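/- For $N\ge 1$ let $\Gamma_N$ be the star graph consisting of $N$ half-lines $[0,\infty)$ with their endpoints $0$ identified (the vertex), equipped with Lebesgue measure on each edge. Let $X$ be $\mathbb R$ or $\Gamma_N$. The space $H^1(\Gamma_N)$ consists of the functions $\psi$ on $\Gamma_N$ whose restrictions to the $N$ edges belong to $H^1(0,\infty)$ and have a common value at the vertex. For a potential $V:X\to\mathbb R$ with $V_-\in L_p(X)$ for some $1\le p<\infty$ and $V_+\in L_1^{\rm loc}(X)$, let $H_V=-\frac{d^2}{dx^2}+V$ be the self-adjoint operator in $L_2(X)$ associated with the lower semibounded closed quadratic form $$h[\psi]=\int_X\left(|\psi'|^2+V|\psi|^2\right)dx,\qquad \psi\in H^1(X)\cap L_2(X,V_+\,dx),$$ and let $\operatorname{tr}(H_V)_-^\gamma$ be the sum of $|E|^\gamma$ over the negative eigenvalues $E$ of $H_V$, counted with multiplicities. A potential on $\Gamma_N$ is called radial if $V(x)$ depends only on the distance of $x$ from the vertex. Let $L_\gamma\in[0,\infty]$ be the optimal (smallest possible) constant such that $$\operatorname{tr}(H_V)_-^\gamma\le L_\gamma\int_{\mathbb R}V_-^{\gamma+1/2}\,dx$$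 for all such potentials $V$ on $X=\mathbb R$, and let $L^{(\rm rad)}_{\gamma,N}\in[0,\infty]$ be the optimal constant such that $$\operatorname{tr}(H_V)_-^\gamma\le L^{(\rm rad)}_{\gamma,N}\int_{\Gamma_N}V_-^{\gamma+1/2}\,dx$$ for all such radial potentials $V$ on $X=\Gamma_N$. Theorem. For every $\gamma\ge 1/2$ and every integer $N\ge 2$, $$L^{(\rm rad)}_{\gamma,N}=L_\gamma .$$ -/

import Mathlib

open MeasureTheory Set
open scoped ENNReal ComplexConjugate

noncomputable section

/-! ### Schrödinger operators defined through quadratic forms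

`X` is the real line or a star graph, with its Lebesgue measure `μ`. The Sobolev space `H¹(X)` is
represented by the graph `D` of the derivative, i.e. by the set of pairs `(ψ, ψ')` in
`L² × L²` such that `ψ` is in `H¹(X)` with derivative `ψ'`. -/

section Schrodinger

variable {X : Type*} [TopologicalSpace X] [MeasurableSpace X] (μ : Measure X)

/-- The potentials for which the Schrödinger operator is defined:
`V₋ ∈ L_p` for some `1 ≤ p < ∞` and `V₊ ∈ L_1^loc`. -/
def IsAdmissiblePotential (V : X → ℝ) : Prop :=
  (∃ p : ℝ≥0∞, 1 ≤ p ∧ p ≠ ∞ ∧ MemLp (fun x => (V x)⁻) p μ) ∧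
    LocallyIntegrable (fun x => (V x)⁺) μ

variable {μ}

/-- Pairs `(ψ, ψ')` with `ψ` in the form domain `H¹(X) ∩ L²(X, V₊ dx)`. -/
def formDomain (D : Set (Lp ℂ 2 μ × Lp ℂ 2 μ)) (V : X → ℝ) : Set (Lp ℂ 2 μ × Lp ℂ 2 μ) :=
  {u | u ∈ D ∧ Integrable (fun x => (V x)⁺ * ‖u.1 x‖ ^ 2) μ}

/-- The sesquilinear form `h[φ, ψ] = ∫ (conj φ' ψ' + V conj φ ψ) dx`, for `u = (φ, φ')` and
`w = (ψ, ψ')`. -/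
def schrodingerForm (V : X → ℝ) (u w : Lp ℂ 2 μ × Lp ℂ 2 μ) : ℂ :=
  (∫ x, conj (u.2 x) * w.2 x ∂μ) + ∫ x, (V x : ℂ) * (conj (u.1 x) * w.1 x) ∂μ

/-- The (graph of the) operator `H = -d²/dx² + V` associated with the form: `ψ` is in the domain
of `H` and `H ψ = f` iff `ψ` is in the form domain and `h[φ, ψ] = ⟨φ, f⟩` for every `φ` in the
form domain. -/
def IsSchrodingerImage (D : Set (Lp ℂ 2 μ × Lp ℂ 2 μ)) (V : X → ℝ) (ψ f : Lp ℂ 2 μ) : Prop :=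
  ∃ ψ' : Lp ℂ 2 μ, (ψ, ψ') ∈ formDomain D V ∧
    ∀ u ∈ formDomain D V, schrodingerForm V u (ψ, ψ') = inner ℂ u.1 f

/-- The multiplicity of `E` as an eigenvalue of `H` (zero if `E` is not an eigenvalue): the
dimension of the space of all `ψ` with `H ψ = E ψ`. -/
def eigenMultiplicity (D : Set (Lp ℂ 2 μ × Lp ℂ 2 μ)) (V : X → ℝ) (E : ℝ) : ℕ∞ :=
  Cardinal.toENat
    (Module.rank ℂ (Submodule.span ℂ {ψ : Lp ℂ 2 μ | IsSchrodingerImage D V ψ ((E : ℂ) • ψ)}))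

/-- `tr H₋^γ`: the sum of `|E|^γ` over the negative eigenvalues `E` of `H`, counted with
multiplicities. -/
def negTrace (D : Set (Lp ℂ 2 μ × Lp ℂ 2 μ)) (V : X → ℝ) (γ : ℝ) : ℝ≥0∞ :=
  ∑' E : Iio (0 : ℝ), (eigenMultiplicity D V E : ℝ≥0∞) * ENNReal.ofReal (|(E : ℝ)| ^ γ)

/-- The optimal (smallest possible) constant `C` in
`tr H₋^γ ≤ C ∫ V₋^(γ+1/2) dx`, where `V` runs over the admissible potentials in the class `P`. -/
def optimalConst (D : Set (Lp ℂ 2 μ × Lp ℂ 2 μ)) (P : (X → ℝ) → Prop) (γ : ℝ) : ℝ≥0∞ :=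
  sInf {C : ℝ≥0∞ | ∀ V : X → ℝ, IsAdmissiblePotential μ V → P V →
    negTrace D V γ ≤ C * ∫⁻ x, ENNReal.ofReal ((V x)⁻ ^ (γ + 1 / 2)) ∂μ}

end Schrodinger

/-! ### The real line -/

/-- `H¹(ℝ)`: pairs `(ψ, ψ')` in `L²(ℝ) × L²(ℝ)` such that `ψ` has an (absolutely continuous)
representative which is an antiderivative of `ψ'`. -/
def sobolevLine : Set (Lp ℂ 2 (volume : Measure ℝ) × Lp ℂ 2 (volume : Measure ℝ)) :=
  {u | ∃ c : ℂ, ∀ᵐ x : ℝ, u.1 x = c + ∫ t in (0 : ℝ)..x, u.2 t}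

/-- The optimal constant `L_γ` of the Lieb–Thirring inequality on `ℝ`. -/
def lineConst (γ : ℝ) : ℝ≥0∞ :=
  optimalConst sobolevLine (fun _ => True) γ

/-! ### The star graph `Γ_N` -/

/-- Lebesgue measure on `Γ_N`: the point at distance `x > 0` from the vertex on the edge `j` is
`(j, x)`, and the measure does not charge any other pair `(j, x)`, nor does it see the vertex. -/
def starMeasure (N : ℕ) : Measure (Fin N × ℝ) :=
  Measure.count.prod (volume.restrict (Ioi 0))

/-- `H¹(Γ_N)`: pairs `(ψ, ψ')` in `L²(Γ_N) × L²(Γ_N)` such that on every edge `ψ` has an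
(absolutely continuous) representative which is an antiderivative of `ψ'`, and the values `c` of
these representatives at the vertex coincide. -/
def sobolevStar (N : ℕ) : Set (Lp ℂ 2 (starMeasure N) × Lp ℂ 2 (starMeasure N)) :=
  {u | ∃ c : ℂ, ∀ j : Fin N, ∀ᵐ x ∂(volume.restrict (Ioi (0 : ℝ))),
    u.1 (j, x) = c + ∫ t in (0 : ℝ)..x, u.2 (j, t)}

/-- `V(x)` depends only on the distance of `x` from the vertex. -/
def IsRadial {N : ℕ} (V : Fin N × ℝ → ℝ) : Prop :=
  ∀ j k : Fin N, ∀ x : ℝ, 0 < x → V (j, x) = V (k, x)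

/-- The optimal constant of the Lieb–Thirring inequality on `Γ_N` for radial potentials. -/
def starRadialConst (γ : ℝ) (N : ℕ) : ℝ≥0∞ :=
  optimalConst (sobolevStar N) IsRadial γ

end

/-!
By the layer cake formula, `tr (H_V)₋^γ` is the integral over `s > 0` of the number of eigenvalues
of `H_V` below `-s^{1/γ}`, so everything reduces to comparing such counting functions.

* From the line to the star graph: for a radial potential `V` the operator on `Γ_N` decomposes into
  one Neumann and `N - 1` Dirichlet operators on the half-line, and the operator on `ℝ` with the
  even potential `V(|x|)` into one Neumann and one Dirichlet operator. Dirichlet counts are at most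
  Neumann counts, hence `2 n_star ≤ N n_line`. The integrals of `V₋^{γ+1/2}` have ratio `N / 2`.
* From the star graph to the line: put `V(x - n)` on every edge. Cutting off a trial space for
  `V` on `ℝ` near `-n` and copying it to the `N` edges gives `N n_line ≤ n_star` as `n → ∞`. Fatou's
  lemma and a scaling `t → 1`, which makes the spectral inequalities strict, conclude.

The form domain is made complete, and the form bounded, by recording a function `ψ` as the
quadruple `(ψ, ψ', √V₊ ψ, √V₋ ψ)`; the form is then a fixed Hermitian form, and only the space of
quadruples depends on `V`.
-/

open Filter Topology

noncomputable section

/-! ### Hermitian pencils -/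

/-- A bounded Hermitian form `h` on `K` together with a bounded map `J : K → H`. A form domain,
complete for its form norm, plays the role of `K`, and `J` is its inclusion into the Hilbert space
in which the associated operator acts: its eigenvalue equation is `h[v, u] = E ⟨J v, J u⟩`. -/
structure HermitianPencil (K H : Type*) [NormedAddCommGroup K] [NormedSpace ℂ K]
    [NormedAddCommGroup H] [InnerProductSpace ℂ H] where
  form : K →L⋆[ℂ] K →L[ℂ] ℂ
  embed : K →L[ℂ] H
  conj_form : ∀ u w, conj (form w u) = form u w

namespace HermitianPencil

variable {K H : Type*} [NormedAddCommGroup K] [NormedSpace ℂ K]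
  [NormedAddCommGroup H] [InnerProductSpace ℂ H] (𝔥 : HermitianPencil K H)

/-- The form `h[u, w] - E ⟨J u, J w⟩` of the operator shifted by `E`. -/
def shift (E : ℝ) : K →L⋆[ℂ] K →L[ℂ] ℂ :=
  𝔥.form - (E : ℂ) • (innerSL ℂ).bilinearComp 𝔥.embed 𝔥.embed

lemma shift_apply (E : ℝ) (u w : K) :
    𝔥.shift E u w = 𝔥.form u w - (E : ℂ) * inner ℂ (𝔥.embed u) (𝔥.embed w) := rfl

lemma shift_eq_add (E E' : ℝ) (u w : K) :
    𝔥.shift E u w = 𝔥.shift E' u w + ((E' : ℂ) - E) * inner ℂ (𝔥.embed u) (𝔥.embed w) := by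
  simp only [shift_apply]; ring

lemma conj_shift (E : ℝ) (u w : K) : conj (𝔥.shift E w u) = 𝔥.shift E u w := by
  simp [shift_apply, 𝔥.conj_form, inner_conj_symm]

/-- The quadratic form `h[u] - E ‖J u‖²`. -/
def energy (E : ℝ) (u : K) : ℝ := (𝔥.shift E u u).re

lemma energy_eq_add (E E' : ℝ) (u : K) :
    𝔥.energy E u = 𝔥.energy E' u + (E' - E) * ‖𝔥.embed u‖ ^ 2 := by
  have h : ((E' : ℂ) - E) * inner ℂ (𝔥.embed u) (𝔥.embed u)
      = ((E' - E) * ‖𝔥.embed u‖ ^ 2 : ℝ) := by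
    rw [inner_self_eq_norm_sq_to_K]; push_cast; rfl
  rw [energy, 𝔥.shift_eq_add E E', h, Complex.add_re, Complex.ofReal_re, energy]

lemma energy_smul (E : ℝ) (z : ℂ) (u : K) : 𝔥.energy E (z • u) = ‖z‖ ^ 2 * 𝔥.energy E u := by
  have h : conj z * z = ((‖z‖ ^ 2 : ℝ) : ℂ) := by rw [Complex.conj_mul']; norm_cast
  simp only [energy, map_smul, map_smulₛₗ, smul_apply, smul_eq_mul]
  rw [mul_left_comm, ← mul_assoc, h, Complex.re_ofReal_mul]

lemma energy_add (E : ℝ) (u v : K) :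
    𝔥.energy E (u + v) = 𝔥.energy E u + 𝔥.energy E v + 2 * (𝔥.shift E u v).re := by
  have h : (𝔥.shift E v u).re = (𝔥.shift E u v).re := by rw [← 𝔥.conj_shift E v u, Complex.conj_re]
  simp only [energy, map_add, add_apply, Complex.add_re, h]; ring

lemma energy_sub (E : ℝ) (u v : K) :
    𝔥.energy E (u - v) = 2 * 𝔥.energy E u + 2 * 𝔥.energy E v - 𝔥.energy E (u + v) := by
  simp only [energy, map_add, map_sub, add_apply,
    sub_apply, Complex.add_re, Complex.sub_re]; ring

lemma continuous_energy (E : ℝ) : Continuous (𝔥.energy E) :=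
  Complex.continuous_re.comp (((𝔥.shift E).continuous.clm_apply continuous_id))

/-- The elements of the form domain `Q` which solve the eigenvalue equation with eigenvalue `E`
when tested against `Q`. -/
def eigenvectors (Q : Submodule ℂ K) (E : ℝ) : Submodule ℂ K :=
  Q ⊓ ⨅ u ∈ Q, LinearMap.ker (𝔥.shift E u).toLinearMap

/-- The eigenspace, as a subspace of the Hilbert space `H`. -/
def eigenspace (Q : Submodule ℂ K) (E : ℝ) : Submodule ℂ H :=
  (𝔥.eigenvectors Q E).map 𝔥.embed.toLinearMap

/-- The multiplicity of `E` as an eigenvalue of the operator with form domain `Q`. -/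
def multiplicity (Q : Submodule ℂ K) (E : ℝ) : ℕ∞ :=
  Cardinal.toENat (Module.rank ℂ (𝔥.eigenspace Q E))

/-- On `Q`, the form shifted by `E` is coercive up to a finite-rank perturbation. This is how
discreteness of the spectrum below `E` enters. -/
def IsCoerciveAt (Q : Submodule ℂ K) (E : ℝ) : Prop :=
  ∃ c > 0, ∃ (n : ℕ) (ℓ : H →L[ℂ] EuclideanSpace ℂ (Fin n)), ∀ w ∈ Q,
    c * ‖w‖ ^ 2 ≤ 𝔥.energy E w + ‖ℓ (𝔥.embed w)‖ ^ 2

variable {𝔥} {P Q : Submodule ℂ K} {E E' : ℝ}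

lemma mem_eigenvectors {w : K} :
    w ∈ 𝔥.eigenvectors Q E ↔ w ∈ Q ∧ ∀ u ∈ Q, 𝔥.shift E u w = 0 := by
  simp [eigenvectors]

lemma IsCoerciveAt.mono_submodule (h : 𝔥.IsCoerciveAt Q E) (hP : P ≤ Q) : 𝔥.IsCoerciveAt P E := by
  obtain ⟨c, hc, n, ℓ, h⟩ := h
  exact ⟨c, hc, n, ℓ, fun w hw => h w (hP hw)⟩

lemma IsCoerciveAt.anti_level (h : 𝔥.IsCoerciveAt Q E) (hE : E' ≤ E) : 𝔥.IsCoerciveAt Q E' := by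
  obtain ⟨c, hc, n, ℓ, h⟩ := h
  refine ⟨c, hc, n, ℓ, fun w hw => (h w hw).trans ?_⟩
  rw [𝔥.energy_eq_add E' E]
  have : 0 ≤ (E - E') * ‖𝔥.embed w‖ ^ 2 := mul_nonneg (sub_nonneg.2 hE) (sq_nonneg _)
  linarith

lemma IsCoerciveAt.embed_ne_zero (h : 𝔥.IsCoerciveAt Q E) {w : K} (hw : w ∈ Q) (hw0 : w ≠ 0)
    (hle : 𝔥.energy E w ≤ 0) : 𝔥.embed w ≠ 0 := by
  obtain ⟨c, hc, n, ℓ, h⟩ := h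
  intro hembed
  have hcoercive := h w hw
  have hpos : 0 < c * ‖w‖ ^ 2 := by positivity
  rw [hembed, map_zero, norm_zero] at hcoercive
  linarith

/-! ### Ground states -/

lemma shift_eq_zero_of_energy_eq_zero (hP : ∀ w ∈ P, 0 ≤ 𝔥.energy E w) {u : K} (hu : u ∈ P)
    (hu0 : 𝔥.energy E u = 0) {v : K} (hv : v ∈ P) : 𝔥.shift E v u = 0 := by
  have re_eq_zero : ∀ v ∈ P, (𝔥.shift E v u).re = 0 := by
    intro v hv
    have h (t : ℝ) : 0 ≤ 𝔥.energy E v * (t * t) + 2 * (𝔥.shift E v u).re * t + 0 := by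
      have := hP _ (P.add_mem (P.smul_mem (t : ℂ) hv) hu)
      rw [energy_add, energy_smul, hu0] at this
      simp only [map_smulₛₗ, smul_apply, smul_eq_mul, Complex.conj_ofReal,
        Complex.re_ofReal_mul, Complex.norm_real, Real.norm_eq_abs, sq_abs] at this
      linarith
    have hdiscrim := discrim_le_zero h
    rw [discrim] at hdiscrim
    nlinarith
  refine Complex.ext (re_eq_zero v hv) ?_
  simpa [map_smulₛₗ] using re_eq_zero _ (P.smul_mem Complex.I hv)

variable (𝔥) in
/-- The values of the form `h` on the elements `w` of `P` with `‖J w‖ = 1`. -/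
def numericalRange (P : Submodule ℂ K) : Set ℝ :=
  {r | ∃ w ∈ P, ‖𝔥.embed w‖ = 1 ∧ 𝔥.energy 0 w = r}

lemma div_mem_numericalRange {w : K} (hw : w ∈ P) (hembed : 𝔥.embed w ≠ 0) :
    𝔥.energy 0 w / ‖𝔥.embed w‖ ^ 2 ∈ 𝔥.numericalRange P := by
  refine ⟨((‖𝔥.embed w‖⁻¹ : ℝ) : ℂ) • w, P.smul_mem _ hw, ?_, ?_⟩
  · rw [map_smul, norm_smul]; simp [hembed]
  · rw [energy_smul]; simp only [Complex.norm_real, norm_inv, norm_norm]; field_simp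

lemma IsCoerciveAt.bddBelow_numericalRange (h : 𝔥.IsCoerciveAt P E) :
    BddBelow (𝔥.numericalRange P) := by
  obtain ⟨c, hc, n, ℓ, h⟩ := h
  refine ⟨E - ‖ℓ‖ ^ 2, ?_⟩
  rintro r ⟨w, hw, hnorm, rfl⟩
  have hcoercive := h w hw
  have hpos : 0 ≤ c * ‖w‖ ^ 2 := by positivity
  have hfunctional : ‖ℓ (𝔥.embed w)‖ ^ 2 ≤ ‖ℓ‖ ^ 2 := by
    gcongr
    simpa only [hnorm, mul_one] using ℓ.le_opNorm (𝔥.embed w)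
  rw [𝔥.energy_eq_add E 0, hnorm] at hcoercive
  linarith

lemma IsCoerciveAt.energy_sInf_nonneg (h : 𝔥.IsCoerciveAt P E) {w : K} (hw : w ∈ P) :
    0 ≤ 𝔥.energy (sInf (𝔥.numericalRange P)) w := by
  rcases eq_or_ne (𝔥.embed w) 0 with hembed | hembed
  · have henergy : 𝔥.energy (sInf (𝔥.numericalRange P)) w = 𝔥.energy E w := by
      rw [𝔥.energy_eq_add _ E, hembed]; simp
    rw [henergy]
    by_contra! hlt
    exact h.embed_ne_zero hw (by rintro rfl; simp [energy] at hlt) hlt.le hembed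
  · have hle := csInf_le h.bddBelow_numericalRange (div_mem_numericalRange hw hembed)
    rw [le_div_iff₀ (by positivity)] at hle
    rw [𝔥.energy_eq_add _ 0]
    linarith

-- The parallelogram law bounds the energy of `w n - w k` by those of `w n` and `w k`, and the
-- finite-rank part of coercivity converges along a subsequence.
lemma IsCoerciveAt.exists_subseq_cauchySeq (h : 𝔥.IsCoerciveAt P E)
    (hnonneg : ∀ w ∈ P, 0 ≤ 𝔥.energy E w) {w : ℕ → K} (hw : ∀ n, w n ∈ P)
    (hbdd : ∀ n, ‖𝔥.embed (w n)‖ ≤ 1) (hlim : Tendsto (fun n => 𝔥.energy E (w n)) atTop (𝓝 0)) :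
    ∃ φ : ℕ → ℕ, StrictMono φ ∧ CauchySeq fun n => w (φ n) := by
  obtain ⟨c, hc, m, ℓ, hco⟩ := h
  have hℓ : ∀ n, ℓ (𝔥.embed (w n)) ∈ Metric.closedBall 0 ‖ℓ‖ := fun n =>
    mem_closedBall_zero_iff.2 (ℓ.le_of_opNorm_le_of_le le_rfl (hbdd n) |>.trans_eq (mul_one _))
  obtain ⟨z, -, φ, hφ, hz⟩ := tendsto_subseq_of_bounded Metric.isBounded_closedBall hℓ
  refine ⟨φ, hφ, cauchySeq_iff_tendsto_dist_atTop_0.2 ?_⟩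
  have hdiff (p : ℕ × ℕ) : ‖w (φ p.1) - w (φ p.2)‖ ^ 2 ≤ c⁻¹ * (2 * 𝔥.energy E (w (φ p.1))
      + 2 * 𝔥.energy E (w (φ p.2))
      + ‖ℓ (𝔥.embed (w (φ p.1))) - ℓ (𝔥.embed (w (φ p.2)))‖ ^ 2) := by
    have hsub := hco _ (P.sub_mem (hw (φ p.1)) (hw (φ p.2)))
    have hadd := hnonneg _ (P.add_mem (hw (φ p.1)) (hw (φ p.2)))
    rw [energy_sub, map_sub, map_sub] at hsub
    rw [← div_eq_inv_mul, le_div_iff₀ hc]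
    linarith
  have tfst : Tendsto (fun p : ℕ × ℕ => p.1) atTop atTop := by
    rw [← prod_atTop_atTop_eq]; exact tendsto_fst
  have tsnd : Tendsto (fun p : ℕ × ℕ => p.2) atTop atTop := by
    rw [← prod_atTop_atTop_eq]; exact tendsto_snd
  have henergy := (hlim.comp hφ.tendsto_atTop).const_mul 2
  have hbound := (((henergy.comp tfst).add (henergy.comp tsnd)).add
    (((hz.comp tfst).sub (hz.comp tsnd)).norm.pow 2)).const_mul c⁻¹
  simp only [mul_zero, add_zero, sub_self, norm_zero, ne_eq, OfNat.ofNat_ne_zero,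
    not_false_eq_true, zero_pow] at hbound
  have hsq := (squeeze_zero (fun _ => by positivity) hdiff hbound).sqrt
  simp only [Real.sqrt_zero] at hsq
  refine hsq.congr fun p => ?_
  rw [Real.sqrt_sq (norm_nonneg _), dist_eq_norm]

lemma IsCoerciveAt.exists_groundState [CompleteSpace K] (hE : 𝔥.IsCoerciveAt P E)
    (hP : IsClosed (P : Set K)) {w₀ : K} (hw₀ : w₀ ∈ P) (hw₀0 : w₀ ≠ 0)
    (hw₀E : 𝔥.energy E w₀ ≤ 0) :
    ∃ E' ≤ E, ∃ u ∈ P, 𝔥.embed u ≠ 0 ∧ ∀ v ∈ P, 𝔥.shift E' v u = 0 := by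
  have hJw₀ := hE.embed_ne_zero hw₀ hw₀0 hw₀E
  have hmem := div_mem_numericalRange hw₀ hJw₀
  have hnonneg : ∀ w ∈ P, _ := fun w hw => hE.energy_sInf_nonneg hw
  set E' := sInf (𝔥.numericalRange P) with hE'
  have hE'E : E' ≤ E := by
    refine (csInf_le hE.bddBelow_numericalRange hmem).trans ?_
    rw [𝔥.energy_eq_add E 0] at hw₀E
    rw [div_le_iff₀ (by positivity)]
    linarith
  obtain ⟨r, -, hr, hrmem⟩ :=
    exists_seq_tendsto_sInf ⟨_, hmem⟩ hE.bddBelow_numericalRange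
  choose w hw hnorm hwr using hrmem
  have hlim : Tendsto (fun n => 𝔥.energy E' (w n)) atTop (𝓝 0) := by
    have h (n : ℕ) : r n - E' = 𝔥.energy E' (w n) := by
      rw [𝔥.energy_eq_add E' 0, hwr, hnorm]; ring
    have hsub := hr.sub_const E'
    rw [← hE', sub_self] at hsub
    exact hsub.congr h
  obtain ⟨φ, hφ, hcauchy⟩ := (hE.anti_level hE'E).exists_subseq_cauchySeq hnonneg hw
    (fun n => (hnorm n).le) hlim
  obtain ⟨u, hu⟩ := cauchySeq_tendsto_of_complete hcauchy
  have huP : u ∈ P := hP.mem_of_tendsto hu (Eventually.of_forall fun n => hw _)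
  have hu1 : ‖𝔥.embed u‖ = 1 := by
    have := ((𝔥.embed.continuous.tendsto u).comp hu).norm
    simp only [Function.comp_def, hnorm] at this
    exact tendsto_nhds_unique this tendsto_const_nhds
  have hu0 : 𝔥.energy E' u = 0 :=
    tendsto_nhds_unique (((𝔥.continuous_energy E').tendsto u).comp hu)
      (hlim.comp hφ.tendsto_atTop)
  exact ⟨E', hE'E, u, huP, norm_ne_zero_iff.1 (by simp [hu1]),
    fun v hv => shift_eq_zero_of_energy_eq_zero hnonneg huP hu0 hv⟩

end HermitianPencil

section Counting

/-! ### Counting eigenvalues -/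

lemma toENNReal_tsum {ι : Type*} (m : ι → ℕ∞) :
    ((∑' i, m i : ℕ∞) : ℝ≥0∞) = ∑' i, (m i : ℝ≥0∞) :=
  ENat.isClosedEmbedding_toENNReal.map_tsum m (g := ENat.toENNRealRingHom)

/-- The number of points `x ≤ E`, counted with the multiplicities `m x`. -/
def countBelow (m : ℝ → ℕ∞) (E : ℝ) : ℕ∞ := ∑' x : Iic E, m x

lemma toENNReal_countBelow (m : ℝ → ℕ∞) (E : ℝ) :
    (countBelow m E : ℝ≥0∞) = ∑' x, (Iic E).indicator (fun x => (m x : ℝ≥0∞)) x := by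
  rw [countBelow, toENNReal_tsum, tsum_subtype _ fun x => (m x : ℝ≥0∞)]

lemma countBelow_mono (m : ℝ → ℕ∞) : Monotone (countBelow m) := fun E E' h => by
  rw [← ENat.toENNReal_le, toENNReal_countBelow, toENNReal_countBelow]
  exact ENNReal.tsum_le_tsum fun x =>
    indicator_le_indicator_of_subset (Iic_subset_Iic.2 h) (fun _ => zero_le) x

lemma tsum_mul_abs_rpow_eq_lintegral (m : ℝ → ℕ∞) {γ t : ℝ} (hγ : 0 < γ) (ht : 0 < t) :
    ∑' x : Iio (0 : ℝ), (m x : ℝ≥0∞) * ENNReal.ofReal ((t * |(x : ℝ)|) ^ γ)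
      = ∫⁻ s in Ioi (0 : ℝ), (countBelow m (-(s ^ (1 / γ)) / t) : ℝ≥0∞) := by
  let _ : MeasurableSpace (Iio (0 : ℝ)) := ⊤
  have : MeasurableSingletonClass (Iio (0 : ℝ)) := ⟨fun _ => trivial⟩
  set ν : Measure (Iio (0 : ℝ)) := Measure.count.withDensity fun x => (m x : ℝ≥0∞)
  have hsum : ∑' x : Iio (0 : ℝ), (m x : ℝ≥0∞) * ENNReal.ofReal ((t * |(x : ℝ)|) ^ γ)
      = ∫⁻ x, ENNReal.ofReal ((t * |(x : ℝ)|) ^ γ) ∂ν := by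
    rw [lintegral_withDensity_eq_lintegral_mul _ measurable_from_top measurable_from_top,
      lintegral_count]
    rfl
  have hm : Measurable fun x : Iio (0 : ℝ) => (t * |(x : ℝ)|) ^ γ := measurable_from_top
  rw [hsum, lintegral_eq_lintegral_meas_le ν (Eventually.of_forall fun x => by positivity)
    hm.aemeasurable]
  refine setLIntegral_congr_fun measurableSet_Ioi fun s (hs : 0 < s) => ?_
  have hms : MeasurableSet {a : Iio (0 : ℝ) | s ≤ (t * |(a : ℝ)|) ^ γ} := trivial
  have hneg : -(s ^ (1 / γ)) / t < 0 :=
    div_neg_of_neg_of_pos (neg_lt_zero.2 (Real.rpow_pos_of_pos hs _)) ht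
  have hlevel : {a : Iio (0 : ℝ) | s ≤ (t * |(a : ℝ)|) ^ γ} =
      Subtype.val ⁻¹' Iic (-(s ^ (1 / γ)) / t) := by
    ext ⟨x, hx : x < 0⟩
    simp only [mem_ofPred_eq, mem_preimage, mem_Iic]
    rw [one_div, abs_of_neg hx, ← Real.rpow_inv_le_iff_of_pos hs.le (by nlinarith) hγ,
      le_div_iff₀ ht]
    constructor <;> intro h <;> linarith
  rw [withDensity_apply _ hms, ← lintegral_indicator hms, lintegral_count,
    toENNReal_countBelow, hlevel]
  exact tsum_subtype_eq_of_support_subset (f := (Iic _).indicator fun x => (m x : ℝ≥0∞))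
    (support_indicator_subset.trans fun x hx => (mem_Iic.1 hx).trans_lt hneg)

lemma tsum_abs_rpow_eq_lintegral (m : ℝ → ℕ∞) {γ : ℝ} (hγ : 0 < γ) :
    ∑' x : Iio (0 : ℝ), (m x : ℝ≥0∞) * ENNReal.ofReal (|(x : ℝ)| ^ γ)
      = ∫⁻ s in Ioi (0 : ℝ), (countBelow m (-(s ^ (1 / γ))) : ℝ≥0∞) := by
  simpa using tsum_mul_abs_rpow_eq_lintegral m hγ zero_lt_one

lemma exists_finset_le_sum_of_le_tsum {ι : Type*} {m : ι → ℕ∞} {k : ℕ}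
    (hk : (k : ℕ∞) ≤ ∑' i, m i) :
    ∃ (F : Finset ι) (r : ι → ℕ), (∀ i, (r i : ℕ∞) ≤ m i) ∧ k ≤ ∑ i ∈ F, r i := by
  have hr (i : ι) : ((min (m i) k).toNat : ℕ∞) = min (m i) k :=
    ENat.natCast_toNat (ne_top_of_le_ne_top (ENat.natCast_ne_top k) (min_le_right _ _))
  obtain ⟨F, hF⟩ : ∃ F : Finset ι, (k : ℕ∞) ≤ ∑ i ∈ F, m i := by
    rcases k with _ | k
    · exact ⟨∅, by simp⟩
    have hlt : ((k : ℕ∞) : ℝ≥0∞) < ∑' i, (m i : ℝ≥0∞) := by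
      rw [← toENNReal_tsum, ENat.toENNReal_lt]
      exact (Nat.cast_lt.2 k.lt_succ_self).trans_le hk
    obtain ⟨F, hF⟩ := lt_iSup_iff.1 (ENNReal.tsum_eq_iSup_sum (f := fun i => (m i : ℝ≥0∞)) ▸ hlt)
    refine ⟨F, ?_⟩
    have hF' : (k : ℕ∞) < ∑ i ∈ F, m i := by
      rwa [← ENat.toENNReal_lt, show ((∑ i ∈ F, m i : ℕ∞) : ℝ≥0∞) = ∑ i ∈ F, (m i : ℝ≥0∞) from
        map_sum ENat.toENNRealRingHom m F]
    exact_mod_cast Order.add_one_le_of_lt hF'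
  refine ⟨F, fun i => (min (m i) k).toNat, fun i => (hr i).trans_le (min_le_left _ _), ?_⟩
  suffices (k : ℕ∞) ≤ ∑ i ∈ F, min (m i) k by
    rw [← Finset.sum_congr rfl fun i _ => hr i] at this
    exact_mod_cast this
  by_cases h : ∃ i ∈ F, (k : ℕ∞) ≤ m i
  · obtain ⟨i, hi, hki⟩ := h
    calc (k : ℕ∞) = min (m i) k := (min_eq_right hki).symm
      _ ≤ _ := Finset.single_le_sum (f := fun i => min (m i) (k : ℕ∞)) (fun _ _ => zero_le) hi
  · push Not at h
    rwa [Finset.sum_congr rfl fun i hi => min_eq_left (h i hi).le]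

end Counting

section Dimension

lemma finrank_finset_sup_le {𝕜 M ι : Type*} [DivisionRing 𝕜] [AddCommGroup M] [Module 𝕜 M]
    (s : Finset ι) (S : ι → Submodule 𝕜 M) (hS : ∀ i ∈ s, FiniteDimensional 𝕜 (S i)) :
    FiniteDimensional 𝕜 (s.sup S : Submodule 𝕜 M) ∧
      Module.finrank 𝕜 (s.sup S : Submodule 𝕜 M) ≤ ∑ i ∈ s, Module.finrank 𝕜 (S i) := by
  classical
  induction s using Finset.induction_on with
  | empty => rw [Finset.sup_empty]; exact ⟨inferInstance, by simp⟩
  | insert i s hi ih =>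
    obtain ⟨hfin, hle⟩ := ih fun j hj => hS j (Finset.mem_insert_of_mem hj)
    have := hS i (Finset.mem_insert_self i s)
    rw [Finset.sup_insert, Finset.sum_insert hi]
    exact ⟨inferInstance, (Submodule.finrank_add_le_finrank_add_finrank _ _).trans (by gcongr)⟩

lemma finrank_iSup_lt_of_tsum_lt {𝕜 M ι : Type*} [DivisionRing 𝕜] [AddCommGroup M] [Module 𝕜 M]
    {S : ι → Submodule 𝕜 M} {k : ℕ}
    (hk : ∑' i, (Module.rank 𝕜 (S i)).toENat < k) :
    FiniteDimensional 𝕜 (⨆ i, S i : Submodule 𝕜 M) ∧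
      Module.finrank 𝕜 (⨆ i, S i : Submodule 𝕜 M) < k := by
  rw [← ENat.toENNReal_lt, toENNReal_tsum, ENat.toENNReal_coe] at hk
  have htop : ∑' i, ((Module.rank 𝕜 (S i)).toENat : ℝ≥0∞) ≠ ∞ :=
    (hk.trans (ENNReal.natCast_lt_top _)).ne
  have hfin (i : ι) : FiniteDimensional 𝕜 (S i) := by
    refine Module.rank_lt_aleph0_iff.1 ?_
    by_contra! h
    exact ENNReal.ne_top_of_tsum_ne_top htop i (by rw [Cardinal.toENat_eq_top.2 h]; rfl)
  have hcast (i : ι) : ((Module.rank 𝕜 (S i)).toENat : ℝ≥0∞) = Module.finrank 𝕜 (S i) := by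
    rw [← Module.finrank_eq_rank, Cardinal.toENat_nat]; rfl
  simp only [hcast] at hk htop
  have hF := ENNReal.finite_const_le_of_tsum_ne_top htop one_ne_zero
  have hle : ⨆ i, S i ≤ hF.toFinset.sup S := by
    refine iSup_le fun i => ?_
    by_cases hi : Module.finrank 𝕜 (S i) = 0
    · simp [Submodule.finrank_eq_zero.1 hi]
    · refine Finset.le_sup (hF.mem_toFinset.2 ?_)
      exact_mod_cast Nat.one_le_iff_ne_zero.2 hi
  obtain ⟨hfinF, hrank⟩ := finrank_finset_sup_le hF.toFinset S fun i _ => hfin i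
  refine ⟨Submodule.finiteDimensional_of_le hle, ?_⟩
  have hsum := (ENNReal.sum_le_tsum hF.toFinset).trans_lt hk
  exact (Submodule.finrank_mono hle).trans_lt (hrank.trans_lt (by exact_mod_cast hsum))

variable {𝕜 H : Type*} [RCLike 𝕜] [NormedAddCommGroup H] [InnerProductSpace 𝕜 H]

lemma exists_linearCombination_mem_orthogonal {S : Submodule 𝕜 H} [FiniteDimensional 𝕜 S]
    {ι : Type*} [Fintype ι] (h : ι → H) (hS : Module.finrank 𝕜 S < Fintype.card ι) :
    ∃ a : ι → 𝕜, a ≠ 0 ∧ ∑ i, a i • h i ∈ Sᗮ := by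
  let T : (ι → 𝕜) →ₗ[𝕜] S :=
    S.orthogonalProjectionOnto.toLinearMap ∘ₗ Fintype.linearCombination 𝕜 h
  have hker : LinearMap.ker T ≠ ⊥ := LinearMap.ker_ne_bot_of_finrank_lt (by simpa using hS)
  obtain ⟨a, ha, ha0⟩ := Submodule.exists_mem_ne_zero_of_ne_bot hker
  refine ⟨a, ha0, Submodule.orthogonalProjectionOnto_eq_zero_iff.1 ?_⟩
  simpa [T, Fintype.linearCombination_apply] using ha

lemma exists_orthonormal_mem_of_le_rank {S : Submodule 𝕜 H} {k : ℕ}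
    (hk : (k : ℕ∞) ≤ (Module.rank 𝕜 S).toENat) :
    ∃ v : Fin k → H, Orthonormal 𝕜 v ∧ ∀ i, v i ∈ S := by
  obtain ⟨v, hv⟩ := Module.le_rank_iff.1 (Cardinal.natCast_le_toENat.1 hk)
  have hfin : FiniteDimensional 𝕜 (Submodule.span 𝕜 (range v)) :=
    FiniteDimensional.span_of_finite 𝕜 (finite_range v)
  have hrank : Module.finrank 𝕜 (Submodule.span 𝕜 (range v)) = k := by
    rw [finrank_span_eq_card hv, Fintype.card_fin]
  let b := (stdOrthonormalBasis 𝕜 (Submodule.span 𝕜 (range v))).reindex (finCongr hrank)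
  exact ⟨fun i => (b i : S), (b.orthonormal.comp_linearIsometry
    (S.subtypeₗᵢ.comp (Submodule.subtypeₗᵢ _)) :), fun i => (b i : S).2⟩

end Dimension

namespace HermitianPencil

/-! ### The variational principle -/

variable {K H : Type*} [NormedAddCommGroup K] [NormedSpace ℂ K]
  [NormedAddCommGroup H] [InnerProductSpace ℂ H]
  {𝔥 : HermitianPencil K H} {P Q : Submodule ℂ K} {E E' : ℝ} {ι : Type*}

lemma shift_eq_zero_of_inner_eq_zero {u w : K} (hw : w ∈ 𝔥.eigenvectors Q E) (hu : u ∈ Q)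
    (h : inner ℂ (𝔥.embed w) (𝔥.embed u) = 0) (E' : ℝ) : 𝔥.shift E' w u = 0 := by
  rw [𝔥.shift_eq_add E' E, h, mul_zero, add_zero, ← 𝔥.conj_shift,
    (mem_eigenvectors.1 hw).2 u hu, map_zero]

lemma inner_embed_eq_zero_of_ne (hne : E ≠ E') {u w : K} (hu : u ∈ 𝔥.eigenvectors Q E)
    (hw : w ∈ 𝔥.eigenvectors Q E') : inner ℂ (𝔥.embed u) (𝔥.embed w) = 0 := by
  obtain ⟨huQ, hu⟩ := mem_eigenvectors.1 hu
  obtain ⟨hwQ, hw⟩ := mem_eigenvectors.1 hw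
  have h := hu w hwQ
  rw [← 𝔥.conj_shift, map_eq_zero, 𝔥.shift_eq_add E E', hw u huQ, zero_add, mul_eq_zero] at h
  exact h.resolve_left fun h => hne (by exact_mod_cast (sub_eq_zero.1 h).symm)

lemma mem_eigenvectors_of_mem_orthogonal {e : ι → ℝ}
    [(⨆ i, 𝔥.eigenspace Q (e i)).HasOrthogonalProjection] {u : K} (hu : u ∈ Q)
    (hJu : 𝔥.embed u ∈ (⨆ i, 𝔥.eigenspace Q (e i))ᗮ)
    (h : ∀ v ∈ Q, 𝔥.embed v ∈ (⨆ i, 𝔥.eigenspace Q (e i))ᗮ → 𝔥.shift E v u = 0) :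
    u ∈ 𝔥.eigenvectors Q E := by
  have hle : ⨆ i, 𝔥.eigenvectors Q (e i) ≤ Q ⊓ LinearMap.ker ((𝔥.shift E).flip u).toLinearMap := by
    refine iSup_le fun i w hw => ⟨(mem_eigenvectors.1 hw).1, ?_⟩
    exact shift_eq_zero_of_inner_eq_zero hw hu
      (hJu _ (Submodule.mem_iSup_of_mem i (Submodule.mem_map_of_mem hw))) E
  refine mem_eigenvectors.2 ⟨hu, fun v hv => ?_⟩
  set S := ⨆ i, 𝔥.eigenspace Q (e i)
  have hmap : S = (⨆ i, 𝔥.eigenvectors Q (e i)).map 𝔥.embed.toLinearMap :=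
    (Submodule.map_iSup _ _).symm
  obtain ⟨x, hx, hxv⟩ := hmap.le (S.orthogonalProjectionOnto (𝔥.embed v)).2
  obtain ⟨hxQ, hx0⟩ := hle hx
  have hvx := h (v - x) (Q.sub_mem hv hxQ) (by
    rw [map_sub, show 𝔥.embed x = _ from hxv]
    exact Submodule.sub_starProjection_mem_orthogonal _)
  rwa [map_sub, sub_apply, show 𝔥.shift E x u = 0 from hx0, sub_zero] at hvx

-- If the eigenspaces below `E` spanned less than the trial space, some trial vector would be
-- orthogonal to them, and the ground state of the form on their orthogonal complement would be a
-- further eigenvector below `E`.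
lemma IsCoerciveAt.card_le_countBelow [CompleteSpace K] (hE : 𝔥.IsCoerciveAt Q E)
    (hQ : IsClosed (Q : Set K)) [Fintype ι] {w : ι → K} (hw : ∀ i, w i ∈ Q)
    (hind : LinearIndependent ℂ w) (hle : ∀ a : ι → ℂ, 𝔥.energy E (∑ i, a i • w i) ≤ 0) :
    (Fintype.card ι : ℕ∞) ≤ countBelow (𝔥.multiplicity Q) E := by
  by_contra! hlt
  obtain ⟨hfin, hrank⟩ := finrank_iSup_lt_of_tsum_lt (S := fun x : Iic E => 𝔥.eigenspace Q x) hlt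
  obtain ⟨a, ha, hort⟩ := exists_linearCombination_mem_orthogonal (fun i => 𝔥.embed (w i)) hrank
  let P := Q ⊓ (⨆ x : Iic E, 𝔥.eigenspace Q x)ᗮ.comap 𝔥.embed.toLinearMap
  have hP : IsClosed (P : Set K) :=
    hQ.inter ((Submodule.isClosed_orthogonal _).preimage 𝔥.embed.continuous)
  have hmem : ∑ i, a i • w i ∈ P :=
    ⟨Q.sum_mem fun i _ => Q.smul_mem _ (hw i), by simpa using hort⟩
  obtain ⟨E', hE', u, ⟨huQ, hJu⟩, hu0, hu⟩ := (hE.mono_submodule inf_le_left).exists_groundState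
    hP hmem (fun h => ha (funext (Fintype.linearIndependent_iff.1 hind a h))) (hle a)
  have heig : u ∈ 𝔥.eigenvectors Q E' :=
    mem_eigenvectors_of_mem_orthogonal huQ hJu fun v hv hJv => hu v ⟨hv, hJv⟩
  have hself := hJu _ (Submodule.mem_iSup_of_mem (⟨E', hE'⟩ : Iic E)
    (Submodule.mem_map_of_mem heig))
  exact hu0 (inner_self_eq_zero.1 hself)

lemma exists_orthonormal_eigenvectors {k : ℕ}
    (hk : (k : ℕ∞) ≤ countBelow (𝔥.multiplicity Q) E) :
    ∃ (w : Fin k → K) (e : Fin k → ℝ), Orthonormal ℂ (fun i => 𝔥.embed (w i)) ∧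
      ∀ i, e i ≤ E ∧ w i ∈ 𝔥.eigenvectors Q (e i) := by
  obtain ⟨F, r, hr, hF⟩ := exists_finset_le_sum_of_le_tsum hk
  have hlift (x : Iic E) : ∃ w : Fin (r x) → K, Orthonormal ℂ (fun i => 𝔥.embed (w i)) ∧
      ∀ i, w i ∈ 𝔥.eigenvectors Q x := by
    obtain ⟨v, hv, hmem⟩ := exists_orthonormal_mem_of_le_rank (hr x)
    choose w hw hwv using hmem
    exact ⟨w, by convert hv using 2 with i; exact hwv i, hw⟩
  choose w hw hwQ using hlift
  have hort : Orthonormal ℂ fun i : (x : F) × Fin (r x) => 𝔥.embed (w i.1 i.2) := by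
    classical
    rw [orthonormal_iff_ite]
    rintro ⟨x, i⟩ ⟨y, j⟩
    by_cases hxy : x = y
    · subst hxy
      simpa using orthonormal_iff_ite.1 (hw x) i j
    · rw [if_neg fun h => hxy (congrArg Sigma.fst h)]
      exact inner_embed_eq_zero_of_ne (fun h => hxy (Subtype.ext (Subtype.ext h)))
        (hwQ x i) (hwQ y j)
  obtain ⟨f⟩ : Nonempty (Fin k ↪ (x : F) × Fin (r x)) := by
    refine Function.Embedding.nonempty_of_card_le ?_
    simpa [Fintype.card_sigma, Finset.sum_attach F r] using hF
  exact ⟨fun i => w (f i).1 (f i).2, fun i => (f i).1, hort.comp f f.injective,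
    fun i => ⟨(f i).1.1.2, hwQ _ _⟩⟩

lemma energy_sum_eigenvectors [Fintype ι] {w : ι → K} {e : ι → ℝ}
    (ho : Orthonormal ℂ (fun i => 𝔥.embed (w i))) (hw : ∀ i, w i ∈ 𝔥.eigenvectors Q (e i)) (E : ℝ)
    (a : ι → ℂ) : 𝔥.energy E (∑ i, a i • w i) = ∑ i, (e i - E) * ‖a i‖ ^ 2 := by
  classical
  have hij (i j : ι) : 𝔥.shift E (w i) (w j) = if i = j then ((e j - E : ℝ) : ℂ) else 0 := by
    rw [𝔥.shift_eq_add E (e j), (mem_eigenvectors.1 (hw j)).2 _ (mem_eigenvectors.1 (hw i)).1,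
      zero_add, orthonormal_iff_ite.1 ho i j]
    split_ifs <;> simp
  have hshift : 𝔥.shift E (∑ i, a i • w i) (∑ i, a i • w i)
      = ∑ i, ((e i - E : ℝ) : ℂ) * (conj (a i) * a i) := by
    simp only [map_sum, sum_apply, map_smulₛₗ, smul_apply, hij, smul_eq_mul, RingHom.id_apply,
      mul_ite, mul_zero, Finset.sum_ite_eq', Finset.mem_univ, if_true]
    exact Finset.sum_congr rfl fun i _ => by ring
  rw [energy, hshift, Complex.re_sum]
  refine Finset.sum_congr rfl fun i _ => ?_
  rw [Complex.conj_mul', Complex.re_ofReal_mul]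
  norm_cast

lemma exists_energy_neg_of_le_countBelow {k : ℕ}
    (hk : (k : ℕ∞) ≤ countBelow (𝔥.multiplicity Q) E) (hE : E < E') :
    ∃ w : Fin k → K, (∀ i, w i ∈ Q) ∧
      ∀ a : Fin k → ℂ, a ≠ 0 → 𝔥.energy E' (∑ i, a i • w i) < 0 := by
  obtain ⟨w, e, ho, hw⟩ := exists_orthonormal_eigenvectors hk
  refine ⟨w, fun i => (mem_eigenvectors.1 (hw i).2).1, fun a ha => ?_⟩
  obtain ⟨i, hi⟩ := Function.ne_iff.1 ha
  rw [energy_sum_eigenvectors ho fun i => (hw i).2]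
  have hneg (j : Fin k) : e j - E' < 0 := by linarith [(hw j).1]
  refine Finset.sum_neg' (fun j _ => mul_nonpos_of_nonpos_of_nonneg (hneg j).le (sq_nonneg _))
    ⟨i, Finset.mem_univ i, mul_neg_of_neg_of_pos (hneg i) ?_⟩
  have : a i ≠ 0 := hi
  positivity

lemma IsCoerciveAt.countBelow_multiplicity_mono [CompleteSpace K] (hE : 𝔥.IsCoerciveAt Q E)
    (hQ : IsClosed (Q : Set K)) (hPQ : P ≤ Q) :
    countBelow (𝔥.multiplicity P) E ≤ countBelow (𝔥.multiplicity Q) E := by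
  refine ENat.forall_natCast_le_iff_le.1 fun k hk => ?_
  obtain ⟨w, e, ho, hw⟩ := exists_orthonormal_eigenvectors hk
  have hle := hE.card_le_countBelow hQ (w := w)
    (fun i => hPQ (mem_eigenvectors.1 (hw i).2).1) (.of_comp 𝔥.embed.toLinearMap
      ho.linearIndependent) fun a => by
        rw [energy_sum_eigenvectors ho fun i => (hw i).2]
        exact Finset.sum_nonpos fun i _ =>
          mul_nonpos_of_nonpos_of_nonneg (sub_nonpos.2 (hw i).1) (sq_nonneg _)
  simpa using hle

lemma eventually_energy_neg [Fintype ι] {w : ι → K}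
    (hw : ∀ a : ι → ℂ, a ≠ 0 → 𝔥.energy E (∑ i, a i • w i) < 0)
    {v : ℕ → ι → K} (hv : ∀ i, Tendsto (fun n => v n i) atTop (𝓝 (w i))) :
    ∀ᶠ n in atTop, ∀ a : ι → ℂ, a ≠ 0 → 𝔥.energy E (∑ i, a i • v n i) < 0 := by
  have hcont : Continuous fun z : (ι → K) × (ι → ℂ) => 𝔥.energy E (∑ i, z.2 i • z.1 i) :=
    (𝔥.continuous_energy E).comp (by fun_prop)
  have hsphere : ∀ᶠ x in 𝓝 w, ∀ a ∈ Metric.sphere (0 : ι → ℂ) 1,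
      𝔥.energy E (∑ i, a i • x i) < 0 := by
    refine (isCompact_sphere _ _).eventually_forall_of_forall_eventually fun a ha => ?_
    exact (hcont.tendsto (w, a)).eventually_lt_const (hw a (ne_zero_of_mem_unit_sphere ⟨a, ha⟩))
  filter_upwards [(tendsto_pi_nhds.2 hv).eventually hsphere] with n hn a ha
  have hunit := hn (((‖a‖⁻¹ : ℝ) : ℂ) • a) (by
    rw [mem_sphere_zero_iff_norm, norm_smul, Complex.norm_real, norm_inv, norm_norm,
      inv_mul_cancel₀ (norm_ne_zero_iff.2 ha)])
  simp only [Pi.smul_apply, smul_assoc, ← Finset.smul_sum, energy_smul] at hunit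
  exact neg_of_mul_neg_right hunit (by positivity)

end HermitianPencil

section FormDomain

/-! ### The form domain of a Schrödinger operator -/

/-- The space of the quadruples `(ψ, ψ', √V₊ ψ, √V₋ ψ)`, in which the form domain of
`-d²/dx² + V` is closed and its form bounded. -/
abbrev Quad (H : Type*) : Type _ := H × H × H × H

/-- The form `⟨ψ', φ'⟩ + ⟨√V₊ ψ, √V₊ φ⟩ - ⟨√V₋ ψ, √V₋ φ⟩` of `-d²/dx² + V` on quadruples. -/
def schrodingerPencil (H : Type*) [NormedAddCommGroup H] [InnerProductSpace ℂ H] :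
    HermitianPencil (Quad H) H where
  form :=
    let deriv := ContinuousLinearMap.fst ℂ H (H × H) ∘L ContinuousLinearMap.snd ℂ H (H × H × H)
    let weighted := ContinuousLinearMap.snd ℂ H (H × H) ∘L ContinuousLinearMap.snd ℂ H (H × H × H)
    let pos := ContinuousLinearMap.fst ℂ H H ∘L weighted
    let neg := ContinuousLinearMap.snd ℂ H H ∘L weighted
    (innerSL ℂ).bilinearComp deriv deriv + (innerSL ℂ).bilinearComp pos pos
      - (innerSL ℂ).bilinearComp neg neg
  embed := ContinuousLinearMap.fst ℂ H (H × H × H)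
  conj_form u w := by simp [inner_conj_symm]

lemma schrodingerPencil_shift_apply {H : Type*} [NormedAddCommGroup H] [InnerProductSpace ℂ H]
    (E : ℝ) (u w : Quad H) :
    (schrodingerPencil H).shift E u w = inner ℂ u.2.1 w.2.1 + inner ℂ u.2.2.1 w.2.2.1
      - inner ℂ u.2.2.2 w.2.2.2 - (E : ℂ) * inner ℂ u.1 w.1 := rfl

variable {X : Type*} [MeasurableSpace X] {μ : Measure X}

/-- The graph of the multiplication by `b`, as an operator in `L²`. -/
def mulGraph (μ : Measure X) (b : X → ℂ) : Submodule ℂ (Lp ℂ 2 μ × Lp ℂ 2 μ) where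
  carrier := {p | p.2 =ᵐ[μ] fun x => b x * p.1 x}
  add_mem' := by
    rintro p q (hp : _ =ᵐ[μ] _) (hq : _ =ᵐ[μ] _)
    filter_upwards [hp, hq, Lp.coeFn_add p.1 q.1, Lp.coeFn_add p.2 q.2] with x h1 h2 h3 h4
    simp only [Prod.fst_add, Prod.snd_add, h3, h4, Pi.add_apply, h1, h2, mul_add]
  zero_mem' := by
    filter_upwards [Lp.coeFn_zero ℂ 2 μ] with x hx
    simp only [Prod.fst_zero, Prod.snd_zero, hx, Pi.zero_apply, mul_zero]
  smul_mem' := by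
    rintro c p (hp : _ =ᵐ[μ] _)
    filter_upwards [hp, Lp.coeFn_smul c p.1, Lp.coeFn_smul c p.2] with x h1 h2 h3
    simp only [Prod.smul_fst, Prod.smul_snd, h2, h3, Pi.smul_apply, h1, smul_eq_mul]; ring

lemma mem_mulGraph {b : X → ℂ} {p : Lp ℂ 2 μ × Lp ℂ 2 μ} :
    p ∈ mulGraph μ b ↔ p.2 =ᵐ[μ] fun x => b x * p.1 x := Iff.rfl

lemma exists_subseq_tendsto_ae {f : ℕ → Lp ℂ 2 μ} {g : Lp ℂ 2 μ} (h : Tendsto f atTop (𝓝 g)) :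
    ∃ φ : ℕ → ℕ, StrictMono φ ∧ ∀ᵐ x ∂μ, Tendsto (fun n => f (φ n) x) atTop (𝓝 (g x)) :=
  (tendstoInMeasure_of_tendsto_Lp h).exists_seq_tendsto_ae

lemma isClosed_mulGraph (b : X → ℂ) :
    IsClosed (mulGraph μ b : Set (Lp ℂ 2 μ × Lp ℂ 2 μ)) := by
  refine IsSeqClosed.isClosed fun p q hp hpq => ?_
  obtain ⟨φ, hφ, hfst⟩ := exists_subseq_tendsto_ae ((continuous_fst.tendsto q).comp hpq)
  obtain ⟨φ', hφ', hsnd⟩ := exists_subseq_tendsto_ae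
    (((continuous_snd.tendsto q).comp hpq).comp hφ.tendsto_atTop)
  have hgraph : ∀ᵐ x ∂μ, ∀ n, (p n).2 x = b x * (p n).1 x := ae_all_iff.2 hp
  refine mem_mulGraph.2 ?_
  filter_upwards [hfst, hsnd, hgraph] with x hfst hsnd hgraph
  have hmul := (hfst.comp hφ'.tendsto_atTop).const_mul (b x)
  exact tendsto_nhds_unique hsnd (hmul.congr fun n => by simp [hgraph])

lemma integrable_mul_norm_sq {b : X → ℝ} (hb : ∀ x, 0 ≤ b x) {p : Lp ℂ 2 μ × Lp ℂ 2 μ}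
    (hp : p ∈ mulGraph μ fun x => (√(b x) : ℂ)) : Integrable (fun x => b x * ‖p.1 x‖ ^ 2) μ := by
  have hsq := (memLp_two_iff_integrable_sq_norm (Lp.aestronglyMeasurable p.2)).1 (Lp.memLp p.2)
  refine hsq.congr ?_
  filter_upwards [mem_mulGraph.1 hp] with x hx
  rw [hx, norm_mul, mul_pow, Complex.norm_real, Real.norm_eq_abs, sq_abs, Real.sq_sqrt (hb x)]

lemma exists_mem_mulGraph {b : X → ℝ} (hbm : AEMeasurable b μ) (hb : ∀ x, 0 ≤ b x)
    {f : Lp ℂ 2 μ} (h : Integrable (fun x => b x * ‖f x‖ ^ 2) μ) :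
    ∃ g : Lp ℂ 2 μ, (f, g) ∈ mulGraph μ fun x => (√(b x) : ℂ) := by
  have hm : AEStronglyMeasurable (fun x => (√(b x) : ℂ) * f x) μ :=
    ((Complex.measurable_ofReal.comp_aemeasurable hbm.sqrt).aestronglyMeasurable).mul
      (Lp.aestronglyMeasurable f)
  have hmem : MemLp (fun x => (√(b x) : ℂ) * f x) 2 μ := by
    rw [memLp_two_iff_integrable_sq_norm hm]
    refine h.congr (Eventually.of_forall fun x => ?_)
    simp only [norm_mul, mul_pow, Complex.norm_real, Real.norm_eq_abs, sq_abs, Real.sq_sqrt (hb x)]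
  exact ⟨hmem.toLp _, hmem.coeFn_toLp⟩

/-- The quadruples `(ψ, ψ', √V₊ ψ, √V₋ ψ)`, where `ψ` and `ψ'` are unrelated. -/
def potentialGraph (μ : Measure X) (V : X → ℝ) : Submodule ℂ (Quad (Lp ℂ 2 μ)) :=
  (mulGraph μ fun x => (√((V x)⁺) : ℂ)).comap ((LinearMap.fst ℂ _ _).prod
      (LinearMap.fst ℂ _ _ ∘ₗ LinearMap.snd ℂ _ _ ∘ₗ LinearMap.snd ℂ _ _)) ⊓
    (mulGraph μ fun x => (√((V x)⁻) : ℂ)).comap ((LinearMap.fst ℂ _ _).prod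
      (LinearMap.snd ℂ _ _ ∘ₗ LinearMap.snd ℂ _ _ ∘ₗ LinearMap.snd ℂ _ _))

/-- The form domain of `-d²/dx² + V` as a space of quadruples `(ψ, ψ', √V₊ ψ, √V₋ ψ)`, for a
Sobolev space `D` of pairs `(ψ, ψ')`. -/
def formGraph (D : Submodule ℂ (Lp ℂ 2 μ × Lp ℂ 2 μ)) (V : X → ℝ) :
    Submodule ℂ (Quad (Lp ℂ 2 μ)) :=
  potentialGraph μ V ⊓ D.comap ((LinearMap.fst ℂ _ _).prod
    (LinearMap.fst ℂ _ _ ∘ₗ LinearMap.snd ℂ _ _))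

variable {D : Submodule ℂ (Lp ℂ 2 μ × Lp ℂ 2 μ)} {V : X → ℝ}

lemma mem_potentialGraph {w : Quad (Lp ℂ 2 μ)} :
    w ∈ potentialGraph μ V ↔ (w.1, w.2.2.1) ∈ mulGraph μ (fun x => (√((V x)⁺) : ℂ)) ∧
      (w.1, w.2.2.2) ∈ mulGraph μ fun x => (√((V x)⁻) : ℂ) := Iff.rfl

lemma mem_formGraph {w : Quad (Lp ℂ 2 μ)} :
    w ∈ formGraph D V ↔ w ∈ potentialGraph μ V ∧ (w.1, w.2.1) ∈ D := Iff.rfl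

lemma isClosed_formGraph (hD : IsClosed (D : Set (Lp ℂ 2 μ × Lp ℂ 2 μ))) (V : X → ℝ) :
    IsClosed (formGraph D V : Set (Quad (Lp ℂ 2 μ))) := by
  have hpos := (isClosed_mulGraph (μ := μ) fun x => (√((V x)⁺) : ℂ)).preimage
    (f := fun w : Quad (Lp ℂ 2 μ) => (w.1, w.2.2.1)) (by fun_prop)
  have hneg := (isClosed_mulGraph (μ := μ) fun x => (√((V x)⁻) : ℂ)).preimage
    (f := fun w : Quad (Lp ℂ 2 μ) => (w.1, w.2.2.2)) (by fun_prop)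
  exact (hpos.inter hneg).inter
    (hD.preimage (f := fun w : Quad (Lp ℂ 2 μ) => (w.1, w.2.1)) (by fun_prop))

lemma exists_mem_formGraph (hV : AEMeasurable V μ) {u : Lp ℂ 2 μ × Lp ℂ 2 μ}
    (hu : u ∈ formDomain (D : Set _) V) (hneg : Integrable (fun x => (V x)⁻ * ‖u.1 x‖ ^ 2) μ) :
    ∃ w ∈ formGraph D V, w.1 = u.1 ∧ w.2.1 = u.2 := by
  obtain ⟨g, hg⟩ := exists_mem_mulGraph (hV.sup_const 0) (fun x => posPart_nonneg (V x)) hu.2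
  obtain ⟨k, hk⟩ := exists_mem_mulGraph (hV.neg.sup_const 0) (fun x => negPart_nonneg (V x)) hneg
  exact ⟨(u.1, u.2, g, k), ⟨⟨hg, hk⟩, hu.1⟩, rfl, rfl⟩

lemma mem_formDomain_of_mem_formGraph {w : Quad (Lp ℂ 2 μ)} (hw : w ∈ formGraph D V) :
    (w.1, w.2.1) ∈ formDomain (D : Set _) V :=
  ⟨hw.2, integrable_mul_norm_sq (p := (w.1, w.2.2.1)) (fun x => posPart_nonneg (V x))
    (mem_potentialGraph.1 hw.1).1⟩

lemma schrodingerForm_sub_inner {u w : Quad (Lp ℂ 2 μ)} (hu : u ∈ potentialGraph μ V)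
    (hw : w ∈ potentialGraph μ V) (E : ℝ) :
    schrodingerForm V (u.1, u.2.1) (w.1, w.2.1) - inner ℂ u.1 ((E : ℂ) • w.1)
      = (schrodingerPencil (Lp ℂ 2 μ)).shift E u w := by
  have hkinetic : ∫ x, conj (u.2.1 x) * w.2.1 x ∂μ = inner ℂ u.2.1 w.2.1 := by
    rw [L2.inner_def]
    exact integral_congr_ae (Eventually.of_forall fun x => by simp [RCLike.inner_apply, mul_comm])
  have hpotential : ∫ x, (V x : ℂ) * (conj (u.1 x) * w.1 x) ∂μ
      = inner ℂ u.2.2.1 w.2.2.1 - inner ℂ u.2.2.2 w.2.2.2 := by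
    rw [L2.inner_def, L2.inner_def, ← integral_sub (L2.integrable_inner _ _)
      (L2.integrable_inner _ _)]
    refine integral_congr_ae ?_
    obtain ⟨hupos, huneg⟩ := mem_potentialGraph.1 hu
    obtain ⟨hwpos, hwneg⟩ := mem_potentialGraph.1 hw
    filter_upwards [mem_mulGraph.1 hupos, mem_mulGraph.1 huneg, mem_mulGraph.1 hwpos,
      mem_mulGraph.1 hwneg] with x hupos huneg hwpos hwneg
    have hpos : (√((V x)⁺) : ℂ) * (√((V x)⁺) : ℂ) = ((V x)⁺ : ℝ) := by
      rw [← Complex.ofReal_mul, Real.mul_self_sqrt (posPart_nonneg _)]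
    have hneg : (√((V x)⁻) : ℂ) * (√((V x)⁻) : ℂ) = ((V x)⁻ : ℝ) := by
      rw [← Complex.ofReal_mul, Real.mul_self_sqrt (negPart_nonneg _)]
    have hv : (V x : ℂ) = ((V x)⁺ : ℝ) - ((V x)⁻ : ℝ) := by
      rw [← Complex.ofReal_sub, posPart_sub_negPart]
    simp only [hupos, huneg, hwpos, hwneg, RCLike.inner_apply, map_mul, Complex.conj_ofReal]
    rw [hv, ← hpos, ← hneg]
    ring
  rw [schrodingerPencil_shift_apply, schrodingerForm, inner_smul_right, hkinetic, hpotential]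
  ring

lemma eigenMultiplicity_eq_multiplicity (hV : AEMeasurable V μ)
    (hD : ∀ u ∈ D, Integrable (fun x => (V x)⁻ * ‖u.1 x‖ ^ 2) μ) (E : ℝ) :
    eigenMultiplicity (D : Set (Lp ℂ 2 μ × Lp ℂ 2 μ)) V E
      = (schrodingerPencil (Lp ℂ 2 μ)).multiplicity (formGraph D V) E := by
  have heig : {ψ : Lp ℂ 2 μ | IsSchrodingerImage (D : Set (Lp ℂ 2 μ × Lp ℂ 2 μ)) V ψ ((E : ℂ) • ψ)}
      = (schrodingerPencil (Lp ℂ 2 μ)).eigenspace (formGraph D V) E := by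
    ext ψ
    constructor
    · rintro ⟨ψ', hdom, heq⟩
      obtain ⟨w, hw, rfl, rfl⟩ := exists_mem_formGraph hV hdom (hD _ hdom.1)
      refine ⟨w, HermitianPencil.mem_eigenvectors.2 ⟨hw, fun u hu => ?_⟩, rfl⟩
      rw [← schrodingerForm_sub_inner hu.1 hw.1, sub_eq_zero]
      exact heq (u.1, u.2.1) (mem_formDomain_of_mem_formGraph hu)
    · rintro ⟨w, hw, rfl⟩
      obtain ⟨hw, heq⟩ := HermitianPencil.mem_eigenvectors.1 hw
      refine ⟨w.2.1, mem_formDomain_of_mem_formGraph hw, fun u hu => ?_⟩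
      obtain ⟨v, hv, hv1, hv2⟩ := exists_mem_formGraph hV hu (hD _ hu.1)
      have hvw := heq v hv
      rwa [← schrodingerForm_sub_inner hv.1 hw.1, sub_eq_zero, hv1, hv2] at hvw
  rw [eigenMultiplicity, heig, Submodule.span_eq]
  rfl

lemma negTrace_eq_lintegral_countBelow (hV : AEMeasurable V μ)
    (hD : ∀ u ∈ D, Integrable (fun x => (V x)⁻ * ‖u.1 x‖ ^ 2) μ) {γ : ℝ} (hγ : 0 < γ) :
    negTrace (D : Set (Lp ℂ 2 μ × Lp ℂ 2 μ)) V γ = ∫⁻ s in Ioi (0 : ℝ),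
      (countBelow ((schrodingerPencil (Lp ℂ 2 μ)).multiplicity (formGraph D V))
        (-(s ^ (1 / γ))) : ℝ≥0∞) := by
  simp_rw [negTrace, eigenMultiplicity_eq_multiplicity hV hD]
  exact tsum_abs_rpow_eq_lintegral _ hγ

end FormDomain

section Transfer

/-! ### Changes of variables in `L²` -/

variable {X Y : Type*} [MeasurableSpace X] [MeasurableSpace Y] {μ : Measure X} {ν : Measure Y}
  {σ : X → Y} {A : Set X}

/-- The conditions under which `f ↦ 1_A (f ∘ σ)` is a contraction from `L²(ν)` to `L²(μ)`. -/
structure IsTransfer (σ : X → Y) (A : Set X) (μ : Measure X) (ν : Measure Y) : Prop where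
  measurable : Measurable σ
  measurableSet : MeasurableSet A
  map_le : (μ.restrict A).map σ ≤ ν

lemma IsTransfer.ae_comp (h : IsTransfer σ A μ ν) {p : Y → Prop} (hp : ∀ᵐ y ∂ν, p y) :
    ∀ᵐ x ∂μ, x ∈ A → p (σ x) :=
  (ae_restrict_iff' h.measurableSet).1
    (ae_of_ae_map h.measurable.aemeasurable (ae_mono h.map_le hp))

lemma IsTransfer.indicator_ae_eq (h : IsTransfer σ A μ ν) {f g : Y → ℂ} (hfg : f =ᵐ[ν] g) :
    A.indicator (f ∘ σ) =ᵐ[μ] A.indicator (g ∘ σ) := by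
  filter_upwards [h.ae_comp hfg] with x hx
  by_cases hxA : x ∈ A
  · simp [hxA, hx hxA]
  · simp [hxA]

lemma IsTransfer.memLp {F : Type*} [NormedAddCommGroup F] (h : IsTransfer σ A μ ν) {f : Y → F}
    {p : ℝ≥0∞} (hf : MemLp f p ν) :
    MemLp (A.indicator (f ∘ σ)) p μ :=
  (memLp_indicator_iff_restrict h.measurableSet).2
    ((hf.mono_measure h.map_le).comp_of_map h.measurable.aemeasurable)

/-- The map `f ↦ 1_A (f ∘ σ)` from `L²(ν)` to `L²(μ)`. -/
def transferLp (h : IsTransfer σ A μ ν) : Lp ℂ 2 ν →ₗ[ℂ] Lp ℂ 2 μ where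
  toFun f := (h.memLp (Lp.memLp f)).toLp _
  map_add' f g := by
    rw [← MemLp.toLp_add]
    refine MemLp.toLp_congr _ _ ((h.indicator_ae_eq (Lp.coeFn_add f g)).trans ?_)
    refine Eventually.of_forall fun x => ?_
    by_cases hx : x ∈ A <;> simp [hx]
  map_smul' c f := by
    rw [RingHom.id_apply, ← MemLp.toLp_const_smul]
    refine MemLp.toLp_congr _ _ ((h.indicator_ae_eq (Lp.coeFn_smul c f)).trans ?_)
    refine Eventually.of_forall fun x => ?_
    by_cases hx : x ∈ A <;> simp [hx]

lemma coeFn_transferLp (h : IsTransfer σ A μ ν) (f : Lp ℂ 2 ν) :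
    transferLp h f =ᵐ[μ] A.indicator (f ∘ σ) := MemLp.coeFn_toLp (h.memLp (Lp.memLp f))

lemma inner_transferLp_left {τ : Y → X} (h : IsTransfer σ A μ ν) (h' : IsTransfer τ univ ν μ)
    (hmap : (μ.restrict A).map σ = ν) (hτ : ∀ x ∈ A, τ (σ x) = x) (f : Lp ℂ 2 ν) (g : Lp ℂ 2 μ) :
    inner ℂ (transferLp h f) g = inner ℂ f (transferLp h' g) := by
  rw [L2.inner_def, L2.inner_def]
  have hright : ∫ y, inner ℂ (f y) (transferLp h' g y) ∂ν = ∫ y, inner ℂ (f y) (g (τ y)) ∂ν := by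
    refine integral_congr_ae ?_
    filter_upwards [coeFn_transferLp h' g] with y hy
    rw [hy]; simp
  have hleft : ∫ x, inner ℂ (transferLp h f x) (g x) ∂μ
      = ∫ x in A, inner ℂ (f (σ x)) (g (τ (σ x))) ∂μ := by
    rw [← integral_indicator h.measurableSet]
    refine integral_congr_ae ?_
    filter_upwards [coeFn_transferLp h f] with x hx
    rw [hx]
    by_cases hxA : x ∈ A
    · simp [hxA, hτ x hxA]
    · simp [hxA]
  have hsm : AEStronglyMeasurable (fun y => inner ℂ (f y) (g (τ y))) ((μ.restrict A).map σ) := by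
    rw [hmap]
    refine (Lp.aestronglyMeasurable f).inner ?_
    have := (h'.memLp (Lp.memLp g)).aestronglyMeasurable
    rwa [indicator_univ] at this
  have hmap_integral := integral_map h.measurable.aemeasurable hsm
  rw [hmap] at hmap_integral
  rw [hright, hleft, hmap_integral]

lemma transferLp_mem_mulGraph (h : IsTransfer σ A μ ν) {b : Y → ℂ} {c : X → ℂ}
    (hbc : ∀ᵐ x ∂μ, x ∈ A → c x = b (σ x)) {p : Lp ℂ 2 ν × Lp ℂ 2 ν} (hp : p ∈ mulGraph ν b) :
    (transferLp h p.1, transferLp h p.2) ∈ mulGraph μ c := by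
  refine mem_mulGraph.2 ?_
  filter_upwards [coeFn_transferLp h p.1, coeFn_transferLp h p.2, h.ae_comp hp, hbc]
    with x hfst hsnd hpx hbx
  rw [hfst, hsnd]
  by_cases hx : x ∈ A
  · simp [hx, hpx hx, hbx hx]
  · simp [hx]

variable {H K : Type*} [NormedAddCommGroup H] [InnerProductSpace ℂ H] [NormedAddCommGroup K]
  [InnerProductSpace ℂ K]

/-- The action of a linear map on quadruples, with a sign `ε` for the derivative. -/
def quadMap (ε : ℝ) (T : H →ₗ[ℂ] K) : Quad H →ₗ[ℂ] Quad K :=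
  T.prodMap (((ε : ℂ) • T).prodMap (T.prodMap T))

lemma quadMap_apply (ε : ℝ) (T : H →ₗ[ℂ] K) (w : Quad H) :
    quadMap ε T w = (T w.1, (ε : ℂ) • T w.2.1, T w.2.2.1, T w.2.2.2) := rfl

lemma shift_quadMap_left {T : H →ₗ[ℂ] K} {T' : K →ₗ[ℂ] H}
    (hT : ∀ f g, inner ℂ (T f) g = inner ℂ f (T' g)) (ε E : ℝ) (u : Quad H) (w : Quad K) :
    (schrodingerPencil K).shift E (quadMap ε T u) w
      = (schrodingerPencil H).shift E u (quadMap ε T' w) := by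
  simp only [schrodingerPencil_shift_apply, quadMap_apply, hT, inner_smul_left, inner_smul_right,
    Complex.conj_ofReal]

lemma quadMap_transferLp_mem_potentialGraph (h : IsTransfer σ A μ ν) {V : Y → ℝ} {W : X → ℝ}
    (hVW : ∀ᵐ x ∂μ, x ∈ A → W x = V (σ x)) (ε : ℝ) {w : Quad (Lp ℂ 2 ν)}
    (hw : w ∈ potentialGraph ν V) : quadMap ε (transferLp h) w ∈ potentialGraph μ W := by
  obtain ⟨hpos, hneg⟩ := mem_potentialGraph.1 hw
  rw [mem_potentialGraph, quadMap_apply]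
  constructor
  · exact transferLp_mem_mulGraph h (p := (w.1, w.2.2.1))
      (hVW.mono fun x hx hxA => by rw [hx hxA]) hpos
  · exact transferLp_mem_mulGraph h (p := (w.1, w.2.2.2))
      (hVW.mono fun x hx hxA => by rw [hx hxA]) hneg

lemma HermitianPencil.map_mem_eigenvectors {K₁ K₂ H₁ H₂ : Type*} [NormedAddCommGroup K₁]
    [NormedSpace ℂ K₁] [NormedAddCommGroup K₂] [NormedSpace ℂ K₂] [NormedAddCommGroup H₁]
    [InnerProductSpace ℂ H₁] [NormedAddCommGroup H₂] [InnerProductSpace ℂ H₂]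
    {𝔥 : HermitianPencil K₁ H₁} {𝔨 : HermitianPencil K₂ H₂} {P : Submodule ℂ K₁}
    {Q : Submodule ℂ K₂} {T : K₁ → K₂} {T' : K₂ → K₁} {E : ℝ} (hT' : ∀ u ∈ Q, T' u ∈ P)
    (hTT' : ∀ u w, 𝔥.shift E (T' u) w = 𝔨.shift E u (T w)) {w : K₁}
    (hw : w ∈ 𝔥.eigenvectors P E) (hTw : T w ∈ Q) : T w ∈ 𝔨.eigenvectors Q E :=
  mem_eigenvectors.2 ⟨hTw, fun u hu => hTT' u w ▸ (mem_eigenvectors.1 hw).2 _ (hT' u hu)⟩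

end Transfer

section Star

/-! ### The star graph -/

variable {N : ℕ}

lemma starMeasure_eq_sum (N : ℕ) :
    starMeasure N = ∑ j : Fin N, ((volume : Measure ℝ).restrict (Ioi 0)).map (Prod.mk j) := by
  ext s hs
  rw [starMeasure, Measure.prod_apply hs, lintegral_count, tsum_fintype, Measure.finsetSum_apply]
  refine Finset.sum_congr rfl fun j _ => ?_
  rw [Measure.map_apply measurable_prodMk_left hs]

lemma map_mk_le_starMeasure (j : Fin N) :
    ((volume : Measure ℝ).restrict (Ioi 0)).map (Prod.mk j) ≤ starMeasure N := by
  rw [starMeasure_eq_sum]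
  exact Finset.single_le_sum (f := fun j : Fin N =>
    ((volume : Measure ℝ).restrict (Ioi 0)).map (Prod.mk j)) (fun _ _ => Measure.zero_le _)
    (Finset.mem_univ j)

lemma lintegral_starMeasure (f : Fin N × ℝ → ℝ≥0∞) :
    ∫⁻ p, f p ∂(starMeasure N) = ∑ j, ∫⁻ x in Ioi (0 : ℝ), f (j, x) := by
  rw [starMeasure_eq_sum, lintegral_finsetSum_measure]
  exact Finset.sum_congr rfl fun j _ => (measurableEmbedding_prodMk_left j).lintegral_map f

lemma ae_starMeasure_iff {p : Fin N × ℝ → Prop} :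
    (∀ᵐ q ∂(starMeasure N), p q) ↔ ∀ j, ∀ᵐ x ∂(volume.restrict (Ioi (0 : ℝ))), p (j, x) := by
  rw [starMeasure_eq_sum, ae_finsetSum_measure_iff]
  simp only [Finset.mem_univ, true_imp_iff]
  exact forall_congr' fun j => (measurableEmbedding_prodMk_left j).ae_map_iff

lemma integral_starMeasure {E : Type*} [NormedAddCommGroup E] [NormedSpace ℝ E]
    {f : Fin N × ℝ → E} (hf : Integrable f (starMeasure N)) :
    ∫ p, f p ∂(starMeasure N) = ∑ j, ∫ x in Ioi (0 : ℝ), f (j, x) := by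
  have hedge : ∀ j ∈ (Finset.univ : Finset (Fin N)),
      Integrable f (((volume : Measure ℝ).restrict (Ioi 0)).map (Prod.mk j)) :=
    fun j _ => hf.mono_measure (map_mk_le_starMeasure j)
  rw [starMeasure_eq_sum, integral_finsetSum_measure hedge]
  exact Finset.sum_congr rfl fun j _ => (measurableEmbedding_prodMk_left j).integral_map f

lemma memLp_edge {E : Type*} [NormedAddCommGroup E] {f : Fin N × ℝ → E} {p : ℝ≥0∞}
    (hf : MemLp f p (starMeasure N)) (j : Fin N) :
    MemLp (fun x => f (j, x)) p (volume.restrict (Ioi (0 : ℝ))) :=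
  (hf.mono_measure (map_mk_le_starMeasure j)).comp_of_map measurable_prodMk_left.aemeasurable

lemma starMeasure_edge_interval_ne_top (j : Fin N) (a b : ℝ) :
    starMeasure N ({j} ×ˢ Ioc a b) ≠ ∞ := by
  rw [starMeasure, Measure.prod_prod]
  exact ENNReal.mul_ne_top (by simp)
    (ne_top_of_le_ne_top (by simp) (Measure.restrict_apply_le (s := Ioi (0 : ℝ)) (Ioc a b)))

/-- The indicator function of an interval on one edge of the star graph. -/
def edgeIndicator (j : Fin N) (a b : ℝ) : Lp ℂ 2 (starMeasure N) :=
  indicatorConstLp 2 ((measurableSet_singleton j).prod measurableSet_Ioc)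
    (starMeasure_edge_interval_ne_top j a b) 1

lemma inner_edgeIndicator (j : Fin N) {a b : ℝ} (ha : 0 ≤ a) (f : Lp ℂ 2 (starMeasure N)) :
    inner ℂ (edgeIndicator j a b) f = ∫ t in Ioc a b, f (j, t) := by
  have hms : MeasurableSet (({j} : Set (Fin N)) ×ˢ Ioc a b) :=
    (measurableSet_singleton j).prod measurableSet_Ioc
  rw [edgeIndicator, L2.inner_indicatorConstLp_one, ← integral_indicator hms]
  have hint : Integrable (indicator (({j} : Set (Fin N)) ×ˢ Ioc a b) f) (starMeasure N) := by
    rw [integrable_indicator_iff hms]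
    have : IsFiniteMeasure ((starMeasure N).restrict ({j} ×ˢ Ioc a b)) :=
      ⟨by simpa using (starMeasure_edge_interval_ne_top j a b).lt_top⟩
    exact ((Lp.memLp f).mono_measure Measure.restrict_le_self).integrable (by norm_num)
  rw [integral_starMeasure hint, Finset.sum_eq_single j]
  · rw [← integral_indicator measurableSet_Ioi, ← integral_indicator measurableSet_Ioc]
    refine integral_congr_ae (Eventually.of_forall fun t => ?_)
    by_cases ht : t ∈ Ioc a b
    · simp [indicator, ht.1, ht.2, ha.trans_lt ht.1]
    · have hjt : (j, t) ∉ ({j} : Set (Fin N)) ×ˢ Ioc a b := fun h => ht h.2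
      simp only [indicator, ht, hjt, if_false, ite_self]
  · intro i _ hij
    have hzero (t : ℝ) : indicator (({j} : Set (Fin N)) ×ˢ Ioc a b) f (i, t) = 0 :=
      indicator_of_notMem (fun h => hij h.1) _
    simp [hzero]
  · simp

lemma intervalIntegral_edge (j : Fin N) {x : ℝ} (hx : 0 < x) (f : Lp ℂ 2 (starMeasure N)) :
    ∫ t in (0 : ℝ)..x, f (j, t) = inner ℂ (edgeIndicator j 0 x) f := by
  rw [inner_edgeIndicator j le_rfl, intervalIntegral.integral_of_le hx.le]

/-- The pairs `(ψ, ψ')` with `ψ` in `H¹` of each edge, together with the values of `ψ` at the ends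
of the edges. -/
def edgeGraph (N : ℕ) : Submodule ℂ
    ((Lp ℂ 2 (starMeasure N) × Lp ℂ 2 (starMeasure N)) × (Fin N → ℂ)) where
  carrier := {q | ∀ᵐ p ∂(starMeasure N),
    q.1.1 p = q.2 p.1 + inner ℂ (edgeIndicator p.1 0 p.2) q.1.2}
  add_mem' := by
    intro a b ha hb
    filter_upwards [ha, hb, Lp.coeFn_add a.1.1 b.1.1] with p hap hbp hadd
    simp only [Prod.fst_add, Prod.snd_add, hadd, Pi.add_apply, hap, hbp, inner_add_right]; ring
  zero_mem' := by
    filter_upwards [Lp.coeFn_zero ℂ 2 (starMeasure N)] with p hp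
    simp only [Prod.fst_zero, Prod.snd_zero, hp, inner_zero_right, Pi.zero_apply, add_zero]
  smul_mem' := by
    intro z a ha
    filter_upwards [ha, Lp.coeFn_smul z a.1.1] with p hap hsmul
    simp only [Prod.smul_fst, Prod.smul_snd, hsmul, Pi.smul_apply, hap, inner_smul_right,
      smul_eq_mul]
    ring

lemma mem_edgeGraph {q : (Lp ℂ 2 (starMeasure N) × Lp ℂ 2 (starMeasure N)) × (Fin N → ℂ)} :
    q ∈ edgeGraph N ↔ ∀ᵐ p ∂(starMeasure N),
      q.1.1 p = q.2 p.1 + inner ℂ (edgeIndicator p.1 0 p.2) q.1.2 := Iff.rfl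

lemma mem_sobolevStar_iff {u : Lp ℂ 2 (starMeasure N) × Lp ℂ 2 (starMeasure N)} :
    u ∈ sobolevStar N ↔ ∃ c : ℂ, (u, fun _ => c) ∈ edgeGraph N := by
  simp only [mem_edgeGraph, ae_starMeasure_iff]
  refine exists_congr fun c => forall_congr' fun j => eventually_congr ?_
  filter_upwards [ae_restrict_mem measurableSet_Ioi] with x hx
  rw [intervalIntegral_edge j hx]

/-- `H¹(Γ_N)` as a subspace. -/
def sobolevStarSubmodule (N : ℕ) :
    Submodule ℂ (Lp ℂ 2 (starMeasure N) × Lp ℂ 2 (starMeasure N)) where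
  carrier := sobolevStar N
  add_mem' := by
    intro a b ha hb
    rw [mem_sobolevStar_iff] at ha hb ⊢
    obtain ⟨c, hc⟩ := ha
    obtain ⟨d, hd⟩ := hb
    exact ⟨c + d, (edgeGraph N).add_mem hc hd⟩
  zero_mem' := mem_sobolevStar_iff.2 ⟨0, (edgeGraph N).zero_mem⟩
  smul_mem' := by
    intro z a ha
    rw [mem_sobolevStar_iff] at ha ⊢
    obtain ⟨c, hc⟩ := ha
    exact ⟨z * c, (edgeGraph N).smul_mem z hc⟩

/-- `H¹₀(Γ_N)`: the pairs `(ψ, ψ')` with `ψ` in `H¹(Γ_N)` vanishing at the vertex. -/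
def sobolevStarZero (N : ℕ) :
    Submodule ℂ (Lp ℂ 2 (starMeasure N) × Lp ℂ 2 (starMeasure N)) :=
  (edgeGraph N).comap ((LinearMap.id).prod 0)

lemma mem_sobolevStarZero {u : Lp ℂ 2 (starMeasure N) × Lp ℂ 2 (starMeasure N)} :
    u ∈ sobolevStarZero N ↔ (u, fun _ => 0) ∈ edgeGraph N := Iff.rfl

lemma sobolevStarZero_le : sobolevStarZero N ≤ sobolevStarSubmodule N := fun _ hu =>
  mem_sobolevStar_iff.2 ⟨0, hu⟩

lemma isClosed_sobolevStar (hN : 0 < N) :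
    IsClosed (sobolevStarSubmodule N :
      Set (Lp ℂ 2 (starMeasure N) × Lp ℂ 2 (starMeasure N))) := by
  refine IsSeqClosed.isClosed fun u v hu huv => ?_
  choose c hc using fun n => mem_sobolevStar_iff.1 (hu n)
  obtain ⟨φ, hφ, hfst⟩ := exists_subseq_tendsto_ae ((continuous_fst.tendsto v).comp huv)
  have hsnd (p : Fin N × ℝ) : Tendsto (fun n => (inner ℂ (edgeIndicator p.1 0 p.2) (u n).2 : ℂ))
      atTop (𝓝 (inner ℂ (edgeIndicator p.1 0 p.2) v.2)) :=
    tendsto_const_nhds.inner ((continuous_snd.tendsto v).comp huv)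
  have hvertex : ∀ᵐ p ∂(starMeasure N), Tendsto (fun n => c (φ n)) atTop
      (𝓝 (v.1 p - inner ℂ (edgeIndicator p.1 0 p.2) v.2)) := by
    filter_upwards [hfst, ae_all_iff.2 hc] with p hp hpc
    refine (hp.sub ((hsnd p).comp hφ.tendsto_atTop)).congr fun n => ?_
    simp [hpc]
  have hne : (ae (starMeasure N)).NeBot := by
    rw [ae_neBot, ← Measure.measure_univ_ne_zero, starMeasure, ← univ_prod_univ, Measure.prod_prod]
    simp [hN.ne']
  obtain ⟨p₀, hp₀⟩ := hvertex.exists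
  refine mem_sobolevStar_iff.2 ⟨v.1 p₀ - inner ℂ (edgeIndicator p₀.1 0 p₀.2) v.2, ?_⟩
  filter_upwards [hvertex] with p hp
  rw [tendsto_nhds_unique hp₀ hp]; ring

end Star

section HalfLine

open scoped NNReal

/-! ### Sobolev functions on a half-line -/

lemma sq_lintegral_le {X : Type*} [MeasurableSpace X] {μ : Measure X} {f : X → ℝ≥0∞}
    (hf : AEMeasurable f μ) : (∫⁻ x, f x ∂μ) ^ 2 ≤ μ univ * ∫⁻ x, f x ^ 2 ∂μ := by
  have hholder := ENNReal.lintegral_mul_le_Lp_mul_Lq μ Real.HolderConjugate.two_two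
    (aemeasurable_const (b := 1)) hf
  have hsq := pow_le_pow_left' hholder 2
  simpa [mul_pow, ← ENNReal.rpow_mul_natCast] using hsq

lemma norm_sub_average_le {X E : Type*} [MeasurableSpace X] {μ : Measure X} [IsFiniteMeasure μ]
    [NeZero μ] [NormedAddCommGroup E] [NormedSpace ℝ E] [CompleteSpace E] {f : X → E} {v : E}
    {B : ℝ} (hf : Integrable f μ) (hv : ∀ᵐ x ∂μ, ‖v - f x‖ ≤ B) : ‖v - ⨍ x, f x ∂μ‖ ≤ B := by
  have hmem : ⨍ x, f x ∂μ ∈ Metric.closedBall v B :=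
    (convex_closedBall v B).average_mem Metric.isClosed_closedBall
      (hv.mono fun x hx => by rwa [Metric.mem_closedBall', dist_eq_norm]) hf
  rwa [Metric.mem_closedBall', dist_eq_norm] at hmem

lemma enorm_setIntegral_sq_le {a b : ℝ} {f : ℝ → ℂ}
    (hf : AEMeasurable f (volume.restrict (Ioc a b))) :
    ‖∫ x in Ioc a b, f x‖ₑ ^ 2 ≤ ENNReal.ofReal (b - a) * ∫⁻ x in Ioc a b, ‖f x‖ₑ ^ 2 := by
  calc ‖∫ x in Ioc a b, f x‖ₑ ^ 2 ≤ (∫⁻ x in Ioc a b, ‖f x‖ₑ) ^ 2 := by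
        gcongr; exact enorm_integral_le_lintegral_enorm _
    _ ≤ _ := by simpa using sq_lintegral_le hf.enorm

/-- The antiderivative of `g` with value `c` at `0`. -/
def primitive (c : ℂ) (g : ℝ → ℂ) (x : ℝ) : ℂ := c + ∫ t in (0 : ℝ)..x, g t

variable {c : ℂ} {g : ℝ → ℂ} {a b : ℝ}

lemma enorm_primitive_sub_le (ha : 0 ≤ a) (hg : IntegrableOn g (Ioc 0 b)) {x y : ℝ}
    (hx : x ∈ Ioc a b) (hy : y ∈ Ioc a b) :
    ‖primitive c g x - primitive c g y‖ₑ ≤ ∫⁻ t in Ioc a b, ‖g t‖ₑ := by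
  have hint {z : ℝ} (hz : z ∈ Ioc a b) : IntervalIntegrable g volume 0 z := by
    rw [intervalIntegrable_iff_integrableOn_Ioc_of_le (ha.trans hz.1.le)]
    exact hg.mono_set (Ioc_subset_Ioc_right hz.2)
  rw [primitive, primitive, add_sub_add_left_eq_sub,
    intervalIntegral.integral_interval_sub_left (hint hx) (hint hy), ← ofReal_norm,
    intervalIntegral.norm_integral_eq_norm_integral_uIoc, ofReal_norm]
  refine (enorm_integral_le_lintegral_enorm _).trans (lintegral_mono_set ?_)
  exact Ioc_subset_Ioc (le_min hy.1.le hx.1.le) (max_le hy.2 hx.2)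

lemma add_sq_le_two_mul (x y : ℝ≥0∞) : (x + y) ^ 2 ≤ 2 * (x ^ 2 + y ^ 2) := by
  have h := ENNReal.rpow_add_le_mul_rpow_add_rpow x y one_le_two
  norm_num at h
  exact h

lemma continuousOn_primitive (hg : IntegrableOn g (Ioc 0 b)) (hb : 0 ≤ b) :
    ContinuousOn (primitive c g) (Icc 0 b) := by
  have h := intervalIntegral.continuousOn_primitive_interval (μ := volume) (f := g) (a := 0)
    (b := b) (by rwa [uIcc_of_le hb, integrableOn_Icc_iff_integrableOn_Ioc])
  rw [uIcc_of_le hb] at h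
  exact continuousOn_const.add h

lemma enorm_primitive_sq_le (ha : 0 ≤ a) (hg : IntegrableOn g (Ioc 0 b)) {x : ℝ}
    (hx : x ∈ Ioc a b) :
    ‖primitive c g x‖ₑ ^ 2 ≤ 2 * (ENNReal.ofReal (b - a) * ∫⁻ t in Ioc a b, ‖g t‖ₑ ^ 2)
      + 2 * ‖⨍ y in Ioc a b, primitive c g y‖ₑ ^ 2 := by
  have hab : a < b := hx.1.trans_le hx.2
  have hgab : IntegrableOn g (Ioc a b) := hg.mono_set (Ioc_subset_Ioc_left ha)
  have hfin : ∫⁻ t in Ioc a b, ‖g t‖ₑ ≠ ∞ := hgab.2.ne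
  have hprim : IntegrableOn (primitive c g) (Ioc a b) :=
    (continuousOn_primitive hg (ha.trans hab.le)).integrableOn_Icc.mono_set
      fun y hy => ⟨ha.trans hy.1.le, hy.2⟩
  have : NeZero ((volume : Measure ℝ).restrict (Ioc a b)) :=
    ⟨by simp [Measure.restrict_eq_zero, hab]⟩
  have hosc : ‖primitive c g x - ⨍ y in Ioc a b, primitive c g y‖ₑ ≤ ∫⁻ t in Ioc a b, ‖g t‖ₑ := by
    rw [← ofReal_norm, ENNReal.ofReal_le_iff_le_toReal hfin]
    refine norm_sub_average_le hprim ?_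
    filter_upwards [ae_restrict_mem measurableSet_Ioc] with y hy
    rw [← ENNReal.ofReal_le_iff_le_toReal hfin, ofReal_norm]
    exact enorm_primitive_sub_le ha hg hx hy
  set m := ⨍ y in Ioc a b, primitive c g y
  calc ‖primitive c g x‖ₑ ^ 2 ≤ (‖primitive c g x - m‖ₑ + ‖m‖ₑ) ^ 2 := by
        gcongr; simpa using enorm_add_le (primitive c g x - m) m
    _ ≤ 2 * (‖primitive c g x - m‖ₑ ^ 2 + ‖m‖ₑ ^ 2) := add_sq_le_two_mul _ _
    _ ≤ 2 * ((∫⁻ t in Ioc a b, ‖g t‖ₑ) ^ 2 + ‖m‖ₑ ^ 2) := by gcongr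
    _ ≤ 2 * (ENNReal.ofReal (b - a) * (∫⁻ t in Ioc a b, ‖g t‖ₑ ^ 2) + ‖m‖ₑ ^ 2) := by
        gcongr; simpa using sq_lintegral_le hgab.1.aemeasurable.enorm
    _ = _ := mul_add _ _ _

/-- The cells of length `l` into which the half-line is divided. -/
def cell (l : ℝ≥0) (i : ℕ) : Set ℝ := Ioc (i * l) ((i + 1) * l)

lemma measurableSet_cell (l : ℝ≥0) (i : ℕ) : MeasurableSet (cell l i) := measurableSet_Ioc

lemma cell_subset_Ioi (l : ℝ≥0) (i : ℕ) : cell l i ⊆ Ioi 0 := fun _ hx =>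
  lt_of_le_of_lt (by positivity) hx.1

lemma lintegral_Ioi_eq_tsum_cell {l : ℝ≥0} (hl : 0 < l) (f : ℝ → ℝ≥0∞) :
    ∫⁻ x in Ioi 0, f x = ∑' i, ∫⁻ x in cell l i, f x := by
  have hmono : Monotone fun i : ℕ => (i : ℝ) * l := fun i j hij => by dsimp only; gcongr
  have hunion : ⋃ i, cell l i = Ioi 0 := by
    have h := iUnion_Ioc_map_succ_eq_Ioi (f := fun i : ℕ => (i : ℝ) * l)
      (fun i => hmono (Nat.zero_le i)) (not_bddAbove_of_tendsto_atTop
        (tendsto_natCast_atTop_atTop.atTop_mul_const (NNReal.coe_pos.2 hl)))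
    simpa [cell] using h
  have hdisj : Pairwise (Function.onFun Disjoint (cell l)) := by
    have h := hmono.pairwise_disjoint_on_Ioc_succ
    simp only [Nat.succ_eq_succ, Nat.succ_eq_add_one, Nat.cast_add_one] at h
    exact h
  rw [← hunion, lintegral_iUnion (measurableSet_cell l) hdisj]

lemma tsum_mul_le_of_le {a s : ℕ → ℝ≥0∞} {S : ℝ≥0∞} (hs : ∀ i, s i ≤ S) (M : ℕ) :
    ∑' i, a i * s i ≤ (∑' i, a i) * ∑ i ∈ Finset.range M, s i + (∑' i, a (i + M)) * S := by
  rw [← ENNReal.summable.sum_add_tsum_nat_add' (k := M), Finset.mul_sum, ← ENNReal.tsum_mul_right]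
  gcongr with i _ i
  · exact ENNReal.le_tsum i
  · exact hs _

lemma setLIntegral_cell_mul_enorm_primitive_sq_le (l : ℝ≥0) (i : ℕ) (v : ℝ → ℝ≥0∞)
    (hg : MemLp g 2 (volume.restrict (Ioi 0))) :
    ∫⁻ x in cell l i, v x * ‖primitive c g x‖ₑ ^ 2
      ≤ (∫⁻ x in cell l i, v x) * (2 * (l * ∫⁻ x in Ioi 0, ‖g x‖ₑ ^ 2)
        + 2 * ((l⁻¹ : ℝ≥0) ^ 2 * ‖∫ x in cell l i, primitive c g x‖ₑ ^ 2)) := by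
  have hlen : ((i : ℝ) + 1) * l - i * l = l := by ring
  have hgint : IntegrableOn g (Ioc 0 ((i + 1) * l)) :=
    (hg.mono_measure (Measure.restrict_mono Ioc_subset_Ioi_self le_rfl)).integrable one_le_two
  have hgfin : ∫⁻ x in Ioi 0, ‖g x‖ₑ ^ 2 ≠ ∞ := by
    simpa using (lintegral_rpow_enorm_lt_top_of_eLpNorm_lt_top two_ne_zero ENNReal.ofNat_ne_top
      hg.2).ne
  have haverage : ‖⨍ x in cell l i, primitive c g x‖ₑ
      = (l⁻¹ : ℝ≥0) * ‖∫ x in cell l i, primitive c g x‖ₑ := by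
    rw [setAverage_eq, enorm_smul, cell, Real.volume_real_Ioc_of_le (by gcongr; simp), hlen,
      ← NNReal.coe_inv, Real.enorm_of_nonneg (NNReal.coe_nonneg _), ENNReal.ofReal_coe_nnreal]
  rw [← mul_pow, ← haverage, ← lintegral_mul_const']
  · refine setLIntegral_mono' (measurableSet_cell l i) fun x hx => ?_
    gcongr
    refine (enorm_primitive_sq_le (by positivity) hgint hx).trans ?_
    rw [hlen, ENNReal.ofReal_coe_nnreal, ← cell]
    gcongr
    exact cell_subset_Ioi l i
  · rw [haverage]
    finiteness

lemma enorm_setIntegral_cell_primitive_sq_le (l : ℝ≥0) (i : ℕ)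
    (hg : MemLp g 2 (volume.restrict (Ioi 0))) :
    ‖∫ x in cell l i, primitive c g x‖ₑ ^ 2 ≤ l * ∫⁻ x in Ioi 0, ‖primitive c g x‖ₑ ^ 2 := by
  have hgint : IntegrableOn g (Ioc 0 ((i + 1) * l)) :=
    (hg.mono_measure (Measure.restrict_mono Ioc_subset_Ioi_self le_rfl)).integrable one_le_two
  have hcont : ContinuousOn (primitive c g) (cell l i) :=
    (continuousOn_primitive hgint (by positivity)).mono fun x hx =>
      ⟨(cell_subset_Ioi l i hx).le, hx.2⟩
  refine (enorm_setIntegral_sq_le (hcont.aemeasurable (measurableSet_cell l i))).trans ?_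
  rw [show ((i : ℝ) + 1) * l - i * l = l by ring, ENNReal.ofReal_coe_nnreal]
  gcongr
  exact cell_subset_Ioi l i

lemma lintegral_mul_enorm_primitive_sq_le {l : ℝ≥0} (hl : 0 < l) (v : ℝ → ℝ≥0∞) (M : ℕ)
    (hg : MemLp g 2 (volume.restrict (Ioi 0))) :
    ∫⁻ x in Ioi 0, v x * ‖primitive c g x‖ₑ ^ 2
      ≤ (∫⁻ x in Ioi 0, v x) * (2 * (l * ∫⁻ x in Ioi 0, ‖g x‖ₑ ^ 2))
        + 2 * (l⁻¹ : ℝ≥0) ^ 2 * ((∫⁻ x in Ioi 0, v x)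
            * ∑ i ∈ Finset.range M, ‖∫ x in cell l i, primitive c g x‖ₑ ^ 2
          + (∑' i, ∫⁻ x in cell l (i + M), v x)
            * (l * ∫⁻ x in Ioi 0, ‖primitive c g x‖ₑ ^ 2)) := by
  rw [lintegral_Ioi_eq_tsum_cell hl v]
  calc ∫⁻ x in Ioi 0, v x * ‖primitive c g x‖ₑ ^ 2
      ≤ ∑' i, (∫⁻ x in cell l i, v x) * (2 * (l * ∫⁻ x in Ioi 0, ‖g x‖ₑ ^ 2)
          + 2 * ((l⁻¹ : ℝ≥0) ^ 2 * ‖∫ x in cell l i, primitive c g x‖ₑ ^ 2)) := by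
        rw [lintegral_Ioi_eq_tsum_cell hl]
        exact ENNReal.tsum_le_tsum fun i => setLIntegral_cell_mul_enorm_primitive_sq_le l i v hg
    _ = (∑' i, ∫⁻ x in cell l i, v x) * (2 * (l * ∫⁻ x in Ioi 0, ‖g x‖ₑ ^ 2))
          + 2 * (l⁻¹ : ℝ≥0) ^ 2
            * ∑' i, (∫⁻ x in cell l i, v x) * ‖∫ x in cell l i, primitive c g x‖ₑ ^ 2 := by
        simp only [mul_add, ENNReal.tsum_add, ENNReal.tsum_mul_right, ← ENNReal.tsum_mul_left]
        congr 1
        exact tsum_congr fun i => by ring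
    _ ≤ _ := by
        gcongr
        exact tsum_mul_le_of_le (fun i => enorm_setIntegral_cell_primitive_sq_le l i hg) M

lemma exists_lintegral_mul_enorm_primitive_sq_le {v : ℝ → ℝ≥0∞} (hv : ∫⁻ x in Ioi 0, v x ≠ ∞)
    {δ : ℝ≥0} (hδ : 0 < δ) :
    ∃ (l C : ℝ≥0) (M : ℕ), ∀ (c : ℂ) (g : ℝ → ℂ), MemLp g 2 (volume.restrict (Ioi 0)) →
      ∫⁻ x in Ioi 0, v x * ‖primitive c g x‖ₑ ^ 2
        ≤ δ * ((∫⁻ x in Ioi 0, ‖primitive c g x‖ₑ ^ 2) + ∫⁻ x in Ioi 0, ‖g x‖ₑ ^ 2)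
          + C * ∑ i ∈ Finset.range M, ‖∫ x in cell l i, primitive c g x‖ₑ ^ 2 := by
  set A := (∫⁻ x in Ioi 0, v x).toNNReal
  have hA : ∫⁻ x in Ioi 0, v x = A := (ENNReal.coe_toNNReal hv).symm
  set l := δ / (2 * (A + 1)) with hldef
  have hl : 0 < l := by positivity
  have hlA : A * (2 * l) ≤ δ := by
    rw [hldef, mul_div_assoc', mul_div_assoc', div_le_iff₀ (by positivity)]
    linarith [show A * (2 * δ) + 2 * δ = δ * (2 * (A + 1)) by ring, show 0 ≤ 2 * δ by positivity]
  obtain ⟨M, hM⟩ : ∃ M, ∑' i, ∫⁻ x in cell l (i + M), v x ≤ (δ * l / 2 : ℝ≥0) :=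
    ((ENNReal.tendsto_sum_nat_add _ (lintegral_Ioi_eq_tsum_cell hl v ▸ hv)).eventually_le_const
      (by positivity)).exists
  refine ⟨l, 2 * (l⁻¹) ^ 2 * A, M, fun c g hg => ?_⟩
  set P := ∫⁻ x in Ioi 0, ‖g x‖ₑ ^ 2
  set R := ∫⁻ x in Ioi 0, ‖primitive c g x‖ₑ ^ 2
  set S := ∑ i ∈ Finset.range M, ‖∫ x in cell l i, primitive c g x‖ₑ ^ 2
  calc ∫⁻ x in Ioi 0, v x * ‖primitive c g x‖ₑ ^ 2
      ≤ A * (2 * (l * P)) + 2 * (l⁻¹ : ℝ≥0) ^ 2 * (A * S + (δ * l / 2 : ℝ≥0) * (l * R)) := by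
        refine (lintegral_mul_enorm_primitive_sq_le hl v M hg).trans ?_
        rw [hA]
        gcongr
    _ = (A * (2 * l) : ℝ≥0) * P + ((2 * (l⁻¹) ^ 2 * A : ℝ≥0) * S
          + (2 * (l⁻¹) ^ 2 * (δ * l / 2) * l : ℝ≥0) * R) := by push_cast; ring
    _ ≤ δ * P + ((2 * (l⁻¹) ^ 2 * A : ℝ≥0) * S + δ * R) := by
        rw [show 2 * (l⁻¹) ^ 2 * (δ * l / 2) * l = δ by field_simp]
        gcongr
    _ = _ := by ring

end HalfLine

section FormCompact

open scoped NNReal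

/-! ### Form compact weights -/

variable {X : Type*} [MeasurableSpace X] {μ : Measure X}

/-- The weight `v` is form compact on `D`: up to finitely many functionals of `ψ`, the integral
`∫ v |ψ|²` is an arbitrarily small part of `‖ψ‖² + ‖ψ'‖²`. This is what makes the negative
spectrum of `-d²/dx² - v` discrete. -/
def IsFormCompact (D : Set (Lp ℂ 2 μ × Lp ℂ 2 μ)) (v : X → ℝ≥0∞) : Prop :=
  ∀ δ : ℝ≥0, 0 < δ → ∃ (n : ℕ) (ℓ : Lp ℂ 2 μ →L[ℂ] EuclideanSpace ℂ (Fin n)), ∀ u ∈ D,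
    ∫⁻ x, v x * ‖u.1 x‖ₑ ^ 2 ∂μ ≤ δ * (‖u.1‖ₑ ^ 2 + ‖u.2‖ₑ ^ 2) + ‖ℓ u.1‖ₑ ^ 2

lemma exists_enorm_sq_eq_sum {H ι : Type*} [NormedAddCommGroup H] [InnerProductSpace ℂ H]
    [Fintype ι] (c : ι → ℝ≥0) (g : ι → H) :
    ∃ (n : ℕ) (ℓ : H →L[ℂ] EuclideanSpace ℂ (Fin n)), ∀ f,
      ‖ℓ f‖ₑ ^ 2 = ∑ i, c i * ‖(inner ℂ (g i) f : ℂ)‖ₑ ^ 2 := by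
  let e := Fintype.equivFin ι
  refine ⟨Fintype.card ι, (EuclideanSpace.equiv (Fin (Fintype.card ι)) ℂ).symm.toContinuousLinearMap
    ∘L ContinuousLinearMap.pi fun k => (√(c (e.symm k)) : ℂ) • innerSL ℂ (g (e.symm k)),
    fun f => ?_⟩
  rw [← e.symm.sum_comp, ← ofReal_norm, ← ENNReal.ofReal_pow (norm_nonneg _),
    EuclideanSpace.norm_sq_eq, ENNReal.ofReal_sum_of_nonneg fun _ _ => sq_nonneg _]
  refine Finset.sum_congr rfl fun k _ => ?_
  rw [← ofReal_norm (inner ℂ _ f), ← ENNReal.ofReal_pow (norm_nonneg _),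
    ← ENNReal.ofReal_coe_nnreal, ← ENNReal.ofReal_mul NNReal.zero_le_coe]
  simp [mul_pow]

lemma enorm_sq_eq_lintegral (f : Lp ℂ 2 μ) : ‖f‖ₑ ^ 2 = ∫⁻ x, ‖f x‖ₑ ^ 2 ∂μ := by
  have h := eLpNorm_nnreal_pow_eq_lintegral (μ := μ) (f := f) (p := 2) two_ne_zero
  simpa [← Lp.enorm_def] using h

lemma enorm_sq_of_mem_mulGraph {b : X → ℝ} (hb : ∀ x, 0 ≤ b x) {p : Lp ℂ 2 μ × Lp ℂ 2 μ}
    (hp : p ∈ mulGraph μ fun x => (√(b x) : ℂ)) :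
    ‖p.2‖ₑ ^ 2 = ∫⁻ x, ‖b x‖ₑ * ‖p.1 x‖ₑ ^ 2 ∂μ := by
  rw [enorm_sq_eq_lintegral]
  refine lintegral_congr_ae ?_
  filter_upwards [mem_mulGraph.1 hp] with x hx
  rw [hx, enorm_mul, mul_pow, ← enorm_pow, ← Complex.ofReal_pow, Real.sq_sqrt (hb x),
    enorm_eq_nnnorm (b x : ℂ), Complex.nnnorm_real, enorm_eq_nnnorm (b x)]

lemma exists_enorm_le_add_of_memLp {E : Type*} [NormedAddCommGroup E] {f : X → E} {p : ℝ≥0∞}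
    (hp1 : 1 ≤ p) (hp : p ≠ ∞) (hf : MemLp f p μ) {η : ℝ≥0} (hη : 0 < η) :
    ∃ w : X → ℝ≥0∞, ∫⁻ x, w x ∂μ ≠ ∞ ∧ ∀ x, ‖f x‖ₑ ≤ η + w x := by
  set r := p.toReal with hr
  have hr1 : 1 ≤ r := by rw [hr, ← ENNReal.toReal_one]; exact ENNReal.toReal_mono hp hp1
  refine ⟨fun x => (η ^ (1 - r) : ℝ≥0) * ‖f x‖ₑ ^ r, ?_, fun x => ?_⟩
  · rw [lintegral_const_mul' _ _ ENNReal.coe_ne_top]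
    exact ENNReal.mul_ne_top ENNReal.coe_ne_top
      (lintegral_rpow_enorm_lt_top_of_eLpNorm_lt_top (zero_lt_one.trans_le hp1).ne' hp hf.2).ne
  · rcases le_or_gt ‖f x‖₊ η with hle | hgt
    · exact le_self_add.trans' (by exact_mod_cast hle)
    · refine le_add_self.trans' ?_
      have hpos := hη.trans hgt
      beta_reduce
      rw [enorm_eq_nnnorm, ← ENNReal.coe_rpow_of_ne_zero hpos.ne', ← ENNReal.coe_mul,
        ENNReal.coe_le_coe]
      calc ‖f x‖₊ = ‖f x‖₊ ^ (1 - r) * ‖f x‖₊ ^ r := by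
            rw [← NNReal.rpow_add hpos.ne']; simp
        _ ≤ _ := by
          gcongr ?_ * _
          exact NNReal.rpow_le_rpow_of_nonpos hη hgt.le (by linarith)

variable {D : Submodule ℂ (Lp ℂ 2 μ × Lp ℂ 2 μ)} {V : X → ℝ}

lemma IsFormCompact.integrable (hV : AEMeasurable V μ)
    (hc : IsFormCompact (D : Set (Lp ℂ 2 μ × Lp ℂ 2 μ)) fun x => ‖(V x)⁻‖ₑ)
    {u : Lp ℂ 2 μ × Lp ℂ 2 μ} (hu : u ∈ D) : Integrable (fun x => (V x)⁻ * ‖u.1 x‖ ^ 2) μ := by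
  obtain ⟨n, ℓ, h⟩ := hc 1 one_pos
  refine ⟨AEStronglyMeasurable.mul hV.negPart.aestronglyMeasurable
    ((Lp.aestronglyMeasurable u.1).norm.pow 2), ?_⟩
  simp only [HasFiniteIntegral, enorm_mul, enorm_pow, enorm_norm]
  exact (h u hu).trans_lt (by finiteness)

lemma IsFormCompact.isCoerciveAt
    (hc : IsFormCompact (D : Set (Lp ℂ 2 μ × Lp ℂ 2 μ)) fun x => ‖(V x)⁻‖ₑ) {E : ℝ} (hE : E < 0) :
    (schrodingerPencil (Lp ℂ 2 μ)).IsCoerciveAt (formGraph D V) E := by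
  obtain ⟨κ, hκ, hκ_le_one, hκ_le_level⟩ : ∃ κ : ℝ≥0, 0 < κ ∧ (κ : ℝ) ≤ 1 ∧ (κ : ℝ) ≤ -E :=
    ⟨min 1 (-E).toNNReal, lt_min one_pos (Real.toNNReal_pos.2 (neg_pos.2 hE)),
      by exact_mod_cast min_le_left _ _,
      (NNReal.coe_le_coe.2 (min_le_right _ _)).trans (Real.coe_toNNReal _ (neg_pos.2 hE).le).le⟩
  obtain ⟨n, ℓ, hℓ⟩ := hc (κ / 4) (by positivity)
  refine ⟨κ / 2, by positivity, n, (√2 : ℂ) • ℓ, fun w hw => ?_⟩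
  have hneg : ‖w.2.2.2‖ ^ 2 ≤ κ / 4 * (‖w.1‖ ^ 2 + ‖w.2.1‖ ^ 2) + ‖ℓ w.1‖ ^ 2 := by
    have h : ‖w.2.2.2‖ₑ ^ 2 ≤ _ :=
      (enorm_sq_of_mem_mulGraph (fun x => negPart_nonneg (V x)) hw.1.2).trans_le
        (hℓ (w.1, w.2.1) hw.2)
    simp only [enorm_eq_nnnorm] at h
    exact_mod_cast h
  have henergy : (schrodingerPencil (Lp ℂ 2 μ)).energy E w
      = ‖w.2.1‖ ^ 2 + ‖w.2.2.1‖ ^ 2 - ‖w.2.2.2‖ ^ 2 - E * ‖w.1‖ ^ 2 := by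
    simp [HermitianPencil.energy, schrodingerPencil_shift_apply, inner_self_eq_norm_sq_to_K]
    norm_cast
  have hnorm : ‖w‖ ^ 2 ≤ ‖w.1‖ ^ 2 + ‖w.2.1‖ ^ 2 + ‖w.2.2.1‖ ^ 2 + ‖w.2.2.2‖ ^ 2 := by
    have hsq (a b : ℝ) : max a b ^ 2 ≤ a ^ 2 + b ^ 2 := by
      rcases max_choice a b with h | h <;> rw [h] <;> nlinarith [sq_nonneg a, sq_nonneg b]
    simp only [Prod.norm_def]
    linarith [hsq ‖w.1‖ (max ‖w.2.1‖ (max ‖w.2.2.1‖ ‖w.2.2.2‖)),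
      hsq ‖w.2.1‖ (max ‖w.2.2.1‖ ‖w.2.2.2‖), hsq ‖w.2.2.1‖ ‖w.2.2.2‖]
  have hfunctional : ‖((√2 : ℂ) • ℓ) w.1‖ ^ 2 = 2 * ‖ℓ w.1‖ ^ 2 := by
    simp [norm_smul, mul_pow]
  have hlevel : κ * ‖w.1‖ ^ 2 ≤ -E * ‖w.1‖ ^ 2 := by gcongr
  have hderiv : κ * ‖w.2.1‖ ^ 2 ≤ 1 * ‖w.2.1‖ ^ 2 := by gcongr
  have hpos : κ * ‖w.2.2.1‖ ^ 2 ≤ 1 * ‖w.2.2.1‖ ^ 2 := by gcongr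
  have hneg' : κ * ‖w.2.2.2‖ ^ 2 ≤ 1 * ‖w.2.2.2‖ ^ 2 := by gcongr
  change _ ≤ _ + ‖((√2 : ℂ) • ℓ) w.1‖ ^ 2
  rw [henergy, hfunctional]
  nlinarith [mul_le_mul_of_nonneg_left hnorm κ.coe_nonneg]

end FormCompact

section StarFormCompact

open scoped NNReal

variable {N : ℕ}

lemma enorm_sq_eq_sum_edges (f : Lp ℂ 2 (starMeasure N)) :
    ‖f‖ₑ ^ 2 = ∑ j, ∫⁻ x in Ioi 0, ‖f (j, x)‖ₑ ^ 2 := by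
  rw [enorm_sq_eq_lintegral, lintegral_starMeasure]

lemma exists_edge_lintegral_mul_enorm_sq_le {v : ℝ → ℝ≥0∞} (hv : ∫⁻ x in Ioi 0, v x ≠ ∞)
    {δ : ℝ≥0} (hδ : 0 < δ) (j : Fin N) :
    ∃ (l C : ℝ≥0) (M : ℕ), ∀ u ∈ sobolevStar N,
      ∫⁻ x in Ioi 0, v x * ‖u.1 (j, x)‖ₑ ^ 2
        ≤ δ * ((∫⁻ x in Ioi 0, ‖u.1 (j, x)‖ₑ ^ 2) + ∫⁻ x in Ioi 0, ‖u.2 (j, x)‖ₑ ^ 2)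
          + C * ∑ i : Fin M,
            ‖(inner ℂ (edgeIndicator j (i * l) ((i + 1) * l)) u.1 : ℂ)‖ₑ ^ 2 := by
  obtain ⟨l, C, M, hprim⟩ := exists_lintegral_mul_enorm_primitive_sq_le hv hδ
  refine ⟨l, C, M, ?_⟩
  rintro u ⟨c, hc⟩
  set Ψ := primitive c fun t => u.2 (j, t)
  have hu : (fun x => u.1 (j, x)) =ᵐ[volume.restrict (Ioi 0)] Ψ := hc j
  have hcell (i : Fin M) : (inner ℂ (edgeIndicator j (i * l) ((i + 1) * l)) u.1 : ℂ)
      = ∫ x in cell l i, Ψ x := by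
    rw [inner_edgeIndicator j (by positivity)]
    exact integral_congr_ae (ae_mono (Measure.restrict_mono (cell_subset_Ioi l i) le_rfl) hu)
  have hweighted : ∫⁻ x in Ioi 0, v x * ‖u.1 (j, x)‖ₑ ^ 2 = ∫⁻ x in Ioi 0, v x * ‖Ψ x‖ₑ ^ 2 :=
    lintegral_congr_ae (hu.mono fun x hx => by simp only [hx])
  have hsq : ∫⁻ x in Ioi 0, ‖u.1 (j, x)‖ₑ ^ 2 = ∫⁻ x in Ioi 0, ‖Ψ x‖ₑ ^ 2 :=
    lintegral_congr_ae (hu.mono fun x hx => by simp only [hx])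
  simp only [hcell]
  rw [hweighted, hsq, Fin.sum_univ_eq_sum_range fun i => ‖∫ x in cell l i, Ψ x‖ₑ ^ 2]
  exact hprim c _ (memLp_edge (Lp.memLp u.2) j)

lemma isFormCompact_star {E : Type*} [NormedAddCommGroup E] {f : Fin N × ℝ → E} {p : ℝ≥0∞}
    (hp1 : 1 ≤ p) (hp : p ≠ ∞) (hf : MemLp f p (starMeasure N)) :
    IsFormCompact (sobolevStar N) fun x => ‖f x‖ₑ := by
  intro δ hδ
  obtain ⟨w, hw, hfw⟩ := exists_enorm_le_add_of_memLp hp1 hp hf (half_pos hδ)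
  rw [lintegral_starMeasure] at hw
  choose l C M hedge using fun j => exists_edge_lintegral_mul_enorm_sq_le
    (ENNReal.sum_ne_top.1 hw j (Finset.mem_univ j)) (half_pos hδ) j
  obtain ⟨n, ℓ, hℓ⟩ := exists_enorm_sq_eq_sum (fun q : Σ j, Fin (M j) => C q.1)
    fun q => edgeIndicator q.1 (q.2 * l q.1) ((q.2 + 1) * l q.1)
  refine ⟨n, ℓ, fun u hu => ?_⟩
  calc ∫⁻ x, ‖f x‖ₑ * ‖u.1 x‖ₑ ^ 2 ∂(starMeasure N)
      ≤ ∫⁻ x, ((δ / 2 : ℝ≥0) * ‖u.1 x‖ₑ ^ 2 + w x * ‖u.1 x‖ₑ ^ 2) ∂(starMeasure N) :=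
        lintegral_mono fun x => by rw [← add_mul]; gcongr; exact hfw x
    _ = (δ / 2 : ℝ≥0) * ‖u.1‖ₑ ^ 2 + ∑ j, ∫⁻ x in Ioi 0, w (j, x) * ‖u.1 (j, x)‖ₑ ^ 2 := by
        rw [lintegral_add_left' ((Lp.aestronglyMeasurable u.1).enorm.pow_const 2 |>.const_mul _),
          lintegral_const_mul' _ _ ENNReal.coe_ne_top, enorm_sq_eq_lintegral,
          lintegral_starMeasure fun x => w x * ‖u.1 x‖ₑ ^ 2]
    _ ≤ (δ / 2 : ℝ≥0) * ‖u.1‖ₑ ^ 2 + ((δ / 2 : ℝ≥0) * (‖u.1‖ₑ ^ 2 + ‖u.2‖ₑ ^ 2)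
          + ‖ℓ u.1‖ₑ ^ 2) := by
        gcongr
        refine (Finset.sum_le_sum fun j _ => hedge j u hu).trans_eq ?_
        rw [hℓ, Fintype.sum_sigma, enorm_sq_eq_sum_edges u.1, enorm_sq_eq_sum_edges u.2]
        simp only [mul_add, Finset.mul_sum, Finset.sum_add_distrib]
    _ ≤ δ * ‖u.1‖ₑ ^ 2 + δ * ‖u.2‖ₑ ^ 2 + ‖ℓ u.1‖ₑ ^ 2 := by
        have hhalf : ((δ / 2 : ℝ≥0) : ℝ≥0∞) + (δ / 2 : ℝ≥0) = δ := by
          rw [← ENNReal.coe_add, add_halves]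
        rw [mul_add, ← add_assoc, ← add_assoc, ← add_mul, hhalf]
        gcongr
        exact half_le_self δ.coe_nonneg
    _ = _ := by rw [mul_add]

end StarFormCompact

section Edges

/-! ### Restriction to an edge and extension from an edge -/

variable {N : ℕ}

lemma isTransfer_restrictEdge (j : Fin N) :
    IsTransfer (fun q : Fin 1 × ℝ => (j, q.2)) univ (starMeasure 1) (starMeasure N) where
  measurable := by fun_prop
  measurableSet := MeasurableSet.univ
  map_le := by
    rw [Measure.restrict_univ, starMeasure_eq_sum 1, Fin.sum_univ_one,
      Measure.map_map (by fun_prop) measurable_prodMk_left]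
    exact map_mk_le_starMeasure j

lemma map_snd_restrict_edge (j : Fin N) :
    ((starMeasure N).restrict ({j} ×ˢ univ)).map (fun q : Fin N × ℝ => ((0 : Fin 1), q.2))
      = starMeasure 1 := by
  rw [starMeasure, ← Measure.prod_restrict, Measure.restrict_univ, starMeasure_eq_sum 1,
    Fin.sum_univ_one, Measure.restrict_singleton, Measure.count_singleton, one_smul,
    Measure.dirac_prod, Measure.map_map (by fun_prop) measurable_prodMk_left]
  rfl

lemma isTransfer_extendEdge (j : Fin N) :
    IsTransfer (fun q : Fin N × ℝ => ((0 : Fin 1), q.2)) ({j} ×ˢ univ) (starMeasure N)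
      (starMeasure 1) where
  measurable := by fun_prop
  measurableSet := (measurableSet_singleton j).prod MeasurableSet.univ
  map_le := (map_snd_restrict_edge j).le

/-- The restriction to the edge `j`. The half-line is modelled as the star graph with one edge. -/
def restrictEdge (j : Fin N) : Lp ℂ 2 (starMeasure N) →ₗ[ℂ] Lp ℂ 2 (starMeasure 1) :=
  transferLp (isTransfer_restrictEdge j)

/-- The extension by zero of a function on the edge `j`. -/
def extendEdge (j : Fin N) : Lp ℂ 2 (starMeasure 1) →ₗ[ℂ] Lp ℂ 2 (starMeasure N) :=
  transferLp (isTransfer_extendEdge j)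

lemma inner_extendEdge (j : Fin N) (f : Lp ℂ 2 (starMeasure 1)) (g : Lp ℂ 2 (starMeasure N)) :
    inner ℂ (extendEdge j f) g = inner ℂ f (restrictEdge j g) := by
  refine inner_transferLp_left _ _ (map_snd_restrict_edge j) ?_ f g
  rintro ⟨i, x⟩ ⟨rfl : i = j, -⟩
  rfl

lemma ae_restrictEdge (j : Fin N) (f : Lp ℂ 2 (starMeasure N)) :
    ∀ᵐ x ∂(volume.restrict (Ioi (0 : ℝ))), restrictEdge j f (0, x) = f (j, x) := by
  filter_upwards [ae_starMeasure_iff.1 (coeFn_transferLp (isTransfer_restrictEdge j) f) 0]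
    with x hx
  rw [restrictEdge, hx, indicator_univ, Function.comp_apply]

lemma ae_extendEdge (i j : Fin N) (f : Lp ℂ 2 (starMeasure 1)) :
    ∀ᵐ x ∂(volume.restrict (Ioi (0 : ℝ))),
      extendEdge j f (i, x) = if i = j then f (0, x) else 0 := by
  filter_upwards [ae_starMeasure_iff.1 (coeFn_transferLp (isTransfer_extendEdge j) f) i] with x hx
  rw [extendEdge, hx]
  simp [indicator]

lemma inner_edgeIndicator_congr {M : ℕ} {i : Fin M} {j : Fin N} {f : Lp ℂ 2 (starMeasure M)}
    {g : Lp ℂ 2 (starMeasure N)}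
    (h : ∀ᵐ x ∂(volume.restrict (Ioi (0 : ℝ))), f (i, x) = g (j, x)) (x : ℝ) :
    inner ℂ (edgeIndicator i 0 x) f = inner ℂ (edgeIndicator j 0 x) g := by
  rw [inner_edgeIndicator i le_rfl, inner_edgeIndicator j le_rfl]
  exact integral_congr_ae (ae_mono (Measure.restrict_mono (fun t ht => ht.1) le_rfl) h)

lemma restrictEdge_mem_edgeGraph (j : Fin N)
    {u : Lp ℂ 2 (starMeasure N) × Lp ℂ 2 (starMeasure N)} {c : Fin N → ℂ}
    (hu : (u, c) ∈ edgeGraph N) :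
    ((restrictEdge j u.1, restrictEdge j u.2), fun _ => c j) ∈ edgeGraph 1 := by
  rw [mem_edgeGraph, ae_starMeasure_iff] at hu ⊢
  intro i
  obtain rfl : i = 0 := Subsingleton.elim _ _
  filter_upwards [hu j, ae_restrictEdge j u.1] with x hux hrestrict
  simp only [hrestrict, hux, inner_edgeIndicator_congr (ae_restrictEdge j u.2) x]

lemma extendEdge_mem_edgeGraph (j : Fin N)
    {u : Lp ℂ 2 (starMeasure 1) × Lp ℂ 2 (starMeasure 1)} {c : ℂ}
    (hu : (u, fun _ => c) ∈ edgeGraph 1) :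
    ((extendEdge j u.1, extendEdge j u.2), Pi.single j c) ∈ edgeGraph N := by
  rw [mem_edgeGraph, ae_starMeasure_iff] at hu ⊢
  intro i
  rcases eq_or_ne i j with rfl | hij
  · have hsnd := (ae_extendEdge i i u.2).mono fun x hx => hx.trans (if_pos rfl)
    filter_upwards [hu 0, ae_extendEdge i i u.1] with x hux hfst
    simp only [hfst, if_true, hux, inner_edgeIndicator_congr hsnd x, Pi.single_eq_same]
  · have hsnd := (ae_extendEdge i j u.2).mono fun x hx => hx.trans (if_neg hij)
    filter_upwards [ae_extendEdge i j u.1] with x hfst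
    have hzero : inner ℂ (edgeIndicator i 0 x) (extendEdge j u.2) = 0 := by
      rw [inner_edgeIndicator i le_rfl, ← integral_zero ℝ ℂ]
      exact integral_congr_ae (ae_mono (Measure.restrict_mono (fun t ht => ht.1) le_rfl) hsnd)
    simp only [hfst, if_neg hij, hzero, Pi.single_eq_of_ne hij, add_zero]

lemma eq_zero_of_restrictEdge_eq_zero {ψ : Lp ℂ 2 (starMeasure N)}
    (h : ∀ j, restrictEdge j ψ = 0) : ψ = 0 := by
  refine Lp.ext (ae_starMeasure_iff.2 fun j => ?_)
  filter_upwards [ae_restrictEdge j ψ, ae_starMeasure_iff.1 (Lp.coeFn_zero ℂ 2 (starMeasure N)) j,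
    ae_starMeasure_iff.1 (Lp.coeFn_zero ℂ 2 (starMeasure 1)) 0] with x hx hN hone
  rw [hN, ← hx, h j, hone]
  rfl

lemma ae_starMeasure_pos (N : ℕ) : ∀ᵐ q ∂(starMeasure N), 0 < q.2 :=
  ae_starMeasure_iff.2 fun _ => ae_restrict_mem measurableSet_Ioi

variable {V : Fin N × ℝ → ℝ} {f : ℝ → ℝ}

lemma quadMap_restrictEdge_mem_potentialGraph (hV : ∀ j x, 0 < x → V (j, x) = f x) (j : Fin N)
    {w : Quad (Lp ℂ 2 (starMeasure N))} (hw : w ∈ potentialGraph (starMeasure N) V) :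
    quadMap 1 (restrictEdge j) w ∈ potentialGraph (starMeasure 1) fun q => f q.2 := by
  refine quadMap_transferLp_mem_potentialGraph _ ?_ 1 hw
  filter_upwards [ae_starMeasure_pos 1] with q hq _
  rw [hV j _ hq]

lemma quadMap_extendEdge_mem_potentialGraph (hV : ∀ j x, 0 < x → V (j, x) = f x) (j : Fin N)
    {w : Quad (Lp ℂ 2 (starMeasure 1))}
    (hw : w ∈ potentialGraph (starMeasure 1) fun q => f q.2) :
    quadMap 1 (extendEdge j) w ∈ potentialGraph (starMeasure N) V := by
  refine quadMap_transferLp_mem_potentialGraph _ ?_ 1 hw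
  filter_upwards [ae_starMeasure_pos N] with q hq _
  exact hV q.1 q.2 hq

end Edges

section Decomposition

/-! ### Reduction of the radial star graph to the half-line -/

variable {N : ℕ} {V : Fin N × ℝ → ℝ} {f : ℝ → ℝ}

lemma sum_smul_restrictEdge_mem_edgeGraph (a : Fin N → ℂ)
    {u : Lp ℂ 2 (starMeasure N) × Lp ℂ 2 (starMeasure N)} {c : ℂ}
    (hu : (u, fun _ => c) ∈ edgeGraph N) :
    ((∑ j, a j • restrictEdge j u.1, ∑ j, a j • restrictEdge j u.2), fun _ => (∑ j, a j) * c)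
      ∈ edgeGraph 1 := by
  convert (edgeGraph 1).sum_mem (t := Finset.univ) fun j _ =>
    (edgeGraph 1).smul_mem (a j) (restrictEdge_mem_edgeGraph j hu) using 1
  refine Prod.ext (Prod.ext ?_ ?_) (funext fun i => ?_)
  · simp [Prod.fst_sum]
  · simp [Prod.fst_sum, Prod.snd_sum]
  · simp [Prod.snd_sum, Finset.sum_mul]

lemma sum_smul_extendEdge_mem_edgeGraph (a : Fin N → ℂ)
    {u : Lp ℂ 2 (starMeasure 1) × Lp ℂ 2 (starMeasure 1)} {c : ℂ}
    (hu : (u, fun _ => c) ∈ edgeGraph 1) :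
    ((∑ j, a j • extendEdge j u.1, ∑ j, a j • extendEdge j u.2), fun j => a j * c)
      ∈ edgeGraph N := by
  convert (edgeGraph N).sum_mem (t := Finset.univ) fun j _ =>
    (edgeGraph N).smul_mem (a j) (extendEdge_mem_edgeGraph j hu) using 1
  refine Prod.ext (Prod.ext ?_ ?_) (funext fun i => ?_)
  · simp [Prod.fst_sum]
  · simp [Prod.fst_sum, Prod.snd_sum]
  · simp [Prod.snd_sum, Pi.single_apply]

/-- The combination with coefficients `a` of the restrictions to the edges. -/
def combineEdges (a : Fin N → ℂ) :
    Quad (Lp ℂ 2 (starMeasure N)) →ₗ[ℂ] Quad (Lp ℂ 2 (starMeasure 1)) :=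
  ∑ j, a j • quadMap 1 (restrictEdge j)

/-- The function which is `a j` times a given function on the edge `j`. -/
def distributeEdges (a : Fin N → ℂ) :
    Quad (Lp ℂ 2 (starMeasure 1)) →ₗ[ℂ] Quad (Lp ℂ 2 (starMeasure N)) :=
  ∑ j, a j • quadMap 1 (extendEdge j)

lemma combineEdges_apply (a : Fin N → ℂ) (w : Quad (Lp ℂ 2 (starMeasure N))) :
    combineEdges a w = ∑ j, a j • quadMap 1 (restrictEdge j) w := by
  simp only [combineEdges, LinearMap.sum_apply, LinearMap.smul_apply]

lemma distributeEdges_apply (a : Fin N → ℂ) (w : Quad (Lp ℂ 2 (starMeasure 1))) :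
    distributeEdges a w = ∑ j, a j • quadMap 1 (extendEdge j) w := by
  simp only [distributeEdges, LinearMap.sum_apply, LinearMap.smul_apply]

lemma shift_distributeEdges_star (a : Fin N → ℂ) (E : ℝ) (u : Quad (Lp ℂ 2 (starMeasure 1)))
    (w : Quad (Lp ℂ 2 (starMeasure N))) :
    (schrodingerPencil _).shift E (distributeEdges (star a) u) w
      = (schrodingerPencil _).shift E u (combineEdges a w) := by
  simp only [combineEdges_apply, distributeEdges_apply, map_sum, map_smul, map_smulₛₗ,
    Pi.star_apply, RCLike.star_def, Complex.conj_conj, sum_apply, smul_apply,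
    shift_quadMap_left (inner_extendEdge _)]

lemma combineEdges_mem_potentialGraph (hV : ∀ j x, 0 < x → V (j, x) = f x) (a : Fin N → ℂ)
    {w : Quad (Lp ℂ 2 (starMeasure N))} (hw : w ∈ potentialGraph (starMeasure N) V) :
    combineEdges a w ∈ potentialGraph (starMeasure 1) fun q => f q.2 := by
  rw [combineEdges_apply]
  exact Submodule.sum_mem _ fun j _ =>
    Submodule.smul_mem _ _ (quadMap_restrictEdge_mem_potentialGraph hV j hw)

lemma distributeEdges_mem_potentialGraph (hV : ∀ j x, 0 < x → V (j, x) = f x) (a : Fin N → ℂ)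
    {w : Quad (Lp ℂ 2 (starMeasure 1))}
    (hw : w ∈ potentialGraph (starMeasure 1) fun q => f q.2) :
    distributeEdges a w ∈ potentialGraph (starMeasure N) V := by
  rw [distributeEdges_apply]
  exact Submodule.sum_mem _ fun j _ =>
    Submodule.smul_mem _ _ (quadMap_extendEdge_mem_potentialGraph hV j hw)

lemma combineEdges_mem_eigenvectors (hV : ∀ j x, 0 < x → V (j, x) = f x) (a : Fin N → ℂ)
    {P : Submodule ℂ (Lp ℂ 2 (starMeasure 1) × Lp ℂ 2 (starMeasure 1))}
    (hP : ∀ u c, (u, fun _ => (∑ j, a j) * c) ∈ edgeGraph 1 → u ∈ P)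
    (hP' : ∀ u ∈ P, ∃ c d : ℂ, (u, fun _ => c) ∈ edgeGraph 1 ∧ ∀ j, conj (a j) * c = d) {E : ℝ}
    {w : Quad (Lp ℂ 2 (starMeasure N))}
    (hw : w ∈ (schrodingerPencil _).eigenvectors (formGraph (sobolevStarSubmodule N) V) E) :
    combineEdges a w
      ∈ (schrodingerPencil _).eigenvectors (formGraph P fun q => f q.2) E := by
  obtain ⟨hwpot, hwdom⟩ := mem_formGraph.1 (HermitianPencil.mem_eigenvectors.1 hw).1
  refine HermitianPencil.map_mem_eigenvectors (fun u hu => ?_) (shift_distributeEdges_star a E)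
    hw ?_
  · obtain ⟨c, d, hc, hcd⟩ := hP' _ hu.2
    refine ⟨distributeEdges_mem_potentialGraph hV _ hu.1, mem_sobolevStar_iff.2 ⟨d, ?_⟩⟩
    convert sum_smul_extendEdge_mem_edgeGraph (star a) hc using 1
    refine Prod.ext (Prod.ext ?_ ?_) (funext fun j => (hcd j).symm)
    · simp [distributeEdges_apply, Prod.fst_sum, quadMap_apply]
    · simp [distributeEdges_apply, Prod.snd_sum, quadMap_apply]
  · refine ⟨combineEdges_mem_potentialGraph hV a hwpot, ?_⟩
    obtain ⟨c, hc⟩ := mem_sobolevStar_iff.1 hwdom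
    refine hP _ c ?_
    convert sum_smul_restrictEdge_mem_edgeGraph a hc using 1
    refine Prod.ext (Prod.ext ?_ ?_) rfl
    · simp [combineEdges_apply, Prod.fst_sum, quadMap_apply]
    · simp [combineEdges_apply, Prod.snd_sum, quadMap_apply]

lemma sum_restrictEdge_mem_eigenspace (hV : ∀ j x, 0 < x → V (j, x) = f x) {E : ℝ}
    {ψ : Lp ℂ 2 (starMeasure N)}
    (hψ : ψ ∈ (schrodingerPencil _).eigenspace (formGraph (sobolevStarSubmodule N) V) E) :
    ∑ j, restrictEdge j ψ ∈ (schrodingerPencil _).eigenspace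
      (formGraph (sobolevStarSubmodule 1) fun q => f q.2) E := by
  obtain ⟨w, hw, rfl⟩ := hψ
  refine ⟨_, combineEdges_mem_eigenvectors hV 1 (P := sobolevStarSubmodule 1)
    (fun u c hc => mem_sobolevStar_iff.2 ⟨_, hc⟩) (fun u hu => ?_) hw, ?_⟩
  · obtain ⟨c, hc⟩ := mem_sobolevStar_iff.1 hu
    exact ⟨c, c, hc, fun j => by simp⟩
  · change (combineEdges 1 w).1 = _
    simp only [combineEdges_apply, Prod.fst_sum, quadMap_apply, Pi.one_apply, one_smul]
    rfl

lemma restrictEdge_sub_mem_eigenspace (hV : ∀ j x, 0 < x → V (j, x) = f x) (i j : Fin N) {E : ℝ}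
    {ψ : Lp ℂ 2 (starMeasure N)}
    (hψ : ψ ∈ (schrodingerPencil _).eigenspace (formGraph (sobolevStarSubmodule N) V) E) :
    restrictEdge i ψ - restrictEdge j ψ
      ∈ (schrodingerPencil _).eigenspace (formGraph (sobolevStarZero 1) fun q => f q.2) E := by
  obtain ⟨w, hw, rfl⟩ := hψ
  refine ⟨_, combineEdges_mem_eigenvectors hV (Pi.single i 1 - Pi.single j 1)
    (P := sobolevStarZero 1) (fun u c hc => mem_sobolevStarZero.2 ?_) (fun u hu => ?_) hw, ?_⟩
  · convert hc using 3
    simp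
  · exact ⟨0, 0, hu, fun _ => mul_zero _⟩
  · change (combineEdges _ w).1 = _
    simp only [combineEdges_apply, quadMap_apply, Pi.sub_apply, sub_smul, Finset.sum_sub_distrib,
      Pi.single_apply, ite_smul, one_smul, zero_smul, Finset.sum_ite_eq',
      Finset.mem_univ, if_true]
    rfl

theorem multiplicity_star_le [NeZero N] (hV : ∀ j x, 0 < x → V (j, x) = f x) (E : ℝ) :
    (schrodingerPencil _).multiplicity (formGraph (sobolevStarSubmodule N) V) E
      ≤ (schrodingerPencil _).multiplicity
          (formGraph (sobolevStarSubmodule 1) fun q => f q.2) E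
        + (N - 1 : ℕ) * (schrodingerPencil _).multiplicity
          (formGraph (sobolevStarZero 1) fun q => f q.2) E := by
  set S := (schrodingerPencil _).eigenspace (formGraph (sobolevStarSubmodule N) V) E
  set SN := (schrodingerPencil _).eigenspace (formGraph (sobolevStarSubmodule 1) fun q => f q.2) E
  set SD := (schrodingerPencil _).eigenspace (formGraph (sobolevStarZero 1) fun q => f q.2) E
  let L : S →ₗ[ℂ] SN × ({j : Fin N // j ≠ 0} → SD) :=
    (((∑ j, restrictEdge j).domRestrict S).codRestrict SN fun ψ => by
      simpa using sum_restrictEdge_mem_eigenspace hV ψ.2).prod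
    (LinearMap.pi fun j => ((restrictEdge j.1 - restrictEdge 0).domRestrict S).codRestrict SD
      fun ψ => restrictEdge_sub_mem_eigenspace hV j.1 0 ψ.2)
  have hL : Function.Injective L := by
    rw [← LinearMap.ker_eq_bot, LinearMap.ker_eq_bot']
    intro ψ hψ
    have hsum : (∑ j, restrictEdge (N := N) j) ψ.1 = 0 :=
      congrArg Subtype.val (congrArg Prod.fst hψ)
    have heq (j : Fin N) : restrictEdge j ψ.1 = restrictEdge 0 ψ.1 := by
      by_cases hj : j = 0
      · rw [hj]
      · exact sub_eq_zero.1
          (congrArg Subtype.val (congrFun (congrArg Prod.snd hψ) ⟨j, hj⟩))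
    rw [LinearMap.sum_apply, Finset.sum_congr rfl fun j _ => heq j, Finset.sum_const,
      Finset.card_univ, Fintype.card_fin, ← Nat.cast_smul_eq_nsmul ℂ, smul_eq_zero] at hsum
    have hzero := hsum.resolve_left (Nat.cast_ne_zero.2 (NeZero.ne N))
    exact Subtype.ext (eq_zero_of_restrictEdge_eq_zero fun j => (heq j).trans hzero)
  have hrank := LinearMap.rank_le_of_injective L hL
  rw [rank_prod', rank_fun] at hrank
  simpa [HermitianPencil.multiplicity, Fintype.card_subtype_compl] using
    Cardinal.toENat.monotone' hrank

end Decomposition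

section Sides

/-! ### Restriction to a half-line and extension from a half-line -/

lemma units_mul_units_mul (s : ℤˣ) (x : ℝ) : (s : ℝ) * (s * x) = x := by
  rcases Int.units_eq_one_or s with rfl | rfl <;> simp

lemma abs_units_mul (s : ℤˣ) (x : ℝ) : |(s : ℝ) * x| = |x| := by
  rcases Int.units_eq_one_or s with rfl | rfl <;> simp

lemma measurePreserving_units_mul (s : ℤˣ) :
    MeasurePreserving (fun x : ℝ => (s : ℝ) * x) volume volume := by
  rcases Int.units_eq_one_or s with rfl | rfl
  · simpa [Function.id_def] using MeasurePreserving.id (volume : Measure ℝ)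
  · simpa using Measure.measurePreserving_neg (volume : Measure ℝ)

lemma ae_real_iff_forall_units {p : ℝ → Prop} :
    (∀ᵐ x, p x) ↔ ∀ s : ℤˣ, ∀ᵐ x ∂(volume.restrict (Ioi (0 : ℝ))), p (s * x) := by
  refine ⟨fun h s => ae_restrict_of_ae
    ((measurePreserving_units_mul s).quasiMeasurePreserving.ae h), fun h => ?_⟩
  have hside (s : ℤˣ) : ∀ᵐ x : ℝ, 0 < s * x → p x := by
    filter_upwards [(measurePreserving_units_mul s).quasiMeasurePreserving.ae
      ((ae_restrict_iff' measurableSet_Ioi).1 (h s))] with x hx hpos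
    simpa only [units_mul_units_mul] using hx hpos
  filter_upwards [hside 1, hside (-1), Measure.ae_ne volume 0] with x hpos hneg hx
  rcases hx.lt_or_gt with hlt | hgt
  · exact hneg (by simpa using hlt)
  · exact hpos (by simpa using hgt)

lemma isTransfer_restrictSide (s : ℤˣ) :
    IsTransfer (fun q : Fin 1 × ℝ => s * q.2) univ (starMeasure 1) volume where
  measurable := by fun_prop
  measurableSet := MeasurableSet.univ
  map_le := by
    rw [Measure.restrict_univ, starMeasure_eq_sum 1, Fin.sum_univ_one,
      Measure.map_map (by fun_prop) measurable_prodMk_left]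
    exact (Measure.map_mono Measure.restrict_le_self (by fun_prop)).trans
      (measurePreserving_units_mul s).map_eq.le

lemma map_units_mul_restrict_side (s : ℤˣ) :
    ((volume : Measure ℝ).restrict {x | 0 < s * x}).map (fun x : ℝ => ((0 : Fin 1), s * x))
      = starMeasure 1 := by
  have h := ((measurePreserving_units_mul s).restrict_preimage (s := Ioi 0)
    measurableSet_Ioi).map_eq
  rw [starMeasure_eq_sum 1, Fin.sum_univ_one, ← h,
    Measure.map_map measurable_prodMk_left (by fun_prop)]
  rfl

lemma isTransfer_extendSide (s : ℤˣ) :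
    IsTransfer (fun x : ℝ => ((0 : Fin 1), s * x)) {x | 0 < s * x} volume (starMeasure 1) where
  measurable := by fun_prop
  measurableSet := measurableSet_lt measurable_const (by fun_prop)
  map_le := (map_units_mul_restrict_side s).le

/-- The restriction of a function on the line to the half-line with sign `s`. -/
def restrictSide (s : ℤˣ) : Lp ℂ 2 (volume : Measure ℝ) →ₗ[ℂ] Lp ℂ 2 (starMeasure 1) :=
  transferLp (isTransfer_restrictSide s)

/-- The extension by zero of a function on the half-line with sign `s`. -/
def extendSide (s : ℤˣ) : Lp ℂ 2 (starMeasure 1) →ₗ[ℂ] Lp ℂ 2 (volume : Measure ℝ) :=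
  transferLp (isTransfer_extendSide s)

lemma inner_extendSide (s : ℤˣ) (f : Lp ℂ 2 (starMeasure 1)) (g : Lp ℂ 2 (volume : Measure ℝ)) :
    inner ℂ (extendSide s f) g = inner ℂ f (restrictSide s g) :=
  inner_transferLp_left _ _ (map_units_mul_restrict_side s)
    (fun x _ => units_mul_units_mul s x) f g

lemma ae_restrictSide (s : ℤˣ) (f : Lp ℂ 2 (volume : Measure ℝ)) :
    ∀ᵐ x ∂(volume.restrict (Ioi (0 : ℝ))), restrictSide s f (0, x) = f (s * x) := by
  filter_upwards [ae_starMeasure_iff.1 (coeFn_transferLp (isTransfer_restrictSide s) f) 0]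
    with x hx
  rw [restrictSide, hx, indicator_univ, Function.comp_apply]

lemma restrictSide_extendSide (s t : ℤˣ) (f : Lp ℂ 2 (starMeasure 1)) :
    restrictSide s (extendSide t f) = if s = t then f else 0 := by
  refine Lp.ext (ae_starMeasure_iff.2 fun j => ?_)
  obtain rfl : j = 0 := Subsingleton.elim _ _
  filter_upwards [ae_restrictSide s (extendSide t f),
    ae_real_iff_forall_units.1 (coeFn_transferLp (isTransfer_extendSide t) f) s,
    ae_starMeasure_iff.1 (Lp.coeFn_zero ℂ 2 (starMeasure 1)) 0,
    ae_restrict_mem measurableSet_Ioi] with x hrestrict hextend hzero (hx : 0 < x)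
  rw [Pi.zero_apply] at hzero
  rw [hrestrict, extendSide, hextend]
  rcases eq_or_ne s t with rfl | hst
  · simp [units_mul_units_mul, hx]
  · have hts : (t : ℝ) * (s * x) = -x := by
      rw [Int.units_ne_iff_eq_neg.1 hst]
      simpa using units_mul_units_mul t x
    simp [hst, hts, hx.le, hzero.symm]

lemma intervalIntegral_units_mul (s : ℤˣ) (f : ℝ → ℂ) (x : ℝ) :
    ∫ t in (0 : ℝ)..s * x, f t = ((s : ℝ) : ℂ) * ∫ t in (0 : ℝ)..x, f (s * t) := by
  rcases Int.units_eq_one_or s with rfl | rfl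
  · simp
  · simp [intervalIntegral.integral_symm 0 (-x)]

lemma restrictSide_mem_edgeGraph_iff (s : ℤˣ)
    {u : Lp ℂ 2 (volume : Measure ℝ) × Lp ℂ 2 (volume : Measure ℝ)} {c : ℂ} :
    ((restrictSide s u.1, ((s : ℝ) : ℂ) • restrictSide s u.2), fun _ => c) ∈ edgeGraph 1 ↔
      ∀ᵐ x ∂(volume.restrict (Ioi (0 : ℝ))),
        u.1 (s * x) = c + ∫ t in (0 : ℝ)..s * x, u.2 t := by
  rw [mem_edgeGraph, ae_starMeasure_iff, Unique.forall_iff, Fin.default_eq_zero]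
  refine eventually_congr ?_
  filter_upwards [ae_restrictSide s u.1, ae_restrict_mem measurableSet_Ioi] with x hfst hx
  have hint : ∫ t in (0 : ℝ)..x, restrictSide s u.2 (0, t) = ∫ t in (0 : ℝ)..x, u.2 (s * t) := by
    refine intervalIntegral.integral_congr_ae ?_
    filter_upwards [(ae_restrict_iff' measurableSet_Ioi).1 (ae_restrictSide s u.2)] with t ht htx
    rw [uIoc_of_le (le_of_lt hx)] at htx
    exact ht htx.1
  rw [hfst, inner_smul_right, ← intervalIntegral_edge 0 hx, hint, intervalIntegral_units_mul]

lemma mem_sobolevLine_iff {u : Lp ℂ 2 (volume : Measure ℝ) × Lp ℂ 2 (volume : Measure ℝ)} :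
    u ∈ sobolevLine ↔ ∃ c : ℂ, ∀ s : ℤˣ,
      ((restrictSide s u.1, ((s : ℝ) : ℂ) • restrictSide s u.2), fun _ => c) ∈ edgeGraph 1 := by
  simp only [restrictSide_mem_edgeGraph_iff]
  exact exists_congr fun c => ae_real_iff_forall_units

/-- `H¹(ℝ)` as a subspace. -/
def sobolevLineSubmodule :
    Submodule ℂ (Lp ℂ 2 (volume : Measure ℝ) × Lp ℂ 2 (volume : Measure ℝ)) where
  carrier := sobolevLine
  add_mem' := by
    intro u v hu hv
    rw [mem_sobolevLine_iff] at hu hv ⊢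
    obtain ⟨c, hc⟩ := hu
    obtain ⟨d, hd⟩ := hv
    refine ⟨c + d, fun s => ?_⟩
    convert (edgeGraph 1).add_mem (hc s) (hd s) using 1
    simp only [Prod.fst_add, Prod.snd_add, map_add, smul_add]
    rfl
  zero_mem' := mem_sobolevLine_iff.2 ⟨0, fun s => by
    simp only [Prod.fst_zero, Prod.snd_zero, map_zero, smul_zero]
    exact (edgeGraph 1).zero_mem⟩
  smul_mem' := by
    intro z u hu
    rw [mem_sobolevLine_iff] at hu ⊢
    obtain ⟨c, hc⟩ := hu
    refine ⟨z * c, fun s => ?_⟩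
    convert (edgeGraph 1).smul_mem z (hc s) using 1
    simp only [Prod.smul_fst, Prod.smul_snd, map_smul, smul_comm _ z]
    rfl

lemma integrable_of_forall_units {g : ℝ → ℝ}
    (hg : ∀ s : ℤˣ, Integrable (fun q : Fin 1 × ℝ => g (s * q.2)) (starMeasure 1)) :
    Integrable g := by
  have hside (s : ℤˣ) : IntegrableOn g {x | 0 < s * x} := by
    have h := ((hg s).mono_measure (isTransfer_extendSide s).map_le).comp_measurable
      (isTransfer_extendSide s).measurable
    simpa only [IntegrableOn, Function.comp_def, units_mul_units_mul] using h
  rw [← integrableOn_univ]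
  refine ((hside 1).union (hside (-1))).congr_set_ae ?_
  filter_upwards [Measure.ae_ne volume 0] with x hx
  refine propext ⟨fun _ => ?_, fun _ => mem_univ x⟩
  exact hx.lt_or_gt.symm.imp (fun h => by simpa using h) fun h => by simpa using h

lemma integrable_negPart_mul_norm_sq_line {V : ℝ → ℝ} {p : ℝ≥0∞} (hV : AEMeasurable V)
    (hp1 : 1 ≤ p) (hp : p ≠ ∞) (hVp : MemLp (fun x => (V x)⁻) p volume)
    {u : Lp ℂ 2 (volume : Measure ℝ) × Lp ℂ 2 (volume : Measure ℝ)} (hu : u ∈ sobolevLine) :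
    Integrable (fun x => (V x)⁻ * ‖u.1 x‖ ^ 2) volume := by
  obtain ⟨c, hc⟩ := mem_sobolevLine_iff.1 hu
  refine integrable_of_forall_units fun s => ?_
  have hmap : (starMeasure 1).map (fun q : Fin 1 × ℝ => (s : ℝ) * q.2) ≤ volume := by
    simpa only [Measure.restrict_univ] using (isTransfer_restrictSide s).map_le
  have hVs : AEMeasurable (fun q : Fin 1 × ℝ => V (s * q.2)) (starMeasure 1) :=
    (hV.mono_measure hmap).comp_measurable (by fun_prop)
  have hVsp : MemLp (fun q : Fin 1 × ℝ => (V (s * q.2))⁻) p (starMeasure 1) :=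
    (hVp.mono_measure hmap).comp_of_map (by fun_prop)
  refine (((isFormCompact_star hp1 hp hVsp).integrable (D := sobolevStarSubmodule 1) hVs
    (mem_sobolevStar_iff.2 ⟨c, hc s⟩))).congr (ae_starMeasure_iff.2 fun j => ?_)
  obtain rfl : j = 0 := Subsingleton.elim _ _
  filter_upwards [ae_restrictSide s u.1] with x hx
  rw [hx]

end Sides

section EvenLine

/-! ### Eigenvalues of even potentials on the line -/

variable {f : ℝ → ℝ}

lemma inner_restrictSide (s : ℤˣ) (f : Lp ℂ 2 (volume : Measure ℝ)) (g : Lp ℂ 2 (starMeasure 1)) :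
    inner ℂ (restrictSide s f) g = inner ℂ f (extendSide s g) := by
  rw [← inner_conj_symm, ← inner_extendSide, inner_conj_symm]

/-- The combination with coefficients `a` of the restrictions to the two half-lines. -/
def combineSides (a : ℤˣ → ℂ) :
    Quad (Lp ℂ 2 (volume : Measure ℝ)) →ₗ[ℂ] Quad (Lp ℂ 2 (starMeasure 1)) :=
  ∑ s : ℤˣ, a s • quadMap s (restrictSide s)

/-- The function on the line which is `a s` times a given function on the half-line with
sign `s`. -/
def distributeSides (a : ℤˣ → ℂ) :
    Quad (Lp ℂ 2 (starMeasure 1)) →ₗ[ℂ] Quad (Lp ℂ 2 (volume : Measure ℝ)) :=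
  ∑ s : ℤˣ, a s • quadMap s (extendSide s)

lemma combineSides_apply (a : ℤˣ → ℂ) (w : Quad (Lp ℂ 2 (volume : Measure ℝ))) :
    combineSides a w = ∑ s : ℤˣ, a s • quadMap s (restrictSide s) w := by
  simp only [combineSides, LinearMap.sum_apply, LinearMap.smul_apply]

lemma distributeSides_apply (a : ℤˣ → ℂ) (w : Quad (Lp ℂ 2 (starMeasure 1))) :
    distributeSides a w = ∑ s : ℤˣ, a s • quadMap s (extendSide s) w := by
  simp only [distributeSides, LinearMap.sum_apply, LinearMap.smul_apply]

lemma shift_combineSides_star (a : ℤˣ → ℂ) (E : ℝ) (u : Quad (Lp ℂ 2 (volume : Measure ℝ)))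
    (w : Quad (Lp ℂ 2 (starMeasure 1))) :
    (schrodingerPencil _).shift E (combineSides (star a) u) w
      = (schrodingerPencil _).shift E u (distributeSides a w) := by
  simp only [combineSides_apply, distributeSides_apply, map_sum, map_smul, map_smulₛₗ,
    Pi.star_apply, RCLike.star_def, Complex.conj_conj, sum_apply, smul_apply,
    shift_quadMap_left (inner_restrictSide _)]

lemma combineSides_mem_potentialGraph (a : ℤˣ → ℂ) {w : Quad (Lp ℂ 2 (volume : Measure ℝ))}
    (hw : w ∈ potentialGraph volume fun x => f |x|) :
    combineSides a w ∈ potentialGraph (starMeasure 1) fun q => f q.2 := by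
  rw [combineSides_apply]
  refine Submodule.sum_mem _ fun s _ => Submodule.smul_mem _ _
    (quadMap_transferLp_mem_potentialGraph _ ?_ _ hw)
  filter_upwards [ae_starMeasure_pos 1] with q hq _
  rw [abs_units_mul, abs_of_pos hq]

lemma distributeSides_mem_potentialGraph (a : ℤˣ → ℂ) {w : Quad (Lp ℂ 2 (starMeasure 1))}
    (hw : w ∈ potentialGraph (starMeasure 1) fun q => f q.2) :
    distributeSides a w ∈ potentialGraph volume fun x => f |x| := by
  rw [distributeSides_apply]
  refine Submodule.sum_mem _ fun s _ => Submodule.smul_mem _ _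
    (quadMap_transferLp_mem_potentialGraph _ (Eventually.of_forall fun x hx => ?_) _ hw)
  rw [← abs_units_mul s x, abs_of_pos (show 0 < (s : ℝ) * x from hx)]

lemma restrictSide_sum_smul_extendSide (a : ℤˣ → ℂ) (s : ℤˣ) (f : Lp ℂ 2 (starMeasure 1)) :
    restrictSide s (∑ t, a t • extendSide t f) = a s • f := by
  simp only [map_sum, map_smul, restrictSide_extendSide, smul_ite, smul_zero, Finset.sum_ite_eq,
    Finset.mem_univ, if_true]

lemma distributeSides_mem_sobolevLine {a : ℤˣ → ℂ} {w : Quad (Lp ℂ 2 (starMeasure 1))} {c d : ℂ}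
    (hw : ((w.1, w.2.1), fun _ => c) ∈ edgeGraph 1) (had : ∀ s, a s * c = d) :
    ((distributeSides a w).1, (distributeSides a w).2.1) ∈ sobolevLine := by
  refine mem_sobolevLine_iff.2 ⟨d, fun s => ?_⟩
  have hfst : (distributeSides a w).1 = ∑ t, a t • extendSide t w.1 := by
    simp [distributeSides_apply, quadMap_apply]
  have hsnd : (distributeSides a w).2.1
      = ∑ t : ℤˣ, (a t * ((t : ℝ) : ℂ)) • extendSide t w.2.1 := by
    simp [distributeSides_apply, quadMap_apply, mul_smul]
  have hsign : ((s : ℝ) : ℂ) * (a s * ((s : ℝ) : ℂ)) = a s := by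
    rcases Int.units_eq_one_or s with rfl | rfl <;> simp
  convert (edgeGraph 1).smul_mem (a s) hw using 1
  refine Prod.ext (Prod.ext ?_ ?_) (funext fun _ => (had s).symm)
  · exact hfst ▸ restrictSide_sum_smul_extendSide a s w.1
  · simp only [hsnd, restrictSide_sum_smul_extendSide (fun t : ℤˣ => a t * ((t : ℝ) : ℂ)),
      smul_smul, hsign]
    rfl

lemma combineSides_mem_edgeGraph (a : ℤˣ → ℂ) {w : Quad (Lp ℂ 2 (volume : Measure ℝ))}
    (hw : (w.1, w.2.1) ∈ sobolevLine) :
    ∃ c : ℂ, (((combineSides a w).1, (combineSides a w).2.1), fun _ => (∑ s, a s) * c)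
      ∈ edgeGraph 1 := by
  obtain ⟨c, hc⟩ := mem_sobolevLine_iff.1 hw
  refine ⟨c, ?_⟩
  convert (edgeGraph 1).sum_mem (t := Finset.univ) fun s _ =>
    (edgeGraph 1).smul_mem (a s) (hc s) using 1
  refine Prod.ext (Prod.ext ?_ ?_) (funext fun i => ?_)
  · simp [combineSides_apply, quadMap_apply]
  · simp [combineSides_apply, quadMap_apply]
  · simp [add_mul]

lemma distributeSides_mem_eigenvectors {a : ℤˣ → ℂ}
    {P : Submodule ℂ (Lp ℂ 2 (starMeasure 1) × Lp ℂ 2 (starMeasure 1))}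
    (hP : ∀ u c, (u, fun _ => (∑ s, conj (a s)) * c) ∈ edgeGraph 1 → u ∈ P)
    (hP' : ∀ u ∈ P, ∃ c d : ℂ, (u, fun _ => c) ∈ edgeGraph 1 ∧ ∀ s, a s * c = d) {E : ℝ}
    {w : Quad (Lp ℂ 2 (starMeasure 1))}
    (hw : w ∈ (schrodingerPencil _).eigenvectors (formGraph P fun q => f q.2) E) :
    distributeSides a w
      ∈ (schrodingerPencil _).eigenvectors (formGraph sobolevLineSubmodule fun x => f |x|) E := by
  obtain ⟨hwpot, hwdom⟩ := mem_formGraph.1 (HermitianPencil.mem_eigenvectors.1 hw).1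
  refine HermitianPencil.map_mem_eigenvectors (fun u hu => ?_) (shift_combineSides_star a E) hw ?_
  · obtain ⟨c, hc⟩ := combineSides_mem_edgeGraph (star a) hu.2
    exact ⟨combineSides_mem_potentialGraph _ hu.1, hP _ c hc⟩
  · obtain ⟨c, d, hc, hcd⟩ := hP' _ hwdom
    exact ⟨distributeSides_mem_potentialGraph a hwpot, distributeSides_mem_sobolevLine hc hcd⟩

lemma sum_extendSide_mem_eigenspace {E : ℝ} {ψ : Lp ℂ 2 (starMeasure 1)}
    (hψ : ψ ∈ (schrodingerPencil _).eigenspace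
      (formGraph (sobolevStarSubmodule 1) fun q => f q.2) E) :
    ∑ s, extendSide s ψ
      ∈ (schrodingerPencil _).eigenspace (formGraph sobolevLineSubmodule fun x => f |x|) E := by
  obtain ⟨w, hw, rfl⟩ := hψ
  refine ⟨_, distributeSides_mem_eigenvectors (a := 1) (P := sobolevStarSubmodule 1)
    (fun u c hc => mem_sobolevStar_iff.2 ⟨_, hc⟩) (fun u hu => ?_) hw, ?_⟩
  · obtain ⟨c, hc⟩ := mem_sobolevStar_iff.1 hu
    exact ⟨c, c, hc, fun _ => one_mul c⟩
  · change (distributeSides 1 w).1 = _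
    simp only [distributeSides_apply, Prod.fst_sum, quadMap_apply, Pi.one_apply, one_smul]
    rfl

lemma sum_smul_extendSide_mem_eigenspace {E : ℝ} {ψ : Lp ℂ 2 (starMeasure 1)}
    (hψ : ψ ∈ (schrodingerPencil _).eigenspace (formGraph (sobolevStarZero 1) fun q => f q.2) E) :
    ∑ s : ℤˣ, ((s : ℝ) : ℂ) • extendSide s ψ
      ∈ (schrodingerPencil _).eigenspace (formGraph sobolevLineSubmodule fun x => f |x|) E := by
  obtain ⟨w, hw, rfl⟩ := hψ
  refine ⟨_, distributeSides_mem_eigenvectors (a := fun s => ((s : ℝ) : ℂ))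
    (P := sobolevStarZero 1) (fun u c hc => mem_sobolevStarZero.2 ?_)
    (fun u hu => ⟨0, 0, hu, fun _ => mul_zero _⟩) hw, ?_⟩
  · convert hc using 3
    simp
  · change (distributeSides _ w).1 = _
    simp only [distributeSides_apply, Prod.fst_sum, quadMap_apply, Prod.smul_fst]
    rfl

theorem multiplicity_add_le_multiplicity_line (f : ℝ → ℝ) (E : ℝ) :
    (schrodingerPencil _).multiplicity (formGraph (sobolevStarSubmodule 1) fun q => f q.2) E
        + (schrodingerPencil _).multiplicity (formGraph (sobolevStarZero 1) fun q => f q.2) E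
      ≤ (schrodingerPencil _).multiplicity (formGraph sobolevLineSubmodule fun x => f |x|) E := by
  set S := (schrodingerPencil _).eigenspace (formGraph sobolevLineSubmodule fun x => f |x|) E
  set SN := (schrodingerPencil _).eigenspace (formGraph (sobolevStarSubmodule 1) fun q => f q.2) E
  set SD := (schrodingerPencil _).eigenspace (formGraph (sobolevStarZero 1) fun q => f q.2) E
  let L : SN × SD →ₗ[ℂ] S :=
    (((∑ s, extendSide s).domRestrict SN).codRestrict S fun ψ => by
        simpa using sum_extendSide_mem_eigenspace ψ.2).coprod
      (((∑ s : ℤˣ, ((s : ℝ) : ℂ) • extendSide s).domRestrict SD).codRestrict S fun φ => by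
        simpa using sum_smul_extendSide_mem_eigenspace φ.2)
  have hL : Function.Injective L := by
    rw [← LinearMap.ker_eq_bot, LinearMap.ker_eq_bot']
    rintro ⟨ψ, φ⟩ h
    have hzero : ∑ s : ℤˣ, (1 : ℂ) • extendSide s ψ.1
        + ∑ s : ℤˣ, ((s : ℝ) : ℂ) • extendSide s φ.1 = 0 := by
      simpa [L] using congrArg Subtype.val h
    have hside (s : ℤˣ) : ψ.1 + ((s : ℝ) : ℂ) • φ.1 = 0 := by
      have h := congrArg (restrictSide s) hzero
      rwa [map_add, map_zero, restrictSide_sum_smul_extendSide fun _ => 1, one_smul,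
        restrictSide_sum_smul_extendSide fun t : ℤˣ => ((t : ℝ) : ℂ)] at h
    have hpos : ψ.1 + φ.1 = 0 := by simpa using hside 1
    have hneg : ψ.1 = φ.1 := by simpa [add_neg_eq_zero] using hside (-1)
    rw [hneg, ← two_smul ℂ, smul_eq_zero] at hpos
    have hφ := hpos.resolve_left two_ne_zero
    exact Prod.ext (Subtype.ext (hneg.trans hφ)) (Subtype.ext hφ)
  have hrank := LinearMap.rank_le_of_injective L hL
  rw [rank_prod'] at hrank
  simpa [HermitianPencil.multiplicity] using Cardinal.toENat.monotone' hrank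

end EvenLine

section LineToStar

/-! ### The constant on the line bounds the constant on the star graph -/

lemma countBelow_le_countBelow {m n : ℝ → ℕ∞} (h : ∀ x, m x ≤ n x) (E : ℝ) :
    countBelow m E ≤ countBelow n E := by
  rw [← ENat.toENNReal_le, toENNReal_countBelow, toENNReal_countBelow]
  exact ENNReal.tsum_le_tsum fun x =>
    indicator_le_indicator (ENat.toENNReal_le.2 (h x))

lemma countBelow_add_mul (m n : ℝ → ℕ∞) (c : ℕ∞) (E : ℝ) :
    countBelow (fun x => m x + c * n x) E = countBelow m E + c * countBelow n E := by
  rw [← ENat.toENNReal_inj, ENat.toENNReal_add, ENat.toENNReal_mul, toENNReal_countBelow,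
    toENNReal_countBelow, toENNReal_countBelow, ← ENNReal.tsum_mul_left, ← ENNReal.tsum_add]
  refine tsum_congr fun x => ?_
  by_cases hx : x ∈ Iic E <;> simp [hx]

lemma IsAdmissiblePotential.aemeasurable {X : Type*} [TopologicalSpace X]
    [SecondCountableTopology X] [MeasurableSpace X] {μ : Measure X} {V : X → ℝ}
    (hV : IsAdmissiblePotential μ V) : AEMeasurable V μ := by
  obtain ⟨⟨p, -, -, hp⟩, hloc⟩ := hV
  refine (hloc.aestronglyMeasurable.aemeasurable.sub hp.aestronglyMeasurable.aemeasurable).congr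
    (Eventually.of_forall fun x => ?_)
  exact posPart_sub_negPart (V x)

variable {N : ℕ}

lemma memLp_comp_abs {F : Type*} [NormedAddCommGroup F] {g : Fin N × ℝ → F} {p : ℝ≥0∞}
    (hg : MemLp g p (starMeasure N)) (j : Fin N) : MemLp (fun x : ℝ => g (j, |x|)) p volume := by
  have hedge : MemLp (fun q : Fin 1 × ℝ => g (j, q.2)) p (starMeasure 1) := by
    simpa [Function.comp_def] using (isTransfer_restrictEdge j).memLp hg
  refine (memLp_congr_ae ?_).1 (((isTransfer_extendSide 1).memLp hedge).add
    ((isTransfer_extendSide (-1)).memLp hedge))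
  filter_upwards [Measure.ae_ne volume 0] with x hx
  rcases hx.lt_or_gt with h | h
  · simp [indicator, h, h.le, abs_of_neg]
  · simp [indicator, h, h.le, abs_of_pos]

lemma IsAdmissiblePotential.comp_abs {V : Fin N × ℝ → ℝ}
    (hV : IsAdmissiblePotential (starMeasure N) V) (j : Fin N) :
    IsAdmissiblePotential volume fun x : ℝ => V (j, |x|) := by
  obtain ⟨⟨p, hp1, hp, hpV⟩, hloc⟩ := hV
  refine ⟨⟨p, hp1, hp, memLp_comp_abs hpV j⟩, locallyIntegrable_iff.2 fun K hK => ?_⟩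
  obtain ⟨R, hR⟩ := hK.isBounded.subset_closedBall 0
  set B : Set (Fin N × ℝ) := univ ×ˢ Icc (-R) R
  have hB : MeasurableSet B := MeasurableSet.univ.prod measurableSet_Icc
  have hstar : MemLp (B.indicator fun q => (V q)⁺) 1 (starMeasure N) :=
    memLp_one_iff_integrable.2 ((integrable_indicator_iff hB).2
      (hloc.integrableOn_isCompact (isCompact_univ.prod isCompact_Icc)))
  have hline : IntegrableOn (fun x : ℝ => (V (j, |x|))⁺) (Icc (-R) R) := by
    rw [← integrable_indicator_iff measurableSet_Icc]
    refine (memLp_one_iff_integrable.1 (memLp_comp_abs hstar j)).congr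
      (Eventually.of_forall fun x => ?_)
    have habs : |x| ∈ Icc (-R) R ↔ x ∈ Icc (-R) R := by
      rw [mem_Icc, mem_Icc, ← abs_le, ← abs_le, abs_abs]
    simp only [B, indicator, mem_prod, mem_univ, true_and, habs]
  refine hline.mono_set fun x hx => ?_
  rw [mem_Icc, ← abs_le]
  exact mem_closedBall_zero_iff.1 (hR hx)

lemma lintegral_comp_abs (g : ℝ → ℝ≥0∞) :
    ∫⁻ x : ℝ, g |x| = 2 * ∫⁻ x in Ioi (0 : ℝ), g x := by
  have hpos : ∫⁻ x in Ioi (0 : ℝ), g |x| = ∫⁻ x in Ioi (0 : ℝ), g x :=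
    setLIntegral_congr_fun measurableSet_Ioi fun x hx => by rw [abs_of_pos hx]
  have hneg : ∫⁻ x in Iio (0 : ℝ), g |x| = ∫⁻ x in Ioi (0 : ℝ), g |x| := by
    simpa using (Measure.measurePreserving_neg (volume : Measure ℝ)).setLIntegral_comp_preimage_emb
      (MeasurableEquiv.neg ℝ).measurableEmbedding (fun x => g |x|) (Ioi 0)
  rw [← lintegral_add_compl _ (measurableSet_Ioi (a := (0 : ℝ))), compl_Ioi,
    ← setLIntegral_congr Iio_ae_eq_Iic, hneg, hpos, two_mul]

lemma lintegral_starMeasure_radial {g : Fin N × ℝ → ℝ≥0∞} {f : ℝ → ℝ≥0∞}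
    (hg : ∀ j x, 0 < x → g (j, x) = f x) :
    ∫⁻ x, g x ∂(starMeasure N) = N * ∫⁻ x in Ioi (0 : ℝ), f x := by
  rw [lintegral_starMeasure, Finset.sum_congr rfl fun j _ =>
    setLIntegral_congr_fun measurableSet_Ioi (hg j), Finset.sum_const, Finset.card_univ,
    Fintype.card_fin, nsmul_eq_mul]

lemma two_mul_countBelow_star_le (hN : 2 ≤ N) {V : Fin N × ℝ → ℝ} {f : ℝ → ℝ}
    (hVf : ∀ j x, 0 < x → V (j, x) = f x) {p : ℝ≥0∞} (hp1 : 1 ≤ p) (hp : p ≠ ∞)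
    (hf : MemLp (fun q : Fin 1 × ℝ => (f q.2)⁻) p (starMeasure 1)) {E : ℝ} (hE : E < 0) :
    2 * countBelow ((schrodingerPencil _).multiplicity (formGraph (sobolevStarSubmodule N) V)) E
      ≤ N * countBelow ((schrodingerPencil _).multiplicity
          (formGraph sobolevLineSubmodule fun x => f |x|)) E := by
  have : NeZero N := ⟨by omega⟩
  set n := countBelow ((schrodingerPencil _).multiplicity
    (formGraph (sobolevStarSubmodule 1) fun q => f q.2)) E
  set d := countBelow ((schrodingerPencil _).multiplicity
    (formGraph (sobolevStarZero 1) fun q => f q.2)) E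
  have hstar := countBelow_le_countBelow (multiplicity_star_le hVf) E
  rw [countBelow_add_mul] at hstar
  have hline : n + 1 * d ≤ countBelow ((schrodingerPencil _).multiplicity
      (formGraph sobolevLineSubmodule fun x => f |x|)) E := by
    rw [← countBelow_add_mul]
    exact countBelow_le_countBelow (fun x => by
      simpa only [one_mul] using multiplicity_add_le_multiplicity_line f x) E
  have hdn : d ≤ n :=
    ((isFormCompact_star hp1 hp hf).isCoerciveAt (D := sobolevStarSubmodule 1)
      hE).countBelow_multiplicity_mono (isClosed_formGraph (isClosed_sobolevStar zero_lt_one) _)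
      fun w hw => ⟨hw.1, sobolevStarZero_le hw.2⟩
  obtain ⟨M, rfl⟩ := Nat.exists_eq_add_of_le' hN
  calc _ ≤ 2 * (n + (M + 1 : ℕ) * d) := by gcongr; exact hstar
    _ = 2 * n + (M + 2) * d + M * d := by push_cast; ring
    _ ≤ 2 * n + (M + 2) * d + M * n := by gcongr
    _ = (M + 2 : ℕ) * (n + 1 * d) := by push_cast; ring
    _ ≤ _ := by gcongr

lemma two_mul_negTrace_star_le (hN : 2 ≤ N) {V : Fin N × ℝ → ℝ}
    (hV : IsAdmissiblePotential (starMeasure N) V) {j : Fin N}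
    (hr : ∀ i x, 0 < x → V (i, x) = V (j, x)) {γ : ℝ} (hγ : 0 < γ) :
    2 * negTrace (sobolevStar N) V γ ≤ N * negTrace sobolevLine (fun x => V (j, |x|)) γ := by
  have hW := hV.comp_abs j
  obtain ⟨q, hq1, hq, hqW⟩ := hW.1
  obtain ⟨p, hp1, hp, hpV⟩ := hV.1
  have hpedge : MemLp (fun q : Fin 1 × ℝ => (V (j, q.2))⁻) p (starMeasure 1) := by
    simpa [Function.comp_def] using (isTransfer_restrictEdge j).memLp hpV
  have hstar := negTrace_eq_lintegral_countBelow (D := sobolevStarSubmodule N) hV.aemeasurable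
    (fun u hu => (isFormCompact_star hp1 hp hpV).integrable hV.aemeasurable hu) hγ
  have hline := negTrace_eq_lintegral_countBelow (D := sobolevLineSubmodule) hW.aemeasurable
    (fun u hu => integrable_negPart_mul_norm_sq_line hW.aemeasurable hq1 hq hqW hu) hγ
  change negTrace (sobolevStar N) V γ = _ at hstar
  change negTrace sobolevLine _ γ = _ at hline
  rw [hstar, hline, ← lintegral_const_mul' _ _ ENNReal.ofNat_ne_top,
    ← lintegral_const_mul' _ _ (ENNReal.natCast_ne_top N)]
  refine setLIntegral_mono' measurableSet_Ioi fun s hs => ?_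
  have hcount := two_mul_countBelow_star_le (f := fun x => V (j, x)) hN hr hp1 hp hpedge
    (neg_lt_zero.2 (Real.rpow_pos_of_pos hs (1 / γ)))
  simpa using ENat.toENNReal_le.2 hcount

theorem star_bound_of_line_bound (hN : 2 ≤ N) {γ : ℝ} (hγ : 0 < γ) {C : ℝ≥0∞}
    (hC : ∀ V : ℝ → ℝ, IsAdmissiblePotential volume V →
      negTrace sobolevLine V γ ≤ C * ∫⁻ x, ENNReal.ofReal ((V x)⁻ ^ (γ + 1 / 2)))
    {V : Fin N × ℝ → ℝ} (hV : IsAdmissiblePotential (starMeasure N) V) (hr : IsRadial V) :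
    negTrace (sobolevStar N) V γ
      ≤ C * ∫⁻ x, ENNReal.ofReal ((V x)⁻ ^ (γ + 1 / 2)) ∂(starMeasure N) := by
  set j : Fin N := ⟨0, by omega⟩
  have hbound := hC _ (hV.comp_abs j)
  rw [lintegral_comp_abs fun x => ENNReal.ofReal ((V (j, x))⁻ ^ (γ + 1 / 2))] at hbound
  rw [lintegral_starMeasure_radial fun i x hx => by rw [hr i j x hx]]
  set I := ∫⁻ x in Ioi (0 : ℝ), ENNReal.ofReal ((V (j, x))⁻ ^ (γ + 1 / 2))
  refine (ENNReal.mul_le_mul_iff_right two_ne_zero ENNReal.ofNat_ne_top).1 ?_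
  calc 2 * negTrace (sobolevStar N) V γ
      ≤ N * negTrace sobolevLine (fun x => V (j, |x|)) γ :=
        two_mul_negTrace_star_le hN hV (fun i x => hr i j x) hγ
    _ ≤ N * (C * (2 * I)) := by gcongr
    _ = 2 * (C * (N * I)) := by ring

end LineToStar

section Multiplication

/-! ### Cutoffs -/

variable {X : Type*} [MeasurableSpace X] {μ : Measure X}

lemma memLp_mul_of_abs_le_one {b : X → ℝ} (hb : Measurable b) (hb1 : ∀ x, |b x| ≤ 1)
    (f : Lp ℂ 2 μ) : MemLp (fun x => (b x : ℂ) * f x) 2 μ := by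
  refine (Lp.memLp f).mono ((Complex.measurable_ofReal.comp hb).aestronglyMeasurable.mul
    (Lp.aestronglyMeasurable f)) (Eventually.of_forall fun x => ?_)
  rw [norm_mul, Complex.norm_real, Real.norm_eq_abs]
  exact mul_le_of_le_one_left (norm_nonneg _) (hb1 x)

/-- Multiplication by a function bounded by `1`. -/
def mulLp {b : X → ℝ} (hb : Measurable b) (hb1 : ∀ x, |b x| ≤ 1) (f : Lp ℂ 2 μ) : Lp ℂ 2 μ :=
  (memLp_mul_of_abs_le_one hb hb1 f).toLp _

lemma coeFn_mulLp {b : X → ℝ} (hb : Measurable b) (hb1 : ∀ x, |b x| ≤ 1) (f : Lp ℂ 2 μ) :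
    mulLp hb hb1 f =ᵐ[μ] fun x => (b x : ℂ) * f x := MemLp.coeFn_toLp _

lemma norm_sub_sq_mulLp {b : X → ℝ} (hb : Measurable b) (hb1 : ∀ x, |b x| ≤ 1) (c : ℝ)
    (f : Lp ℂ 2 μ) :
    ‖mulLp hb hb1 f - (c : ℂ) • f‖ ^ 2 = ∫ x, (b x - c) ^ 2 * ‖f x‖ ^ 2 ∂μ := by
  rw [← Complex.ofReal_inj, Complex.ofReal_pow, ← integral_complex_ofReal]
  refine (inner_self_eq_norm_sq_to_K (𝕜 := ℂ) (mulLp hb hb1 f - (c : ℂ) • f)).symm.trans ?_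
  refine (L2.inner_def (𝕜 := ℂ) _ _).trans (integral_congr_ae ?_)
  filter_upwards [Lp.coeFn_sub (mulLp hb hb1 f) ((c : ℂ) • f), Lp.coeFn_smul (c : ℂ) f,
    coeFn_mulLp hb hb1 f] with x hsub hsmul hmul
  rw [hsub, Pi.sub_apply, hsmul, hmul, Pi.smul_apply, smul_eq_mul, ← sub_mul,
    inner_self_eq_norm_sq_to_K, norm_mul, ← Complex.ofReal_sub, Complex.norm_real,
    Real.norm_eq_abs, ← RCLike.ofReal_pow, mul_pow, sq_abs]
  rfl

lemma tendsto_mulLp {b : ℕ → X → ℝ} (hb : ∀ n, Measurable (b n)) (hb1 : ∀ n x, |b n x| ≤ 1)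
    {c : ℝ} (hbc : ∀ x, Tendsto (fun n => b n x) atTop (𝓝 c)) (f : Lp ℂ 2 μ) :
    Tendsto (fun n => mulLp (hb n) (hb1 n) f) atTop (𝓝 ((c : ℂ) • f)) := by
  have hint : Integrable (fun x => ‖f x‖ ^ 2) μ :=
    (memLp_two_iff_integrable_sq_norm (Lp.aestronglyMeasurable f)).1 (Lp.memLp f)
  have hbound (n : ℕ) (x : X) : (b n x - c) ^ 2 ≤ 2 ^ 2 := by
    have hc : |c| ≤ 1 := le_of_tendsto' (hbc x).abs fun n => hb1 n x
    exact sq_le_sq' (by linarith [abs_le.1 (hb1 n x), abs_le.1 hc])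
      (by linarith [abs_le.1 (hb1 n x), abs_le.1 hc])
  have hlim : Tendsto (fun n => ∫ x, (b n x - c) ^ 2 * ‖f x‖ ^ 2 ∂μ) atTop
      (𝓝 (∫ _, (0 : ℝ) ∂μ)) := by
    refine tendsto_integral_of_dominated_convergence (fun x => 2 ^ 2 * ‖f x‖ ^ 2) (fun n => ?_)
      (hint.const_mul _) (fun n => Eventually.of_forall fun x => ?_)
      (Eventually.of_forall fun x => ?_)
    · exact (((hb n).sub_const c).pow_const 2).aestronglyMeasurable.mul hint.aestronglyMeasurable
    · rw [Real.norm_of_nonneg (by positivity)]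
      exact mul_le_mul_of_nonneg_right (hbound n x) (sq_nonneg _)
    · simpa using (((hbc x).sub_const c).pow 2).mul_const (‖f x‖ ^ 2)
  simp only [integral_zero, ← norm_sub_sq_mulLp (hb _) (hb1 _)] at hlim
  rw [tendsto_iff_norm_sub_tendsto_zero]
  simpa [Real.sqrt_sq (norm_nonneg _)] using hlim.sqrt

end Multiplication

section ProductRule

open scoped NNReal

variable {f g : ℝ → ℂ}

lemma absolutelyContinuousOnInterval_ofReal {f : ℝ → ℝ} {a b : ℝ}
    (hf : AbsolutelyContinuousOnInterval f a b) :
    AbsolutelyContinuousOnInterval (fun x => (f x : ℂ)) a b := by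
  simpa using hf.fun_smul (g := fun _ => (1 : ℂ))
    (LipschitzWith.const 1).lipschitzOnWith.absolutelyContinuousOnInterval

lemma absolutelyContinuousOnInterval_integral (hg : ∀ a b, IntervalIntegrable g volume a b)
    (a b : ℝ) : AbsolutelyContinuousOnInterval (fun x => ∫ t in a..x, g t) a b := by
  have hre := IntervalIntegrable.absolutelyContinuousOnInterval_intervalIntegral
    (f := fun t => (g t).re) ⟨(hg a b).1.re, (hg a b).2.re⟩ left_mem_uIcc
  have him := IntervalIntegrable.absolutelyContinuousOnInterval_intervalIntegral
    (f := fun t => (g t).im) ⟨(hg a b).1.im, (hg a b).2.im⟩ left_mem_uIcc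
  have hsplit (x : ℝ) : ∫ t in a..x, g t
      = (∫ t in a..x, (g t).re : ℝ) + Complex.I • (∫ t in a..x, (g t).im : ℝ) := by
    have hre_comm := Complex.reCLM.intervalIntegral_comp_comm (hg a x)
    have him_comm := Complex.imCLM.intervalIntegral_comp_comm (hg a x)
    simp only [Complex.reCLM_apply, Complex.imCLM_apply] at hre_comm him_comm
    rw [hre_comm, him_comm, smul_eq_mul, mul_comm, Complex.re_add_im]
  simp only [hsplit]
  exact (absolutelyContinuousOnInterval_ofReal hre).fun_add
    ((absolutelyContinuousOnInterval_ofReal him).const_smul Complex.I)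

lemma integral_eq_sub_of_ae_hasDerivAt {a b : ℝ} (hf : AbsolutelyContinuousOnInterval f a b)
    (hg : ∀ a b, IntervalIntegrable g volume a b)
    (hderiv : ∀ᵐ x, x ∈ uIcc a b → HasDerivAt f (g x) x) : ∫ t in a..b, g t = f b - f a := by
  obtain ⟨C, hC⟩ := (hf.fun_sub (absolutelyContinuousOnInterval_integral hg a b))
    |>.const_of_ae_hasDerivAt_zero <| by
      filter_upwards [hderiv, (hg a b).ae_hasDerivAt_integral] with x hfx hgx hx
      simpa only [sub_self] using (hfx hx).fun_sub (hgx hx a left_mem_uIcc)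
  have hconst := (hC b right_mem_uIcc).trans (hC a left_mem_uIcc).symm
  rw [intervalIntegral.integral_same, sub_zero] at hconst
  linear_combination -hconst

lemma primitive_eq_add_integral (hg : ∀ a b, IntervalIntegrable g volume a b) (c : ℂ) (a : ℝ) :
    primitive c g = fun x => primitive c g a + ∫ t in a..x, g t := by
  ext x
  rw [primitive, primitive, add_assoc,
    intervalIntegral.integral_add_adjacent_intervals (hg 0 a) (hg a x)]

lemma absolutelyContinuousOnInterval_primitive (hg : ∀ a b, IntervalIntegrable g volume a b)
    (c : ℂ) (a b : ℝ) : AbsolutelyContinuousOnInterval (primitive c g) a b := by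
  rw [primitive_eq_add_integral hg c a]
  exact (LipschitzWith.const _).lipschitzOnWith.absolutelyContinuousOnInterval.fun_add
    (absolutelyContinuousOnInterval_integral hg a b)

lemma ae_hasDerivAt_primitive (hg : ∀ a b, IntervalIntegrable g volume a b) (c : ℂ) (a b : ℝ) :
    ∀ᵐ x, x ∈ uIcc a b → HasDerivAt (primitive c g) (g x) x := by
  filter_upwards [(hg a b).ae_hasDerivAt_integral] with x hgx hx
  rw [primitive_eq_add_integral hg c a]
  exact (hgx hx a left_mem_uIcc).const_add _

lemma intervalIntegrable_mul_add_deriv_mul_primitive {φ : ℝ → ℝ} {K : ℝ≥0}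
    (hφ : LipschitzWith K φ) (hg : ∀ a b, IntervalIntegrable g volume a b) (c : ℂ) (a b : ℝ) :
    IntervalIntegrable (fun t => φ t * g t + (deriv φ t : ℝ) * primitive c g t) volume a b := by
  have hφac := (hφ.lipschitzOnWith (s := uIcc a b)).absolutelyContinuousOnInterval
  refine ((hg a b).continuousOn_mul ?_).add (IntervalIntegrable.mul_continuousOn
    ⟨hφac.intervalIntegrable_deriv.1.ofReal, hφac.intervalIntegrable_deriv.2.ofReal⟩
    (absolutelyContinuousOnInterval_primitive hg c a b).continuousOn)
  exact (Complex.continuous_ofReal.comp hφ.continuous).continuousOn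

lemma integral_mul_add_deriv_mul_primitive {φ : ℝ → ℝ} {K : ℝ≥0} (hφ : LipschitzWith K φ)
    (hg : ∀ a b, IntervalIntegrable g volume a b) (c : ℂ) (a b : ℝ) :
    ∫ t in a..b, (φ t * g t + (deriv φ t : ℝ) * primitive c g t)
      = φ b * primitive c g b - φ a * primitive c g a := by
  have hφac := (hφ.lipschitzOnWith (s := uIcc a b)).absolutelyContinuousOnInterval
  refine integral_eq_sub_of_ae_hasDerivAt (f := fun x => φ x * primitive c g x)
    ((absolutelyContinuousOnInterval_ofReal hφac).fun_smul
      (absolutelyContinuousOnInterval_primitive hg c a b))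
    (intervalIntegrable_mul_add_deriv_mul_primitive hφ hg c) ?_
  filter_upwards [hφ.ae_differentiableAt_real, ae_hasDerivAt_primitive hg c a b] with x hφx hgx hx
  exact (hφx.hasDerivAt.ofReal_comp.fun_mul (hgx hx)).congr_deriv (add_comm _ _)

end ProductRule

section Cutoff

/-- The piecewise linear cutoff which vanishes on `(-∞, a]` and equals `1` on `[a + 1, ∞)`. -/
def cutoff (a x : ℝ) : ℝ := min 1 (max 0 (x - a))

lemma lipschitzWith_cutoff (a : ℝ) : LipschitzWith 1 (cutoff a) := by
  have h := ((LipschitzWith.id.sub (LipschitzWith.const a)).const_max 0).const_min 1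
  rwa [add_zero] at h

lemma cutoff_of_le {a x : ℝ} (hx : x ≤ a) : cutoff a x = 0 := by
  simp [cutoff, hx]

lemma cutoff_of_ge {a x : ℝ} (hx : a + 1 ≤ x) : cutoff a x = 1 :=
  min_eq_left (le_max_of_le_right (by linarith))

lemma abs_cutoff_le (a x : ℝ) : |cutoff a x| ≤ 1 := by
  rw [abs_of_nonneg (le_min zero_le_one (le_max_left _ _))]
  exact min_le_left _ _

lemma abs_deriv_cutoff_le (a x : ℝ) : |deriv (cutoff a) x| ≤ 1 :=
  norm_deriv_le_of_lipschitz (lipschitzWith_cutoff a)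

lemma deriv_cutoff_of_lt {a x : ℝ} (hx : x < a) : deriv (cutoff a) x = 0 := by
  have hzero : cutoff a =ᶠ[𝓝 x] fun _ => 0 :=
    (eventually_lt_nhds hx).mono fun y hy => cutoff_of_le hy.le
  rw [hzero.deriv_eq, deriv_const]

lemma deriv_cutoff_of_gt {a x : ℝ} (hx : a + 1 < x) : deriv (cutoff a) x = 0 := by
  have hone : cutoff a =ᶠ[𝓝 x] fun _ => 1 :=
    (eventually_gt_nhds hx).mono fun y hy => cutoff_of_ge hy.le
  rw [hone.deriv_eq, deriv_const]

lemma eventually_neg_natCast_add_one_lt (x : ℝ) : ∀ᶠ n : ℕ in atTop, -(n : ℝ) + 1 < x :=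
  (tendsto_natCast_atTop_atTop.eventually_gt_atTop (1 - x)).mono fun n hn => by linarith

lemma tendsto_cutoff (x : ℝ) : Tendsto (fun n : ℕ => cutoff (-n) x) atTop (𝓝 1) :=
  tendsto_const_nhds.congr' ((eventually_neg_natCast_add_one_lt x).mono fun _ hn =>
    (cutoff_of_ge hn.le).symm)

lemma tendsto_deriv_cutoff (x : ℝ) : Tendsto (fun n : ℕ => deriv (cutoff (-n)) x) atTop (𝓝 0) :=
  tendsto_const_nhds.congr' ((eventually_neg_natCast_add_one_lt x).mono fun _ hn =>
    (deriv_cutoff_of_gt hn).symm)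

/-- Multiplication of a function on the line by the cutoff at `a`. -/
def cutoffMul (a : ℝ) : Lp ℂ 2 (volume : Measure ℝ) → Lp ℂ 2 (volume : Measure ℝ) :=
  mulLp (lipschitzWith_cutoff a).continuous.measurable (abs_cutoff_le a)

/-- Multiplication of a function on the line by the derivative of the cutoff at `a`. -/
def cutoffDerivMul (a : ℝ) : Lp ℂ 2 (volume : Measure ℝ) → Lp ℂ 2 (volume : Measure ℝ) :=
  mulLp (measurable_deriv _) (abs_deriv_cutoff_le a)

lemma ae_cutoffMul (a : ℝ) (f : Lp ℂ 2 (volume : Measure ℝ)) :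
    ∀ᵐ x, cutoffMul a f x = cutoff a x * f x := coeFn_mulLp _ _ f

lemma ae_cutoffDerivMul (a : ℝ) (f : Lp ℂ 2 (volume : Measure ℝ)) :
    ∀ᵐ x, cutoffDerivMul a f x = (deriv (cutoff a) x : ℝ) * f x := coeFn_mulLp _ _ f

/-- Multiplication by the cutoff at `a` on quadruples; the derivative follows the product rule. -/
def cutoffQuad (a : ℝ) (w : Quad (Lp ℂ 2 (volume : Measure ℝ))) :
    Quad (Lp ℂ 2 (volume : Measure ℝ)) :=
  (cutoffMul a w.1, cutoffMul a w.2.1 + cutoffDerivMul a w.1, cutoffMul a w.2.2.1,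
    cutoffMul a w.2.2.2)

lemma tendsto_cutoffQuad (w : Quad (Lp ℂ 2 (volume : Measure ℝ))) :
    Tendsto (fun n : ℕ => cutoffQuad (-n) w) atTop (𝓝 w) := by
  have hmul (f : Lp ℂ 2 (volume : Measure ℝ)) :
      Tendsto (fun n : ℕ => cutoffMul (-n) f) atTop (𝓝 f) := by
    have h := tendsto_mulLp (fun _ => (lipschitzWith_cutoff _).continuous.measurable)
      (fun _ => abs_cutoff_le _) tendsto_cutoff f
    rwa [Complex.ofReal_one, one_smul] at h
  have hderiv : Tendsto (fun n : ℕ => cutoffDerivMul (-n) w.1) atTop (𝓝 0) := by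
    have h := tendsto_mulLp (fun _ => measurable_deriv _) (fun _ => abs_deriv_cutoff_le _)
      tendsto_deriv_cutoff w.1
    rwa [Complex.ofReal_zero, zero_smul] at h
  have hsnd := (hmul w.2.1).add hderiv
  rw [add_zero] at hsnd
  exact (hmul w.1).prodMk_nhds (hsnd.prodMk_nhds ((hmul _).prodMk_nhds (hmul _)))

lemma cutoffQuad_mem_potentialGraph (a : ℝ) {V : ℝ → ℝ} {w : Quad (Lp ℂ 2 (volume : Measure ℝ))}
    (hw : w ∈ potentialGraph volume V) : cutoffQuad a w ∈ potentialGraph volume V := by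
  have hmul {b : ℝ → ℂ} (p : Lp ℂ 2 (volume : Measure ℝ) × Lp ℂ 2 (volume : Measure ℝ))
      (hp : p ∈ mulGraph volume b) : (cutoffMul a p.1, cutoffMul a p.2) ∈ mulGraph volume b := by
    refine mem_mulGraph.2 ?_
    filter_upwards [mem_mulGraph.1 hp, ae_cutoffMul a p.1, ae_cutoffMul a p.2] with x hx hfst hsnd
    rw [hfst, hsnd, hx]
    ring
  obtain ⟨hpos, hneg⟩ := mem_potentialGraph.1 hw
  rw [mem_potentialGraph, cutoffQuad]
  exact ⟨hmul (w.1, w.2.2.1) hpos, hmul (w.1, w.2.2.2) hneg⟩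

lemma intervalIntegrable_coeFn (f : Lp ℂ 2 (volume : Measure ℝ)) (a b : ℝ) :
    IntervalIntegrable f volume a b :=
  ⟨((Lp.memLp f).restrict _).integrable one_le_two, ((Lp.memLp f).restrict _).integrable one_le_two⟩

lemma ae_cutoffQuad_eq_integral (a : ℝ) {w : Quad (Lp ℂ 2 (volume : Measure ℝ))}
    (hw : (w.1, w.2.1) ∈ sobolevLine) :
    ∀ᵐ x, (cutoffQuad a w).1 x = ∫ t in a..x, (cutoffQuad a w).2.1 t := by
  obtain ⟨c, hc⟩ := hw
  filter_upwards [hc, ae_cutoffMul a w.1] with x hx hfst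
  have hsnd : ∫ t in a..x, (cutoffQuad a w).2.1 t
      = ∫ t in a..x, (cutoff a t * w.2.1 t + (deriv (cutoff a) t : ℝ) * primitive c w.2.1 t) := by
    refine intervalIntegral.integral_congr_ae ?_
    filter_upwards [hc, Lp.coeFn_add (cutoffMul a w.2.1) (cutoffDerivMul a w.1),
      ae_cutoffMul a w.2.1, ae_cutoffDerivMul a w.1] with t ht hadd hmul hderiv _
    rw [cutoffQuad, hadd, Pi.add_apply, hmul, hderiv, ht, primitive]
  rw [hsnd, integral_mul_add_deriv_mul_primitive (lipschitzWith_cutoff a)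
    (intervalIntegrable_coeFn w.2.1), cutoff_of_le le_rfl, Complex.ofReal_zero, zero_mul, sub_zero,
    cutoffQuad, hfst, hx, primitive]

end Cutoff

section Rays

/-! ### Translation of a ray to the half-line -/

lemma isTransfer_restrictRay (a : ℝ) :
    IsTransfer (fun q : Fin 1 × ℝ => q.2 + a) univ (starMeasure 1) volume where
  measurable := by fun_prop
  measurableSet := MeasurableSet.univ
  map_le := by
    rw [Measure.restrict_univ, starMeasure_eq_sum 1, Fin.sum_univ_one,
      Measure.map_map (by fun_prop) measurable_prodMk_left]
    exact (Measure.map_mono Measure.restrict_le_self (by fun_prop)).trans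
      (measurePreserving_add_right volume a).map_eq.le

lemma map_sub_restrict_Ioi (a : ℝ) :
    ((volume : Measure ℝ).restrict (Ioi a)).map (fun x : ℝ => ((0 : Fin 1), x - a))
      = starMeasure 1 := by
  have h := ((measurePreserving_sub_right volume a).restrict_preimage (s := Ioi 0)
    measurableSet_Ioi).map_eq
  rw [preimage_sub_const_Ioi, zero_add] at h
  rw [starMeasure_eq_sum 1, Fin.sum_univ_one, ← h,
    Measure.map_map measurable_prodMk_left (by fun_prop)]
  rfl

lemma isTransfer_extendRay (a : ℝ) :
    IsTransfer (fun x : ℝ => ((0 : Fin 1), x - a)) (Ioi a) volume (starMeasure 1) where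
  measurable := by fun_prop
  measurableSet := measurableSet_Ioi
  map_le := (map_sub_restrict_Ioi a).le

/-- The restriction of a function on the line to the ray `(a, ∞)`, moved to `(0, ∞)`. -/
def restrictRay (a : ℝ) : Lp ℂ 2 (volume : Measure ℝ) →ₗ[ℂ] Lp ℂ 2 (starMeasure 1) :=
  transferLp (isTransfer_restrictRay a)

/-- The extension by zero of a function on `(0, ∞)`, moved to `(a, ∞)`. -/
def extendRay (a : ℝ) : Lp ℂ 2 (starMeasure 1) →ₗ[ℂ] Lp ℂ 2 (volume : Measure ℝ) :=
  transferLp (isTransfer_extendRay a)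

lemma inner_extendRay (a : ℝ) (f : Lp ℂ 2 (starMeasure 1)) (g : Lp ℂ 2 (volume : Measure ℝ)) :
    inner ℂ (extendRay a f) g = inner ℂ f (restrictRay a g) :=
  inner_transferLp_left _ _ (map_sub_restrict_Ioi a) (fun x _ => sub_add_cancel x a) f g

lemma ae_restrictRay (a : ℝ) (f : Lp ℂ 2 (volume : Measure ℝ)) :
    ∀ᵐ x ∂(volume.restrict (Ioi (0 : ℝ))), restrictRay a f (0, x) = f (x + a) := by
  filter_upwards [ae_starMeasure_iff.1 (coeFn_transferLp (isTransfer_restrictRay a) f) 0]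
    with x hx
  rw [restrictRay, hx, indicator_univ, Function.comp_apply]

lemma extendRay_restrictRay {a : ℝ} {f : Lp ℂ 2 (volume : Measure ℝ)}
    (hf : ∀ᵐ x, x < a → f x = 0) : extendRay a (restrictRay a f) = f := by
  refine Lp.ext ?_
  have hrestrict := (measurePreserving_sub_right volume a).quasiMeasurePreserving.ae
    ((ae_restrict_iff' measurableSet_Ioi).1 (ae_restrictRay a f))
  filter_upwards [coeFn_transferLp (isTransfer_extendRay a) (restrictRay a f), hrestrict, hf,
    Measure.ae_ne volume a] with x hextend hrestrict hzero hne
  rw [extendRay, hextend]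
  rcases hne.lt_or_gt with hlt | hgt
  · rw [indicator_of_notMem (notMem_Ioi.2 hlt.le), hzero hlt]
  · rw [indicator_of_mem (mem_Ioi.2 hgt), Function.comp_apply, hrestrict (sub_pos.2 hgt),
      sub_add_cancel]

lemma restrictRay_mem_sobolevStarZero {a : ℝ} {f g : Lp ℂ 2 (volume : Measure ℝ)}
    (h : ∀ᵐ x, f x = ∫ t in a..x, g t) :
    (restrictRay a f, restrictRay a g) ∈ sobolevStarZero 1 := by
  rw [mem_sobolevStarZero, mem_edgeGraph, ae_starMeasure_iff, Unique.forall_iff,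
    Fin.default_eq_zero]
  filter_upwards [ae_restrictRay a f, ae_restrict_mem measurableSet_Ioi, ae_restrict_of_ae
    ((measurePreserving_add_right volume a).quasiMeasurePreserving.ae h)] with x hfst hx hprim
  have hint : ∫ t in (0 : ℝ)..x, restrictRay a g (0, t) = ∫ t in (0 : ℝ)..x, g (t + a) := by
    refine intervalIntegral.integral_congr_ae ?_
    filter_upwards [(ae_restrict_iff' measurableSet_Ioi).1 (ae_restrictRay a g)] with t ht htx
    rw [uIoc_of_le (le_of_lt hx)] at htx
    exact ht htx.1
  rw [hfst, hprim, ← intervalIntegral_edge 0 hx, hint, intervalIntegral.integral_comp_add_right,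
    zero_add, zero_add]

lemma quadMap_extendRay_restrictRay_cutoffQuad (a : ℝ)
    (w : Quad (Lp ℂ 2 (volume : Measure ℝ))) :
    quadMap 1 (extendRay a) (quadMap 1 (restrictRay a) (cutoffQuad a w)) = cutoffQuad a w := by
  have hmul (f : Lp ℂ 2 (volume : Measure ℝ)) :
      extendRay a (restrictRay a (cutoffMul a f)) = cutoffMul a f :=
    extendRay_restrictRay ((ae_cutoffMul a f).mono fun x hx hxa => by
      rw [hx, cutoff_of_le hxa.le, Complex.ofReal_zero, zero_mul])
  have hderiv : extendRay a (restrictRay a (cutoffDerivMul a w.1)) = cutoffDerivMul a w.1 :=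
    extendRay_restrictRay ((ae_cutoffDerivMul a w.1).mono fun x hx hxa => by
      rw [hx, deriv_cutoff_of_lt hxa, Complex.ofReal_zero, zero_mul])
  simp only [quadMap_apply, cutoffQuad, Complex.ofReal_one, one_smul, map_add, hmul, hderiv]

lemma energy_restrictRay_cutoffQuad {ι : Type*} [Fintype ι] (a E : ℝ)
    (w : ι → Quad (Lp ℂ 2 (volume : Measure ℝ))) (z : ι → ℂ) :
    (schrodingerPencil _).energy E (∑ i, z i • quadMap 1 (restrictRay a) (cutoffQuad a (w i)))
      = (schrodingerPencil _).energy E (∑ i, z i • cutoffQuad a (w i)) := by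
  have hsum : ∑ i, z i • quadMap 1 (restrictRay a) (cutoffQuad a (w i))
      = quadMap 1 (restrictRay a) (∑ i, z i • cutoffQuad a (w i)) := by
    simp only [map_sum, map_smul]
  have hback : quadMap 1 (extendRay a) (quadMap 1 (restrictRay a) (∑ i, z i • cutoffQuad a (w i)))
      = ∑ i, z i • cutoffQuad a (w i) := by
    simp only [map_sum, map_smul, quadMap_extendRay_restrictRay_cutoffQuad]
  rw [hsum, HermitianPencil.energy, ← shift_quadMap_left (inner_extendRay a), hback,
    HermitianPencil.energy]

lemma quadMap_restrictRay_cutoffQuad_mem_formGraph (a : ℝ) {V : ℝ → ℝ}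
    {w : Quad (Lp ℂ 2 (volume : Measure ℝ))} (hw : w ∈ formGraph sobolevLineSubmodule V) :
    quadMap 1 (restrictRay a) (cutoffQuad a w)
      ∈ formGraph (sobolevStarZero 1) fun q => V (q.2 + a) := by
  obtain ⟨hpot, hsob⟩ := mem_formGraph.1 hw
  refine mem_formGraph.2 ⟨quadMap_transferLp_mem_potentialGraph (isTransfer_restrictRay a)
    (Eventually.of_forall fun _ _ => rfl) 1 (cutoffQuad_mem_potentialGraph a hpot), ?_⟩
  have hsob := restrictRay_mem_sobolevStarZero (ae_cutoffQuad_eq_integral a hsob)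
  rw [quadMap_apply, Complex.ofReal_one, one_smul]
  exact hsob

end Rays

section StarToLine

/-! ### The constant on the star graph bounds the constant on the line -/

variable {N : ℕ}

lemma restrictEdge_extendEdge (i j : Fin N) (f : Lp ℂ 2 (starMeasure 1)) :
    restrictEdge i (extendEdge j f) = if i = j then f else 0 := by
  refine Lp.ext (ae_starMeasure_iff.2 fun l => ?_)
  obtain rfl : l = 0 := Subsingleton.elim _ _
  filter_upwards [ae_restrictEdge i (extendEdge j f), ae_extendEdge i j f,
    ae_starMeasure_iff.1 (Lp.coeFn_zero ℂ 2 (starMeasure 1)) 0] with x hrestrict hextend hzero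
  rw [hrestrict, hextend]
  split_ifs with hij
  · rfl
  · rw [hzero, Pi.zero_apply]

lemma energy_sum_extendEdge (E : ℝ) (y : Fin N → Quad (Lp ℂ 2 (starMeasure 1))) :
    (schrodingerPencil _).energy E (∑ j, quadMap 1 (extendEdge j) (y j))
      = ∑ j, (schrodingerPencil _).energy E (y j) := by
  have hback (i j : Fin N) (w : Quad (Lp ℂ 2 (starMeasure 1))) :
      quadMap 1 (restrictEdge i) (quadMap 1 (extendEdge j) w) = if i = j then w else 0 := by
    simp only [quadMap_apply, Complex.ofReal_one, one_smul, restrictEdge_extendEdge]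
    split_ifs <;> rfl
  simp only [HermitianPencil.energy]
  rw [← Complex.re_sum, map_sum ((schrodingerPencil _).shift E), sum_apply]
  refine congrArg Complex.re (Finset.sum_congr rfl fun i _ => ?_)
  rw [shift_quadMap_left (inner_extendEdge i), map_sum]
  simp only [hback, Finset.sum_ite_eq, Finset.mem_univ, if_true]

lemma mul_card_le_countBelow_star (hN : 0 < N) {V : Fin N × ℝ → ℝ} {f : ℝ → ℝ}
    (hVf : ∀ j x, 0 < x → V (j, x) = f x) {E : ℝ}
    (hE : (schrodingerPencil _).IsCoerciveAt (formGraph (sobolevStarSubmodule N) V) E)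
    {ι : Type*} [Fintype ι] {w : ι → Quad (Lp ℂ 2 (starMeasure 1))}
    (hw : ∀ i, w i ∈ formGraph (sobolevStarZero 1) fun q => f q.2)
    (hneg : ∀ a : ι → ℂ, a ≠ 0 → (schrodingerPencil _).energy E (∑ i, a i • w i) < 0) :
    (N * Fintype.card ι : ℕ∞) ≤ countBelow
      ((schrodingerPencil _).multiplicity (formGraph (sobolevStarSubmodule N) V)) E := by
  set u : Fin N × ι → Quad (Lp ℂ 2 (starMeasure N)) := fun q => quadMap 1 (extendEdge q.1) (w q.2)
  have hu (q : Fin N × ι) : u q ∈ formGraph (sobolevStarSubmodule N) V := by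
    obtain ⟨hpot, hsob⟩ := mem_formGraph.1 (hw q.2)
    refine mem_formGraph.2 ⟨quadMap_extendEdge_mem_potentialGraph hVf q.1 hpot,
      sobolevStarZero_le (mem_sobolevStarZero.2 ?_)⟩
    simpa only [u, quadMap_apply, Complex.ofReal_one, one_smul, Pi.single_zero, Pi.zero_def] using
      extendEdge_mem_edgeGraph q.1 (mem_sobolevStarZero.1 hsob)
  have henergy (a : Fin N × ι → ℂ) : (schrodingerPencil _).energy E (∑ q, a q • u q)
      = ∑ j, (schrodingerPencil _).energy E (∑ i, a (j, i) • w i) := by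
    rw [← energy_sum_extendEdge]
    simp only [u, Fintype.sum_prod_type, map_sum, map_smul]
  have hedge (a : ι → ℂ) : (schrodingerPencil _).energy E (∑ i, a i • w i) ≤ 0 := by
    rcases eq_or_ne a 0 with rfl | ha
    · simp [HermitianPencil.energy]
    · exact (hneg a ha).le
  have hind : LinearIndependent ℂ u := by
    refine Fintype.linearIndependent_iff.2 fun a hsum => congrFun ?_
    by_contra ha
    obtain ⟨q, hq⟩ := Function.ne_iff.1 ha
    have hlt : (schrodingerPencil _).energy E (∑ q, a q • u q) < 0 := by
      rw [henergy]
      exact Finset.sum_neg' (fun j _ => hedge fun i => a (j, i)) ⟨q.1, Finset.mem_univ _,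
        hneg (fun i => a (q.1, i)) fun h => hq (congrFun h q.2)⟩
    simp [hsum, HermitianPencil.energy] at hlt
  have hle := hE.card_le_countBelow (isClosed_formGraph (isClosed_sobolevStar hN) V) hu hind
    fun a => (henergy a).trans_le (Finset.sum_nonpos fun j _ => hedge fun i => a (j, i))
  simpa only [Fintype.card_prod, Fintype.card_fin, Nat.cast_mul] using hle

lemma memLp_translate {F : Type*} [NormedAddCommGroup F] {g : ℝ → F} {p : ℝ≥0∞}
    (hg : MemLp g p volume) (a : ℝ) :
    MemLp (fun q : Fin N × ℝ => g (q.2 + a)) p (starMeasure N) :=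
  ((hg.comp_measurePreserving (measurePreserving_add_right volume a)).restrict (Ioi 0)).comp_snd
    Measure.count

lemma IsAdmissiblePotential.translate {V : ℝ → ℝ} (hV : IsAdmissiblePotential volume V) (a : ℝ) :
    IsAdmissiblePotential (starMeasure N) fun q => V (q.2 + a) := by
  obtain ⟨⟨p, hp1, hp, hpV⟩, hloc⟩ := hV
  refine ⟨⟨p, hp1, hp, memLp_translate hpV a⟩, locallyIntegrable_iff.2 fun K hK => ?_⟩
  have himage : IsCompact ((fun q : Fin N × ℝ => q.2 + a) '' K) := hK.image (by fun_prop)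
  have hint := memLp_one_iff_integrable.1 (memLp_translate (N := N) (memLp_one_iff_integrable.2
    ((integrable_indicator_iff himage.measurableSet).2 (hloc.integrableOn_isCompact himage))) a)
  exact (hint.integrableOn (s := K)).congr_fun
    (fun q hq => indicator_of_mem (mem_image_of_mem (fun q : Fin N × ℝ => q.2 + a) hq) _)
    hK.measurableSet

/-- The multiplicities on the star graph carrying, on every edge, the potential `V` cut off to the
left of `a` and moved to the half-line. -/
def truncatedMultiplicity (N : ℕ) (V : ℝ → ℝ) (a : ℝ) : ℝ → ℕ∞ :=
  (schrodingerPencil _).multiplicity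
    (formGraph (sobolevStarSubmodule N) fun q : Fin N × ℝ => V (q.2 + a))

lemma eventually_mul_le_countBelow_truncatedMultiplicity (hN : 0 < N) {V : ℝ → ℝ} {p : ℝ≥0∞}
    (hp1 : 1 ≤ p) (hp : p ≠ ∞) (hpV : MemLp (fun x => (V x)⁻) p volume) {E E' : ℝ} (hE : E < E')
    (hE' : E' < 0) {k : ℕ} (hk : (k : ℕ∞) ≤ countBelow
      ((schrodingerPencil _).multiplicity (formGraph sobolevLineSubmodule V)) E) :
    ∀ᶠ n : ℕ in atTop, N * k ≤ countBelow (truncatedMultiplicity N V (-n)) E' := by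
  obtain ⟨w, hw, hneg⟩ := HermitianPencil.exists_energy_neg_of_le_countBelow hk hE
  filter_upwards [HermitianPencil.eventually_energy_neg hneg fun i => tendsto_cutoffQuad (w i)]
    with n hn
  have hcoercive := (isFormCompact_star (N := N) hp1 hp (memLp_translate hpV (-n))).isCoerciveAt
    (D := sobolevStarSubmodule N) hE'
  have hcard := mul_card_le_countBelow_star (f := fun x => V (x + -n)) hN (fun _ _ _ => rfl)
    hcoercive (fun i => quadMap_restrictRay_cutoffQuad_mem_formGraph (-n) (hw i))
    fun a ha => (energy_restrictRay_cutoffQuad (-n) E' w a).trans_lt (hn a ha)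
  rwa [Fintype.card_fin] at hcard

lemma mul_toENNReal_le_of_forall_natCast_le {n : ℕ∞} {C b : ℝ≥0∞}
    (h : ∀ k : ℕ, (k : ℕ∞) ≤ n → C * k ≤ b) : C * (n : ℝ≥0∞) ≤ b := by
  induction n using ENat.recTopCoe with
  | top =>
    rw [ENat.toENNReal_top, ← ENNReal.iSup_natCast, ENNReal.mul_iSup]
    exact iSup_le fun k => h k le_top
  | coe k => exact h k le_rfl

lemma lintegral_countBelow_truncatedMultiplicity_le {γ : ℝ} (hγ : 0 < γ) {C : ℝ≥0∞}
    (hC : ∀ V : Fin N × ℝ → ℝ, IsAdmissiblePotential (starMeasure N) V → IsRadial V →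
      negTrace (sobolevStar N) V γ
        ≤ C * ∫⁻ x, ENNReal.ofReal ((V x)⁻ ^ (γ + 1 / 2)) ∂(starMeasure N))
    {V : ℝ → ℝ} (hV : IsAdmissiblePotential volume V) (a : ℝ) :
    ∫⁻ s in Ioi (0 : ℝ), (countBelow (truncatedMultiplicity N V a) (-(s ^ (1 / γ))) : ℝ≥0∞)
      ≤ C * (N * ∫⁻ x, ENNReal.ofReal ((V x)⁻ ^ (γ + 1 / 2))) := by
  have hVa := hV.translate (N := N) a
  obtain ⟨p, hp1, hp, hpV⟩ := hVa.1
  have htrace := negTrace_eq_lintegral_countBelow (D := sobolevStarSubmodule N) hVa.aemeasurable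
    (fun u hu => (isFormCompact_star hp1 hp hpV).integrable hVa.aemeasurable hu) hγ
  refine htrace.symm.trans_le ((hC _ hVa fun _ _ _ _ => rfl).trans ?_)
  rw [lintegral_starMeasure_radial (f := fun x => ENNReal.ofReal ((V (x + a))⁻ ^ (γ + 1 / 2)))
    fun _ _ _ => rfl]
  have hle : ∫⁻ x in Ioi (0 : ℝ), ENNReal.ofReal ((V (x + a))⁻ ^ (γ + 1 / 2))
      ≤ ∫⁻ x, ENNReal.ofReal ((V x)⁻ ^ (γ + 1 / 2)) :=
    (setLIntegral_le_lintegral _ _).trans_eq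
      (lintegral_add_right_eq_self (μ := volume) (fun x => ENNReal.ofReal ((V x)⁻ ^ (γ + 1 / 2))) a)
  exact mul_le_mul' le_rfl (mul_le_mul' le_rfl hle)

lemma mul_lintegral_countBelow_div_le_liminf (hN : 0 < N) {γ : ℝ} {V : ℝ → ℝ}
    (hV : IsAdmissiblePotential volume V) {t : ℝ} (ht : t ∈ Ioo (0 : ℝ) 1) :
    N * ∫⁻ s in Ioi (0 : ℝ), (countBelow ((schrodingerPencil _).multiplicity
        (formGraph sobolevLineSubmodule V)) (-(s ^ (1 / γ)) / t) : ℝ≥0∞)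
      ≤ liminf (fun n : ℕ => ∫⁻ s in Ioi (0 : ℝ),
        (countBelow (truncatedMultiplicity N V (-n)) (-(s ^ (1 / γ))) : ℝ≥0∞)) atTop := by
  obtain ⟨p, hp1, hp, hpV⟩ := hV.1
  have hmeas (n : ℕ) : Measurable fun s : ℝ =>
      (countBelow (truncatedMultiplicity N V (-n)) (-(s ^ (1 / γ))) : ℝ≥0∞) :=
    (ENat.toENNReal_mono.comp (countBelow_mono _)).measurable.comp (by fun_prop)
  rw [← lintegral_const_mul' _ _ (ENNReal.natCast_ne_top N)]
  refine (setLIntegral_mono' measurableSet_Ioi fun s hs => ?_).trans (lintegral_liminf_le hmeas)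
  have hs_pos : 0 < s ^ (1 / γ) := Real.rpow_pos_of_pos hs _
  have hlt : -(s ^ (1 / γ)) / t < -(s ^ (1 / γ)) := by
    rw [div_lt_iff₀ ht.1]
    nlinarith [ht.2]
  refine mul_toENNReal_le_of_forall_natCast_le fun k hk => le_liminf_of_le (by isBoundedDefault) ?_
  filter_upwards [eventually_mul_le_countBelow_truncatedMultiplicity hN hp1 hp hpV hlt
    (neg_lt_zero.2 hs_pos) hk] with n hn
  simpa using ENat.toENNReal_le.2 hn

lemma ofReal_rpow_mul_negTrace_line {V : ℝ → ℝ} (hV : IsAdmissiblePotential volume V) {γ : ℝ}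
    (hγ : 0 < γ) {t : ℝ} (ht : 0 < t) :
    ENNReal.ofReal (t ^ γ) * negTrace sobolevLine V γ
      = ∫⁻ s in Ioi (0 : ℝ), (countBelow ((schrodingerPencil _).multiplicity
          (formGraph sobolevLineSubmodule V)) (-(s ^ (1 / γ)) / t) : ℝ≥0∞) := by
  obtain ⟨p, hp1, hp, hpV⟩ := hV.1
  have htrace := negTrace_eq_lintegral_countBelow (D := sobolevLineSubmodule) hV.aemeasurable
    (fun u hu => integrable_negPart_mul_norm_sq_line hV.aemeasurable hp1 hp hpV hu) hγ
  change negTrace sobolevLine V γ = _ at htrace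
  rw [htrace, ← tsum_abs_rpow_eq_lintegral _ hγ, ← tsum_mul_abs_rpow_eq_lintegral _ hγ ht,
    ← ENNReal.tsum_mul_left]
  refine tsum_congr fun x => ?_
  rw [Real.mul_rpow ht.le (abs_nonneg _), ENNReal.ofReal_mul (Real.rpow_nonneg ht.le _)]
  ring

theorem line_bound_of_star_bound (hN : 0 < N) {γ : ℝ} (hγ : 0 < γ) {C : ℝ≥0∞}
    (hC : ∀ V : Fin N × ℝ → ℝ, IsAdmissiblePotential (starMeasure N) V → IsRadial V →
      negTrace (sobolevStar N) V γ
        ≤ C * ∫⁻ x, ENNReal.ofReal ((V x)⁻ ^ (γ + 1 / 2)) ∂(starMeasure N))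
    {V : ℝ → ℝ} (hV : IsAdmissiblePotential volume V) :
    negTrace sobolevLine V γ ≤ C * ∫⁻ x, ENNReal.ofReal ((V x)⁻ ^ (γ + 1 / 2)) := by
  set I := ∫⁻ x : ℝ, ENNReal.ofReal ((V x)⁻ ^ (γ + 1 / 2))
  have hscaled (t : ℝ) (ht : t ∈ Ioo (0 : ℝ) 1) :
      ENNReal.ofReal (t ^ γ) * negTrace sobolevLine V γ ≤ C * I := by
    have hfatou := (mul_lintegral_countBelow_div_le_liminf hN (γ := γ) hV ht).trans
      (liminf_le_of_frequently_le' (Frequently.of_forall fun n : ℕ =>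
        lintegral_countBelow_truncatedMultiplicity_le hγ hC hV (-n)))
    rw [← ofReal_rpow_mul_negTrace_line hV hγ ht.1, mul_left_comm C] at hfatou
    exact (ENNReal.mul_le_mul_iff_right (by exact_mod_cast hN.ne') (ENNReal.natCast_ne_top N)).1
      hfatou
  have hlim : Tendsto (fun t : ℝ => ENNReal.ofReal (t ^ γ) * negTrace sobolevLine V γ) (𝓝[<] 1)
      (𝓝 (ENNReal.ofReal (1 ^ γ) * negTrace sobolevLine V γ)) :=
    ENNReal.Tendsto.mul_const (ENNReal.tendsto_ofReal
      ((Real.continuousAt_rpow_const 1 γ (Or.inl one_ne_zero)).tendsto.mono_left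
        nhdsWithin_le_nhds)) (Or.inl (by simp))
  rw [Real.one_rpow, ENNReal.ofReal_one, one_mul] at hlim
  exact le_of_tendsto hlim (mem_of_superset (Ioo_mem_nhdsLT zero_lt_one) hscaled)

end StarToLine

end

theorem theorem2_general {γ : ℝ} (hγ : 0 < γ) {N : ℕ} (hN : 2 ≤ N) :
    starRadialConst γ N = lineConst γ :=
  congrArg sInf <| Set.ext fun _ =>
    ⟨fun hC _ hV _ => line_bound_of_star_bound (by omega) hγ hC hV,
      fun hC _ hV hr => star_bound_of_line_bound hN hγ (fun V hV => hC V hV trivial) hV hr⟩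

theorem theorem2 (γ : ℝ) (hγ : 1 / 2 ≤ γ) (N : ℕ) (hN : 2 ≤ N) :
    starRadialConst γ N = lineConst γ :=
  theorem2_general (by linarith) hN
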